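/- Let $d\ge 0$ and $q\ge 1$ be integers and let $Y=(Y^1,\dots,Y^d)^\top$, $Y=(Y_t)_{0\le t\le 1}$, be an $\mathbb R^d$-valued process on a probability space with $Y_0=0$ whose paths are almost surely continuous and of finite variation on $[0,1]$. Call $f:\mathbb R^q\to\mathbb R^{q\times d}$ *admissible* if its entries $f^{ij}$ are $C^2$ and $\|f(x)\|\le c(1+\|x\|)$ for some constant $c$ and all $x$. Write $f^{ij}_k=\partial f^{ij}/\partial x_k$, let $f^i$ be the $i$-th row of $f$, $Df^i=(f^{ij}_k)_{k,j}\in\mathbb R^{q\times d}$, and let $Hf^{ij}$ be the Hessian matrix of $f^{ij}$. For $x_0\in\mathbb R^q$ and $f$ admissible let $X$ be the solution of $$X_t=x_0+\int_0^t f(X_s)\,dY_s,\qquad 0\le t\le 1,$$ (pathwise Lebesgue–Stieltjes integrals), and for $n\ge1$ let $X^n$ be the Milstein scheme $$X^{n,i}_t=x_0^i+\int_0^t f^i(X^n_{n(s)})\,dY_s+\int_0^t (Y_s-Y_{n(s)})^\top f(X^n_{n(s)})^\top Df^i(X^n_{n(s)})\,dY_s,\qquad i=1,\dots,q,$$ where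 $n(s)=k/n$ for $k/n<s\le (k+1)/n$ and $n(0)=0$. Put $U^n=X^n-X$. Consider the statements: (a) for every $x_0\in\mathbb R^q$ and every admissible $f$, almost surely $\sup_{n\ge 1} n^2\int_0^1|dU^n_s|<\infty$, where $\int_0^1|dU^n_s|$ is the total variation of $U^n$ on $[0,1]$; (b) for every $x_0\in\mathbb R^q$ and every admissible $f$, almost surely $n^2U^n$ converges uniformly on $[0,1]$ to a limit $U$; (c) there is a measurable process $y=(y^1,\dots,y^d)^\top$ such that almost surely, for each $i$, $\int_0^1|y^i_s|^3\,ds<\infty$ and $Y^i_t=\int_0^t y^i_s\,ds$ for all $t\in[0,1]$. Then (a) and (c) are equivalent, and they imply (b). If moreover the paths of each $Y^i$ are almost surely nondecreasing, then (a), (b) and (c) are equivalent. Furthermore, if (c) holds with $y$, then for every $x_0$ and every admissible $f$ the limit $U=(U^1,\dots,U^q)^\top$ in (b) is almost surely the unique continuous solution on $[0,1]$ of the linear equation $U_0=0$, $$U^i_t=\int_0^t U_s^\top Df^i(X_s)\,y_s\,ds-\frac16\sum_{j=1}^d\int_0^t \bigl(y_s^\top G^{ij}(X_s)f(X_s)\,y_s\bigr)\,y^j_s\,ds,\qquad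 i=1,\dots,q,$$ where $$G^{ij}(x)=f(x)^\top Hf^{ij}(x)+\sum_{k=1}^q f^{ij}_k(x)\,[Df^k(x)]^\top .$$ -/

import Mathlib

open MeasureTheory Set Filter Topology
open scoped Matrix

noncomputable section

namespace Milstein

/-- The path `y` on `[0,1]`, extended to `ℝ` by its values at the end points. -/
def clamp (y : ℝ → ℝ) : ℝ → ℝ := fun s => y (projIcc (0 : ℝ) 1 zero_le_one s)

open Classical in
/-- The Lebesgue-Stieltjes integral `∫_{(a,b]} g dy` for `[a,b] ⊆ [0,1]` and a path `y` of
finite variation on `[0,1]` (and `0` if `y` is not of finite variation). -/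
def stieltjes (g y : ℝ → ℝ) (a b : ℝ) : ℝ :=
  if h : BoundedVariationOn (clamp y) univ then
    (h.vectorMeasure.restrict (Ioc a b)).integral g (ContinuousLinearMap.lsmul ℝ ℝ)
  else 0

/-- Continuous paths of finite variation on `[0,1]`, null at `0`. -/
def IsContinuousFV {d : ℕ} (y : ℝ → Fin d → ℝ) : Prop :=
  y 0 = 0 ∧ ContinuousOn y (Icc 0 1) ∧ BoundedVariationOn y (Icc 0 1)

/-- Matrices of `C²` functions with at most linear growth. -/
def IsCoefficient {q d : ℕ} (f : (Fin q → ℝ) → Matrix (Fin q) (Fin d) ℝ) : Prop :=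
  (∀ i j, ContDiff ℝ 2 fun x => f x i j) ∧
    ∃ c : ℝ, ∀ x i j, |f x i j| ≤ c * (1 + ‖x‖)

/-- The partial derivative `∂g/∂x_k`. -/
def partialD {q : ℕ} (k : Fin q) (g : (Fin q → ℝ) → ℝ) (x : Fin q → ℝ) : ℝ :=
  fderiv ℝ g x (Pi.single k 1)

/-- The `q × d` matrix `Df^i = (∂f^{ij}/∂x_k)_{k,j}`. -/
def Df {q d : ℕ} (f : (Fin q → ℝ) → Matrix (Fin q) (Fin d) ℝ) (i : Fin q) (x : Fin q → ℝ) :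
    Matrix (Fin q) (Fin d) ℝ :=
  Matrix.of fun k j => partialD k (fun z => f z i j) x

/-- The Hessian matrix of `g`. -/
def hess {q : ℕ} (g : (Fin q → ℝ) → ℝ) (x : Fin q → ℝ) : Matrix (Fin q) (Fin q) ℝ :=
  Matrix.of fun k l => partialD l (partialD k g) x

/-- The `d × q` matrix `G^{ij} = fᵀ Hf^{ij} + ∑_k (∂f^{ij}/∂x_k) (Df^k)ᵀ`. -/
def G {q d : ℕ} (f : (Fin q → ℝ) → Matrix (Fin q) (Fin d) ℝ) (i : Fin q) (j : Fin d)
    (x : Fin q → ℝ) : Matrix (Fin d) (Fin q) ℝ :=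
  (f x)ᵀ * hess (fun z => f z i j) x +
    ∑ k, partialD k (fun z => f z i j) x • (Df f k x)ᵀ

/-- `X` solves `X_t = x₀ + ∫_0^t f(X_s) dy_s` on `[0,1]`. -/
def IsSolution {q d : ℕ} (f : (Fin q → ℝ) → Matrix (Fin q) (Fin d) ℝ) (x₀ : Fin q → ℝ)
    (y : ℝ → Fin d → ℝ) (X : ℝ → Fin q → ℝ) : Prop :=
  ContinuousOn X (Icc 0 1) ∧
    ∀ t ∈ Icc (0 : ℝ) 1, ∀ i,
      X t i = x₀ i + ∑ j, stieltjes (fun s => f (X s) i j) (fun s => y s j) 0 t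

/-- One step of the scheme, started from `x` at time `a` and evaluated at time `t`:
`x^i + f^i(x)(y_t - y_a) + ∫_{(a,t]} (y_s - y_a)ᵀ f(x)ᵀ Df^i(x) dy_s`. -/
def step {q d : ℕ} (f : (Fin q → ℝ) → Matrix (Fin q) (Fin d) ℝ) (y : ℝ → Fin d → ℝ)
    (x : Fin q → ℝ) (a t : ℝ) : Fin q → ℝ := fun i =>
  x i + ∑ j, f x i j * (y t j - y a j) +
    ∑ l, ∑ j, ((f x)ᵀ * Df f i x) l j *
      stieltjes (fun s => y s l - y a l) (fun s => y s j) a t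

/-- The scheme at the grid points `k / n`. -/
def grid {q d : ℕ} (f : (Fin q → ℝ) → Matrix (Fin q) (Fin d) ℝ) (x₀ : Fin q → ℝ)
    (y : ℝ → Fin d → ℝ) (n : ℕ) : ℕ → Fin q → ℝ
  | 0 => x₀
  | k + 1 => step f y (grid f x₀ y n k) ((k : ℝ) / n) (((k : ℝ) + 1) / n)

/-- The continuous-time Milstein scheme `X^n_t`: one step from the grid point `k / n` with
`k / n < t ≤ (k + 1) / n` (and `k = 0` for `t = 0`). -/
def scheme {q d : ℕ} (f : (Fin q → ℝ) → Matrix (Fin q) (Fin d) ℝ) (x₀ : Fin q → ℝ)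
    (y : ℝ → Fin d → ℝ) (n : ℕ) (t : ℝ) : Fin q → ℝ :=
  step f y (grid f x₀ y n (⌈(n : ℝ) * t⌉₊ - 1)) (((⌈(n : ℝ) * t⌉₊ - 1 : ℕ) : ℝ) / n) t

/-- The linear equation for the limiting error, driven by the density `y`, on `[0,1]`. -/
def IsErrorSolution {q d : ℕ} (f : (Fin q → ℝ) → Matrix (Fin q) (Fin d) ℝ)
    (y : ℝ → Fin d → ℝ) (X U : ℝ → Fin q → ℝ) : Prop :=
  ContinuousOn U (Icc 0 1) ∧ U 0 = 0 ∧
    ∀ t ∈ Icc (0 : ℝ) 1, ∀ i,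
      U t i = (∫ s in (0 : ℝ)..t, U s ⬝ᵥ (Df f i (X s) *ᵥ y s)) -
        1 / 6 * ∑ j, ∫ s in (0 : ℝ)..t, (y s ⬝ᵥ ((G f i j (X s) * f (X s)) *ᵥ y s)) * y s j

section Paths

variable {Ω : Type*} [MeasurableSpace Ω]

/-- For every starting point and coefficient, `n² ∫_0^1 |dU^n_s|` is a.s. bounded in `n`, where
`U^n = X^n - X` is the error of the scheme. -/
def ErrorVariationBounded (P : Measure Ω) {d : ℕ} (q : ℕ) (Y : Ω → ℝ → Fin d → ℝ) : Prop :=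
  ∀ (x₀ : Fin q → ℝ) (f : (Fin q → ℝ) → Matrix (Fin q) (Fin d) ℝ), IsCoefficient f →
    ∀ X : Ω → ℝ → Fin q → ℝ, (∀ᵐ ω ∂P, IsSolution f x₀ (Y ω) (X ω)) →
      ∀ᵐ ω ∂P, ∃ C : NNReal, ∀ n : ℕ, 1 ≤ n →
        (n : ENNReal) ^ 2 *
          eVariationOn (fun t => scheme f x₀ (Y ω) n t - X ω t) (Icc 0 1) ≤ C

/-- For every starting point and coefficient, `n² U^n` converges a.s. uniformly on `[0,1]`. -/
def ErrorConverges (P : Measure Ω) {d : ℕ} (q : ℕ) (Y : Ω → ℝ → Fin d → ℝ) : Prop :=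
  ∀ (x₀ : Fin q → ℝ) (f : (Fin q → ℝ) → Matrix (Fin q) (Fin d) ℝ), IsCoefficient f →
    ∀ X : Ω → ℝ → Fin q → ℝ, (∀ᵐ ω ∂P, IsSolution f x₀ (Y ω) (X ω)) →
      ∃ U : Ω → ℝ → Fin q → ℝ, ∀ᵐ ω ∂P,
        TendstoUniformlyOn
          (fun (n : ℕ) t => (n : ℝ) ^ 2 • (scheme f x₀ (Y ω) n t - X ω t)) (U ω) atTop (Icc 0 1)

/-- `y` is a measurable process with a.s. `Y^i_t = ∫_0^t y^i_s ds` and `∫_0^1 |y^i_s|³ ds < ∞`. -/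
def IsCubicDensity (P : Measure Ω) {d : ℕ} (Y y : Ω → ℝ → Fin d → ℝ) : Prop :=
  Measurable (fun p : Ω × ℝ => y p.1 p.2) ∧
    ∀ᵐ ω ∂P, ∀ i, MemLp (fun s => y ω s i) 3 (volume.restrict (Icc 0 1)) ∧
      ∀ t ∈ Icc (0 : ℝ) 1, Y ω t i = ∫ s in (0 : ℝ)..t, y ω s i

end Paths

end Milstein

end

/-! All estimates are made for one path at a time. Suppose first that Y has a density y in L³. The
scheme is the integral against dY of `rate`, the first order expansion of f around the last grid
value, so the error U^n = X^n - X has density (rate - f(X)) y. Write rate - f(X) = (f(X^n) - f(X)) -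
(f(X^n) - rate). The first difference is linear in U^n up to O(|U^n|²). The second is the Taylor
defect of one step. With w the increments of Y since the last grid point and F their iterated
integrals, it equals Σ quad_{lm} F_{lm} + o(v²), where v is the integral of the ℓ¹ norm of y since
that point: the relation w_l w_m = F_{lm} + F_{ml} turns the symmetric second order Taylor term into
iterated integrals as well (`exists_defect_expansion`).

On a grid cell y is close in L³ to its mean, so n² F_{lm} is close to the product of two means times
θ²/2, where θ in (0,1] is the relative position in the cell, and θ²/2 has mean 1/6. Integration
against dY^j supplies a third factor, so exactly three L³ functions are multiplied and the limit is
(1/6) ∫ quad y y y (`tendsto_trilinear`); evaluating quad at y yᵀ gives the quadratic form of G f.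
Grönwall's inequality yields the order n⁻² in supremum and in variation (`exists_error_bound`). Then
n² U^n solves the limiting linear equation up to a vanishing residual, which forces uniform
convergence (`exists_volterra_limit`). A general f is replaced by a compactly supported one: X is
bounded, and the scheme of the new coefficient is so close to X that for large n it never meets the
cut-off (`exists_tame_coefficient`).

For the converse, the equation dx = x dY^j is tested. Its solution is exp(Y^j), a step of the scheme
multiplies by 1 + Δ + Δ²/2, and the local error e^Δ - 1 - Δ - Δ²/2 is at least a constant times
|Δ|³. A variation of order n⁻² thus bounds n² Σ |Δ_k|³ (`sum_cube_le_of_error_variation`). For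
nondecreasing Y all local errors push the same way, so the error at time 1 is enough
(`sum_cube_le_of_monotone`). The sum n² Σ |Δ_k|³ is the integral of the cubed difference quotient
over the grid; its boundedness makes Y^j absolutely continuous and, by Fatou, its derivative cube
integrable (`deriv_of_cubic_increments`). -/

noncomputable section

namespace Milstein

/-! ### Stieltjes integrals along continuous paths of finite variation -/

/-- An additive function of intervals that is small compared with the increments of a fixed
function on all short intervals vanishes. -/
theorem eq_zero_of_additive_of_small {Ψ : ℝ → ℝ → ℝ} {w : ℝ → ℝ}
    (hadd : ∀ a b c, 0 ≤ a → a ≤ b → b ≤ c → c ≤ 1 → Ψ a b + Ψ b c = Ψ a c)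
    (hsmall : ∀ ε > 0, ∃ δ > 0, ∀ a b, 0 ≤ a → a ≤ b → b ≤ 1 → b - a < δ →
      |Ψ a b| ≤ ε * (w b - w a))
    {a b : ℝ} (ha : 0 ≤ a) (hab : a ≤ b) (hb : b ≤ 1) : Ψ a b = 0 := by
  have key : ∀ ε > 0, |Ψ a b| ≤ ε * (w b - w a) := by
    intro ε hε
    obtain ⟨δ, hδ, h⟩ := hsmall ε hε
    -- Cut the interval into N equal pieces shorter than δ; the bounds on the pieces add up because
    -- the increments of w telescope.
    obtain ⟨N, hN⟩ := exists_nat_gt ((b - a) / δ)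
    have hN0 : (0 : ℝ) < N := lt_of_le_of_lt (div_nonneg (by linarith) hδ.le) hN
    set τ : ℕ → ℝ := fun k => a + k * ((b - a) / N) with hτ
    have hstep : (b - a) / N < δ := by
      rw [div_lt_iff₀ hδ] at hN
      rw [div_lt_iff₀ hN0]; linarith
    have hpos : 0 ≤ (b - a) / N := div_nonneg (by linarith) hN0.le
    have hsucc : ∀ k, τ (k + 1) = τ k + (b - a) / N := by
      intro k; simp only [hτ]; push_cast; ring
    have hend : τ N = b := by simp only [hτ]; field_simp; ring
    have hle : ∀ k, a ≤ τ k := fun k => by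
      simp only [hτ]; have := mul_nonneg (Nat.cast_nonneg (α := ℝ) k) hpos; linarith
    have hle1 : ∀ k, k ≤ N → τ k ≤ b := fun k hk => by
      rw [← hend]; simp only [hτ]
      have : (k : ℝ) ≤ N := by exact_mod_cast hk
      nlinarith
    have ind : ∀ k, k ≤ N → |Ψ a (τ k)| ≤ ε * (w (τ k) - w a) := by
      intro k
      induction k with
      | zero =>
        intro _
        have h0 : Ψ a a = 0 := by
          have := hadd a a a ha le_rfl le_rfl (by linarith); linarith
        simp [hτ, h0]
      | succ k ih =>
        intro hk
        have h1 := ih (by omega)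
        have h2 := h (τ k) (τ (k + 1)) (ha.trans (hle k)) (by rw [hsucc]; linarith)
          ((hle1 _ hk).trans hb) (by rw [hsucc]; linarith)
        rw [← hadd a (τ k) (τ (k + 1)) ha (hle k) (by rw [hsucc]; linarith)
          ((hle1 _ hk).trans hb)]
        refine (abs_add_le _ _).trans ?_
        linarith
    have := ind N le_rfl
    rwa [hend] at this
  have h0 : |Ψ a b| ≤ 0 := by
    refine le_of_forall_pos_le_add fun η hη => ?_
    have hw : 0 ≤ w b - w a := by
      have := (abs_nonneg _).trans (key 1 one_pos); linarith
    -- The summand 1 keeps the quotient meaningful when w does not grow on the interval.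
    have := key (η / (w b - w a + 1)) (by positivity)
    refine this.trans ?_
    rw [div_mul_eq_mul_div, div_le_iff₀ (by positivity)]
    nlinarith
  exact abs_nonpos_iff.mp h0

theorem clamp_of_mem (y : ℝ → ℝ) {s : ℝ} (hs : s ∈ Icc (0 : ℝ) 1) : clamp y s = y s := by
  simp only [clamp, projIcc_of_mem zero_le_one hs]

theorem continuous_clamp {y : ℝ → ℝ} (hy : ContinuousOn y (Icc 0 1)) : Continuous (clamp y) := by
  have h1 : Continuous ((Icc (0 : ℝ) 1).domRestrict y) := continuousOn_iff_continuous_domRestrict.1 hy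
  exact h1.comp continuous_projIcc

theorem boundedVariationOn_clamp {y : ℝ → ℝ} (hy : BoundedVariationOn y (Icc 0 1)) :
    BoundedVariationOn (clamp y) univ := by
  have h := eVariationOn.comp_le_of_monotoneOn y
    (fun s : ℝ => (projIcc (0 : ℝ) 1 zero_le_one s : ℝ)) (s := Icc 0 1) (t := univ)
    (fun a _ b _ hab => monotone_projIcc _ hab) (fun s _ => (projIcc (0 : ℝ) 1 _ s).2)
  exact ne_top_of_le_ne_top hy h

theorem isFiniteMeasure_variation_signed {α : Type*} [MeasurableSpace α]
    (μ : VectorMeasure α ℝ) : IsFiniteMeasure μ.variation := by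
  rw [← SignedMeasure.totalVariation_eq_variation]; infer_instance

theorem stieltjes_congr {g g' y y' : ℝ → ℝ} {a b : ℝ} (hg : EqOn g g' (Ioc a b))
    (hy : EqOn y y' (Icc 0 1)) : stieltjes g y a b = stieltjes g' y' a b := by
  have : clamp y = clamp y' := by
    ext s; exact hy (projIcc (0 : ℝ) 1 zero_le_one s).2
  unfold stieltjes
  generalize clamp y = Z at this
  subst this
  split_ifs
  · exact VectorMeasure.setIntegral_congr_fun hg
  · rfl

/-- Collects what is needed from the vector measure of y: its variation has a distribution function
w that dominates the increments of y, the integral is additive in the interval, and freezing the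
integrand costs at most its oscillation times the increment of w. These facts determine the integral
of a continuous function. -/
theorem exists_stieltjes_control {y : ℝ → ℝ} (hc : ContinuousOn y (Icc 0 1))
    (hv : BoundedVariationOn y (Icc 0 1)) :
    ∃ w : ℝ → ℝ, (∀ a b, 0 ≤ a → a ≤ b → b ≤ 1 → |y b - y a| ≤ w b - w a) ∧
      ∀ g : ℝ → ℝ, ContinuousOn g (Icc 0 1) →
        (∀ a b c, 0 ≤ a → a ≤ b → b ≤ c → c ≤ 1 →
          stieltjes g y a b + stieltjes g y b c = stieltjes g y a c) ∧
        ∀ a b c ε, 0 ≤ a → a ≤ b → b ≤ 1 → (∀ s ∈ Ioc a b, |g s - c| ≤ ε) →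
          |stieltjes g y a b - c * (y b - y a)| ≤ ε * (w b - w a) := by
  have hbv := boundedVariationOn_clamp hv
  set μ : VectorMeasure ℝ ℝ := hbv.vectorMeasure with hμ
  have := isFiniteMeasure_variation_signed μ
  have hIoc : ∀ a b, 0 ≤ a → a ≤ b → b ≤ 1 → μ (Ioc a b) = y b - y a := by
    intro a b ha hab hb
    -- The measure of a half-open interval is a difference of right limits; by continuity these are
    -- values.
    have hr : ∀ x, (clamp y).rightLim x = clamp y x := fun x =>
      ContinuousWithinAt.rightLim_eq (continuous_clamp hc).continuousWithinAt
    rw [hμ, hbv.vectorMeasure_Ioc hab, hr, hr, clamp_of_mem y ⟨by linarith, hb⟩,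
      clamp_of_mem y ⟨ha, by linarith⟩]
  have hw : ∀ a b, 0 ≤ a → a ≤ b → μ.variation.real (Ioc a b) =
      μ.variation.real (Ioc 0 b) - μ.variation.real (Ioc 0 a) := by
    intro a b ha hab
    rw [← Ioc_union_Ioc_eq_Ioc ha hab, measureReal_union _ measurableSet_Ioc]
    · ring
    · exact Ioc_disjoint_Ioc_of_le le_rfl
  have hst : ∀ g a b, stieltjes g y a b =
      (μ.restrict (Ioc a b)).integral g (ContinuousLinearMap.lsmul ℝ ℝ) := by
    intro g a b
    rw [stieltjes, dif_pos hbv]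
  refine ⟨fun t => μ.variation.real (Ioc 0 t), fun a b ha hab hb => ?_, fun g hg => ?_⟩
  · rw [← hIoc a b ha hab hb, ← hw a b ha hab, ← Real.norm_eq_abs]
    exact VectorMeasure.norm_measure_le_variation
  · have hint : ∀ a b, 0 ≤ a → b ≤ 1 → μ.IntegrableOn g (Ioc a b) := by
      intro a b ha hb
      change Integrable g (μ.restrict (Ioc a b)).variation
      rw [VectorMeasure.variation_restrict measurableSet_Ioc]
      have : IntegrableOn g (Icc 0 1) μ.variation := hg.integrableOn_compact isCompact_Icc
      exact this.mono_set fun s hs => ⟨ha.trans hs.1.le, hs.2.trans hb⟩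
    refine ⟨fun a b c ha hab hbc hc1 => ?_, fun a b c ε ha hab hb hε => ?_⟩
    · rw [hst, hst, hst, ← VectorMeasure.setIntegral_union _ measurableSet_Ioc measurableSet_Ioc
        (hint a b ha (by linarith)) (hint b c (by linarith) hc1), Ioc_union_Ioc_eq_Ioc hab hbc]
      exact Ioc_disjoint_Ioc_of_le le_rfl
    · have h1 : c * (y b - y a) =
          (μ.restrict (Ioc a b)).integral (fun _ => c) (ContinuousLinearMap.lsmul ℝ ℝ) := by
        rw [VectorMeasure.setIntegral_const, hIoc a b ha hab hb]; simp
      rw [hst, h1, ← VectorMeasure.integral_sub (hint a b ha hb) (by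
        change Integrable _ _; exact integrable_const c), ← hw a b ha hab, ← Real.norm_eq_abs]
      have := VectorMeasure.norm_setIntegral_le_of_norm_le_const (μ := μ) (s := Ioc a b)
        (f := fun s => g s - c) (B := ContinuousLinearMap.lsmul ℝ ℝ) (C := ε)
        (fun s hs => by simpa using hε s hs)
      refine this.trans ?_
      rw [ContinuousLinearMap.opNorm_lsmul, mul_one]

theorem continuousOn_unif {g : ℝ → ℝ} (hg : ContinuousOn g (Icc 0 1)) :
    ∀ ε > 0, ∃ δ > 0, ∀ a s, a ∈ Icc (0 : ℝ) 1 → s ∈ Icc (0 : ℝ) 1 → |s - a| < δ →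
      |g s - g a| ≤ ε := by
  intro ε hε
  have hu := isCompact_Icc.uniformContinuousOn_of_continuous hg
  obtain ⟨δ, hδ, h⟩ := Metric.uniformContinuousOn_iff.1 hu ε hε
  exact ⟨δ, hδ, fun a s ha hs has => (h s hs a ha has).le⟩

/-- The Stieltjes integral of a continuous function is characterised by additivity and by its
first order behaviour on short intervals. -/
theorem stieltjes_eq_of_additive {y g : ℝ → ℝ} (hc : ContinuousOn y (Icc 0 1))
    (hv : BoundedVariationOn y (Icc 0 1)) (hg : ContinuousOn g (Icc 0 1)) {Φ : ℝ → ℝ → ℝ}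
    {w : ℝ → ℝ}
    (hadd : ∀ a b c, 0 ≤ a → a ≤ b → b ≤ c → c ≤ 1 → Φ a b + Φ b c = Φ a c)
    (hsmall : ∀ ε > 0, ∃ δ > 0, ∀ a b, 0 ≤ a → a ≤ b → b ≤ 1 → b - a < δ →
      |Φ a b - g a * (y b - y a)| ≤ ε * (w b - w a))
    {a b : ℝ} (ha : 0 ≤ a) (hab : a ≤ b) (hb : b ≤ 1) : stieltjes g y a b = Φ a b := by
  obtain ⟨v, -, hv2⟩ := exists_stieltjes_control hc hv
  obtain ⟨hv3, hv4⟩ := hv2 g hg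
  -- Integral and candidate agree to first order on short intervals, so their difference is additive
  -- and negligible.
  have := eq_zero_of_additive_of_small (Ψ := fun a b => stieltjes g y a b - Φ a b)
    (w := fun t => v t + w t) (fun a b c h1 h2 h3 h4 => by
      simp only [← hadd a b c h1 h2 h3 h4, ← hv3 a b c h1 h2 h3 h4]; ring) (fun ε hε => by
      obtain ⟨δ, hδ, h⟩ := hsmall ε hε
      obtain ⟨δ', hδ', h'⟩ := continuousOn_unif hg ε hε
      refine ⟨min δ δ', lt_min hδ hδ', fun a b h1 h2 h3 h4 => ?_⟩
      have e1 := h a b h1 h2 h3 (h4.trans_le (min_le_left _ _))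
      have e2 := hv4 a b (g a) ε h1 h2 h3 (fun s hs => h' a s ⟨h1, by linarith⟩
        ⟨by linarith [hs.1], by linarith [hs.2]⟩ (by
          rw [abs_of_pos (by linarith [hs.1])]
          have := h4.trans_le (min_le_right _ _)
          linarith [hs.2]))
      calc _ = |(stieltjes g y a b - g a * (y b - y a)) - (Φ a b - g a * (y b - y a))| := by
            congr 1; ring
        _ ≤ _ := abs_sub _ _
        _ ≤ ε * (v b - v a) + ε * (w b - w a) := add_le_add e2 e1
        _ = _ := by ring) ha hab hb
  linarith

/-- The chain rule for continuous paths of finite variation. -/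
theorem stieltjes_deriv_comp {y F F' : ℝ → ℝ} (hc : ContinuousOn y (Icc 0 1))
    (hv : BoundedVariationOn y (Icc 0 1)) (hF : ∀ x, HasDerivAt F (F' x) x)
    (hF' : Continuous F') {a b : ℝ} (ha : 0 ≤ a) (hab : a ≤ b) (hb : b ≤ 1) :
    stieltjes (fun s => F' (y s)) y a b = F (y b) - F (y a) := by
  obtain ⟨w, hw, -⟩ := exists_stieltjes_control hc hv
  refine stieltjes_eq_of_additive (Φ := fun a b => F (y b) - F (y a)) (w := w) hc hv
    (hF'.comp_continuousOn hc) (fun a b c _ _ _ _ => by ring) (fun ε hε => ?_) ha hab hb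
  have hcomp : IsCompact (y '' Icc 0 1) := isCompact_Icc.image_of_continuousOn hc
  obtain ⟨R, hR⟩ := hcomp.isBounded.subset_closedBall 0
  have hu := (isCompact_closedBall (0 : ℝ) R).uniformContinuousOn_of_continuous hF'.continuousOn
  obtain ⟨η, hη, h⟩ := Metric.uniformContinuousOn_iff.1 hu ε hε
  obtain ⟨δ, hδ, h'⟩ := continuousOn_unif hc (η / 2) (by positivity)
  refine ⟨δ, hδ, fun a b h1 h2 h3 h4 => ?_⟩
  have hya : y a ∈ Metric.closedBall (0 : ℝ) R := hR ⟨a, ⟨h1, by linarith⟩, rfl⟩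
  have hyb : y b ∈ Metric.closedBall (0 : ℝ) R := hR ⟨b, ⟨by linarith, h3⟩, rfl⟩
  have hyab : |y b - y a| ≤ η / 2 := h' a b ⟨h1, by linarith⟩ ⟨by linarith, h3⟩ (by
    rwa [abs_of_nonneg (by linarith)])
  -- Mean value inequality for F minus its tangent at y a: on the segment the derivative of this
  -- difference is at most ε.
  have hconv : Convex ℝ (segment ℝ (y a) (y b)) := convex_segment _ _
  have hmv := hconv.norm_image_sub_le_of_norm_hasDerivWithin_le
    (f := fun x => F x - F' (y a) * x) (f' := fun x => F' x - F' (y a)) (C := ε)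
    (fun x _ => by
      have := ((hF x).sub ((hasDerivAt_id x).const_mul (F' (y a)))).hasDerivWithinAt
        (s := segment ℝ (y a) (y b))
      rw [mul_one] at this
      exact this)
    (fun x hx => by
      have hxb : x ∈ Metric.closedBall (0 : ℝ) R :=
        (convex_closedBall (0 : ℝ) R).segment_subset hya hyb hx
      refine (h x hxb (y a) hya ?_).le
      rw [segment_eq_uIcc] at hx
      have := abs_sub_left_of_mem_uIcc hx
      rw [Real.dist_eq]
      linarith)
    (left_mem_segment ℝ _ _) (right_mem_segment ℝ _ _)
  have e : |F (y b) - F (y a) - F' (y a) * (y b - y a)| ≤ ε * |y b - y a| := by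
    rw [Real.norm_eq_abs, Real.norm_eq_abs] at hmv
    convert hmv using 2; ring
  exact e.trans (mul_le_mul_of_nonneg_left (hw a b h1 h2 h3) hε.le)

/-- For an absolutely continuous path the Stieltjes integral is a Lebesgue integral. -/
theorem stieltjes_eq_intervalIntegral {Y y g : ℝ → ℝ} (hy : IntervalIntegrable y volume 0 1)
    (hY : ∀ t ∈ Icc (0 : ℝ) 1, Y t = ∫ s in (0 : ℝ)..t, y s) (hg : ContinuousOn g (Icc 0 1))
    {a b : ℝ} (ha : 0 ≤ a) (hab : a ≤ b) (hb : b ≤ 1) :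
    stieltjes g Y a b = ∫ s in a..b, g s * y s := by
  have hac := hy.absolutelyContinuousOnInterval_intervalIntegral (c := 0) (by simp)
  have hv : BoundedVariationOn Y (Icc 0 1) := by
    have := hac.boundedVariationOn
    rw [uIcc_of_le zero_le_one] at this
    rw [BoundedVariationOn, eVariationOn.eq_of_eqOn hY]
    exact this
  have hc : ContinuousOn Y (Icc 0 1) := by
    have := hac.continuousOn
    rw [uIcc_of_le zero_le_one] at this
    exact this.congr hY
  have hsub : ∀ a b, 0 ≤ a → a ≤ 1 → 0 ≤ b → b ≤ 1 → uIcc a b ⊆ uIcc (0 : ℝ) 1 := by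
    intro a b h1 h2 h3 h4
    rw [uIcc_of_le zero_le_one]
    exact uIcc_subset_Icc ⟨h1, h2⟩ ⟨h3, h4⟩
  have hyi : ∀ a b, 0 ≤ a → a ≤ 1 → 0 ≤ b → b ≤ 1 → IntervalIntegrable y volume a b :=
    fun a b h1 h2 h3 h4 => hy.mono_set (hsub a b h1 h2 h3 h4)
  have hgy : IntervalIntegrable (fun s => g s * y s) volume 0 1 :=
    hy.continuousOn_mul (by rwa [uIcc_of_le zero_le_one])
  have hgyi : ∀ a b, 0 ≤ a → a ≤ 1 → 0 ≤ b → b ≤ 1 →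
      IntervalIntegrable (fun s => g s * y s) volume a b :=
    fun a b h1 h2 h3 h4 => hgy.mono_set (hsub a b h1 h2 h3 h4)
  refine stieltjes_eq_of_additive (Φ := fun a b => ∫ s in a..b, g s * y s)
    (w := fun t => ∫ s in (0 : ℝ)..t, |y s|) hc hv hg (fun a b c h1 h2 h3 h4 => ?_)
    (fun ε hε => ?_) ha hab hb
  · exact intervalIntegral.integral_add_adjacent_intervals
      (hgyi _ _ h1 (by linarith) (by linarith) (by linarith))
      (hgyi _ _ (by linarith) (by linarith) (by linarith) h4)
  · obtain ⟨δ, hδ, h⟩ := continuousOn_unif hg ε hε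
    refine ⟨δ, hδ, fun a b h1 h2 h3 h4 => ?_⟩
    have hi := hyi a b h1 (by linarith) (by linarith) h3
    have e1 : Y b - Y a = ∫ s in a..b, y s := by
      rw [hY b ⟨by linarith, h3⟩, hY a ⟨h1, by linarith⟩,
        intervalIntegral.integral_interval_sub_left
          (hyi _ _ le_rfl zero_le_one (by linarith) h3)
          (hyi _ _ le_rfl zero_le_one (by linarith) (by linarith))]
    have e2 : (∫ s in (0 : ℝ)..b, |y s|) - (∫ s in (0 : ℝ)..a, |y s|) = ∫ s in a..b, |y s| := by
      rw [intervalIntegral.integral_interval_sub_left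
          (hyi _ _ le_rfl zero_le_one (by linarith) h3).abs
          (hyi _ _ le_rfl zero_le_one (by linarith) (by linarith)).abs]
    rw [e1, e2, ← intervalIntegral.integral_const_mul, ← intervalIntegral.integral_const_mul,
      ← intervalIntegral.integral_sub (hgyi a b h1 (by linarith) (by linarith) h3)
        (hi.const_mul _), ← Real.norm_eq_abs]
    refine intervalIntegral.norm_integral_le_of_norm_le h2 ?_ (hi.abs.const_mul ε)
    refine Eventually.of_forall fun s hs => ?_
    rw [← sub_mul, norm_mul, Real.norm_eq_abs, Real.norm_eq_abs]
    refine mul_le_mul_of_nonneg_right (h a s ⟨h1, by linarith⟩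
      ⟨by linarith [hs.1], by linarith [hs.2]⟩ ?_) (abs_nonneg _)
    rw [abs_of_pos (by linarith [hs.1])]; linarith [hs.2]

/-! ### Grönwall's inequality -/

/-- Grönwall's inequality with an integrable kernel. -/
theorem gronwall_of_integrable {φ k : ℝ → ℝ} {A : ℝ} (hA : 0 ≤ A)
    (hk : IntervalIntegrable k volume 0 1) (hk0 : ∀ s, 0 ≤ k s)
    (hφ : ContinuousOn φ (Icc 0 1))
    (h : ∀ t ∈ Icc (0 : ℝ) 1, φ t ≤ A + ∫ s in (0 : ℝ)..t, k s * φ s) :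
    ∀ t ∈ Icc (0 : ℝ) 1, φ t ≤ 2 * A * Real.exp (2 * ∫ s in (0 : ℝ)..1, k s) := by
  set K : ℝ → ℝ := fun t => ∫ s in (0 : ℝ)..t, k s with hK
  have hsub : ∀ t ∈ Icc (0 : ℝ) 1, uIcc 0 t ⊆ uIcc (0 : ℝ) 1 := fun t ht => by
    rw [uIcc_of_le zero_le_one]; exact uIcc_subset_Icc ⟨le_rfl, zero_le_one⟩ ht
  have hki : ∀ t ∈ Icc (0 : ℝ) 1, IntervalIntegrable k volume 0 t := fun t ht =>
    hk.mono_set (hsub t ht)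
  have hac := hk.absolutelyContinuousOnInterval_intervalIntegral (c := 0) (by simp)
  have hKc : ContinuousOn K (Icc 0 1) := by
    have := hac.continuousOn; rwa [uIcc_of_le zero_le_one] at this
  have hKv : BoundedVariationOn K (Icc 0 1) := by
    have := hac.boundedVariationOn; rwa [uIcc_of_le zero_le_one] at this
  have hec : ContinuousOn (fun s => Real.exp (2 * K s)) (Icc 0 1) :=
    Real.continuous_exp.comp_continuousOn (hKc.const_mul 2)
  have hexp : ∀ t ∈ Icc (0 : ℝ) 1,
      ∫ s in (0 : ℝ)..t, Real.exp (2 * K s) * k s = (Real.exp (2 * K t) - 1) / 2 := by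
    intro t ht
    -- K is only absolutely continuous, so the integral is evaluated by the Stieltjes chain rule.
    rw [← stieltjes_eq_intervalIntegral hk (fun _ _ => rfl) hec le_rfl ht.1 ht.2,
      stieltjes_deriv_comp (F := fun x => Real.exp (2 * x) / 2) (F' := fun x => Real.exp (2 * x))
        hKc hKv (fun x => ?_) (by fun_prop) le_rfl ht.1 ht.2]
    · simp [hK]; ring
    · have := ((hasDerivAt_id x).const_mul 2).exp.div_const 2
      rw [mul_one, mul_div_assoc, div_self two_ne_zero, mul_one] at this
      exact this
  -- Look at the maximum S of φ exp(-2K). The factor 2 gains a half: at the maximum S e^{2K} ≤ A + S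
  -- (e^{2K} - 1) / 2, which is impossible for S > 2A.
  have hψ : ContinuousOn (fun t => φ t * Real.exp (-(2 * K t))) (Icc 0 1) :=
    hφ.mul (Real.continuous_exp.comp_continuousOn (hKc.const_mul 2).neg)
  obtain ⟨t₀, ht₀, hmax⟩ := isCompact_Icc.exists_isMaxOn ⟨0, le_rfl, zero_le_one⟩ hψ
  set S := φ t₀ * Real.exp (-(2 * K t₀)) with hS
  have hle : ∀ t ∈ Icc (0 : ℝ) 1, φ t ≤ S * Real.exp (2 * K t) := by
    intro t ht
    have h1 : φ t * Real.exp (-(2 * K t)) ≤ S := hmax ht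
    have h2 := mul_le_mul_of_nonneg_right h1 (Real.exp_pos (2 * K t)).le
    rwa [mul_assoc, ← Real.exp_add, neg_add_cancel, Real.exp_zero, mul_one] at h2
  have hKpos : ∀ t ∈ Icc (0 : ℝ) 1, 0 ≤ K t := fun t ht =>
    intervalIntegral.integral_nonneg ht.1 fun s _ => hk0 s
  have hS2 : S ≤ 2 * A := by
    by_contra hcon
    push Not at hcon
    have hI : ∫ s in (0 : ℝ)..t₀, k s * φ s ≤
        ∫ s in (0 : ℝ)..t₀, S * (Real.exp (2 * K s) * k s) := by
      have hu : uIcc 0 t₀ = Icc 0 t₀ := uIcc_of_le ht₀.1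
      have hss : Icc 0 t₀ ⊆ Icc (0 : ℝ) 1 := Icc_subset_Icc le_rfl ht₀.2
      refine intervalIntegral.integral_mono_on ht₀.1
        ((hki t₀ ht₀).mul_continuousOn (by rw [hu]; exact hφ.mono hss))
        (((hki t₀ ht₀).continuousOn_mul (by rw [hu]; exact hec.mono hss)).const_mul S)
        fun s hs => ?_
      have := mul_le_mul_of_nonneg_left (hle s (hss hs)) (hk0 s)
      linarith
    rw [intervalIntegral.integral_const_mul, hexp t₀ ht₀] at hI
    have h1 := h t₀ ht₀
    have hS0 : φ t₀ = S * Real.exp (2 * K t₀) := by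
      rw [hS, mul_assoc, ← Real.exp_add, neg_add_cancel, Real.exp_zero, mul_one]
    have h3 : 1 ≤ Real.exp (2 * K t₀) := Real.one_le_exp (by linarith [hKpos t₀ ht₀])
    nlinarith
  intro t ht
  refine (hle t ht).trans ?_
  have hKm : K t ≤ ∫ s in (0 : ℝ)..1, k s :=
    intervalIntegral.integral_mono_interval le_rfl ht.1 ht.2
      (Eventually.of_forall fun s => hk0 s) hk
  have hKm' : 2 * K t ≤ 2 * ∫ s in (0 : ℝ)..1, k s := by linarith
  exact mul_le_mul hS2 (Real.exp_le_exp.2 hKm') (Real.exp_pos _).le (by positivity)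

/-! ### Grid cells -/

/-- Index of the grid interval `(k / n, (k + 1) / n]` that contains `s`. -/
def cell (n : ℕ) (s : ℝ) : ℕ := ⌈(n : ℝ) * s⌉₊ - 1

/-- Left end point of the grid interval that contains `s`. -/
def lo (n : ℕ) (s : ℝ) : ℝ := (cell n s : ℝ) / n

theorem cell_eq {n k : ℕ} (hn : 0 < n) {s : ℝ} (h1 : (k : ℝ) / n < s)
    (h2 : s ≤ ((k : ℝ) + 1) / n) : cell n s = k := by
  have hn' : (0 : ℝ) < n := by exact_mod_cast hn
  rw [div_lt_iff₀ hn'] at h1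
  rw [le_div_iff₀ hn'] at h2
  have : ⌈(n : ℝ) * s⌉₊ = k + 1 := by
    rw [Nat.ceil_eq_iff (by omega)]
    constructor
    · simp; linarith
    · push_cast; linarith
  simp [cell, this]

theorem exists_cell {n : ℕ} (hn : 0 < n) {s : ℝ} (h0 : 0 < s) (h1 : s ≤ 1) :
    ∃ k < n, (k : ℝ) / n < s ∧ s ≤ ((k : ℝ) + 1) / n ∧ cell n s = k := by
  have hn' : (0 : ℝ) < n := by exact_mod_cast hn
  have hpos : 0 < ⌈(n : ℝ) * s⌉₊ := Nat.ceil_pos.2 (by positivity)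
  obtain ⟨k, hk⟩ := Nat.exists_eq_add_of_lt hpos
  have hk' : ⌈(n : ℝ) * s⌉₊ = k + 1 := by omega
  rw [Nat.ceil_eq_iff (by omega)] at hk'
  simp only [add_tsub_cancel_right] at hk'
  have e1 : (k : ℝ) / n < s := by rw [div_lt_iff₀ hn']; linarith [hk'.1]
  have e2 : s ≤ ((k : ℝ) + 1) / n := by
    rw [le_div_iff₀ hn']; have := hk'.2; push_cast at this; linarith
  refine ⟨k, ?_, e1, e2, cell_eq hn e1 e2⟩
  have : (k : ℝ) < n := by
    have := hk'.1; nlinarith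
  exact_mod_cast this

theorem lo_eq {n k : ℕ} (hn : 0 < n) {s : ℝ} (h1 : (k : ℝ) / n < s)
    (h2 : s ≤ ((k : ℝ) + 1) / n) : lo n s = (k : ℝ) / n := by
  rw [lo, cell_eq hn h1 h2]

theorem lo_nonneg (n : ℕ) (s : ℝ) : 0 ≤ lo n s := by unfold lo; positivity

theorem lo_bounds {n : ℕ} (hn : 0 < n) {s : ℝ} (h0 : 0 < s) (h1 : s ≤ 1) :
    lo n s < s ∧ s ≤ lo n s + 1 / n ∧ lo n s + 1 / n ≤ 1 := by
  obtain ⟨k, hk, e1, e2, e3⟩ := exists_cell hn h0 h1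
  have hn' : (0 : ℝ) < n := by exact_mod_cast hn
  rw [lo, e3]
  refine ⟨e1, by rwa [← add_div], ?_⟩
  rw [← add_div, div_le_one hn']
  exact_mod_cast hk

/-- Cells are open on the left; truncated subtraction nevertheless assigns time 0 to the first one.
-/
theorem cell_zero (n : ℕ) : cell n 0 = 0 := by simp [cell]

theorem lo_zero (n : ℕ) : lo n 0 = 0 := by simp [lo, cell_zero]

theorem measurable_cell (n : ℕ) : Measurable (cell n) := by
  have : Measurable fun s : ℝ => ⌈(n : ℝ) * s⌉₊ :=
    Nat.measurable_ceil.comp (measurable_const_mul _)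
  exact (Measurable.of_discrete (f := fun k : ℕ => k - 1)).comp this

/-- Since there are countably many cells, a quantity that restarts at each grid point is measurable
once it is so on every cell. -/
theorem measurable_cell_comp (n : ℕ) {g : ℕ → ℝ → ℝ} (hg : ∀ k, Measurable (g k)) :
    Measurable fun s => g (cell n s) s := by
  have : Measurable (Function.uncurry g) := measurable_from_prod_countable_right hg
  exact this.comp ((measurable_cell n).prodMk measurable_id)

theorem integral_eq_sum_cells {n : ℕ} (hn : 0 < n) {g : ℝ → ℝ}
    (hg : IntervalIntegrable g volume 0 1) {m : ℕ} (hm : m ≤ n) :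
    ∫ s in (0 : ℝ)..((m : ℝ) / n), g s =
      ∑ k ∈ Finset.range m, ∫ s in ((k : ℝ) / n)..(((k : ℝ) + 1) / n), g s := by
  have hn' : (0 : ℝ) < n := by exact_mod_cast hn
  have := intervalIntegral.sum_integral_adjacent_intervals (f := g) (μ := volume)
    (a := fun k : ℕ => (k : ℝ) / n) (n := m) (fun k hk => by
      refine hg.mono_set ?_
      rw [uIcc_of_le zero_le_one]
      have : ((k + 1 : ℕ) : ℝ) ≤ n := by exact_mod_cast (by omega : k + 1 ≤ n)
      have h2 : (k : ℝ) ≤ n := by exact_mod_cast (by omega : k ≤ n)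
      exact uIcc_subset_Icc ⟨by positivity, by rw [div_le_one hn']; exact h2⟩
        ⟨by positivity, by rw [div_le_one hn']; exact this⟩)
  simp only [Nat.cast_add, Nat.cast_one, Nat.cast_zero, zero_div] at this
  exact this.symm

theorem cell_Ioc_subset {n k : ℕ} (hk : k < n) :
    Icc ((k : ℝ) / n) (((k : ℝ) + 1) / n) ⊆ Icc (0 : ℝ) 1 := by
  have hn' : (0 : ℝ) < n := by exact_mod_cast (by omega : 0 < n)
  have : ((k : ℝ) + 1) ≤ n := by exact_mod_cast hk
  exact Icc_subset_Icc (by positivity) (by rw [div_le_one hn']; exact this)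

theorem cell_le {n k : ℕ} : (k : ℝ) / n ≤ ((k : ℝ) + 1) / n := by gcongr; linarith

theorem intervalIntegrable_cell {n k : ℕ} (hk : k < n) {g : ℝ → ℝ}
    (hg : IntervalIntegrable g volume 0 1) :
    IntervalIntegrable g volume ((k : ℝ) / n) (((k : ℝ) + 1) / n) := by
  refine hg.mono_set ?_
  rw [uIcc_of_le zero_le_one, uIcc_of_le cell_le]
  exact cell_Ioc_subset hk

/-! ### Products of three functions in L³ -/

theorem mul_mul_le_add_cubes {x y z : ℝ} (hx : 0 ≤ x) (hy : 0 ≤ y) (hz : 0 ≤ z) :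
    x * y * z ≤ x ^ 3 + y ^ 3 + z ^ 3 := by
  nlinarith [mul_nonneg hx (sq_nonneg (y - z)), mul_nonneg hy (sq_nonneg (x - z)),
    mul_nonneg hz (sq_nonneg (x - y)),
    mul_nonneg (add_nonneg (add_nonneg hx hy) hz) (sq_nonneg (x - y)),
    mul_nonneg (add_nonneg (add_nonneg hx hy) hz) (sq_nonneg (y - z)),
    mul_nonneg (add_nonneg (add_nonneg hx hy) hz) (sq_nonneg (x - z)),
    pow_nonneg hx 3, pow_nonneg hy 3, pow_nonneg hz 3]

/-- Functions on `(0,1]` with integrable third power. -/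
def L3 (u : ℝ → ℝ) : Prop := MemLp u 3 (volume.restrict (Ioc (0 : ℝ) 1))

namespace L3

variable {u v w : ℝ → ℝ}

theorem cube (hu : L3 u) : IntervalIntegrable (fun s => |u s| ^ 3) volume 0 1 := by
  rw [intervalIntegrable_iff_integrableOn_Ioc_of_le zero_le_one]
  exact MemLp.integrable_norm_pow (p := 3) hu (by norm_num)

theorem intervalIntegrable (hu : L3 u) : IntervalIntegrable u volume 0 1 := by
  rw [intervalIntegrable_iff_integrableOn_Ioc_of_le zero_le_one]
  exact MemLp.integrable (by norm_num) hu

theorem sub (hu : L3 u) (hv : L3 v) : L3 fun s => u s - v s := MemLp.sub hu hv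

theorem abs (hu : L3 u) : L3 fun s => |u s| := MemLp.abs hu

theorem mul_mul (hu : L3 u) (hv : L3 v) (hw : L3 w) :
    IntervalIntegrable (fun s => u s * v s * w s) volume 0 1 := by
  have h := (hu.cube.add hv.cube).add hw.cube
  rw [intervalIntegrable_iff_integrableOn_Ioc_of_le zero_le_one] at h ⊢
  refine Integrable.mono' h ((hu.aestronglyMeasurable.mul hv.aestronglyMeasurable).mul
    hw.aestronglyMeasurable) (Eventually.of_forall fun s => ?_)
  rw [norm_mul, norm_mul, Real.norm_eq_abs, Real.norm_eq_abs, Real.norm_eq_abs]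
  exact mul_mul_le_add_cubes (abs_nonneg _) (abs_nonneg _) (abs_nonneg _)

end L3

/-- Third power of the `L³` norm on `(0,1]`. -/
def N3 (u : ℝ → ℝ) : ℝ := ∫ s in (0 : ℝ)..1, |u s| ^ 3

theorem N3_nonneg (u : ℝ → ℝ) : 0 ≤ N3 u :=
  intervalIntegral.integral_nonneg zero_le_one fun _ _ => by positivity

/-- Inequality of arithmetic and geometric means for a/η², ηb, ηc. It takes the place of Hölder's
inequality: the weights put the large constant on the factor that tends to 0 and the small one on
the bounded factors. -/
theorem mul_mul_le_weighted {a b c η : ℝ} (ha : 0 ≤ a) (hb : 0 ≤ b) (hc : 0 ≤ c) (hη : 0 < η) :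
    a * b * c ≤ a ^ 3 / η ^ 6 + η ^ 3 * b ^ 3 + η ^ 3 * c ^ 3 := by
  have := mul_mul_le_add_cubes (x := a / η ^ 2) (y := η * b) (z := η * c) (by positivity)
    (by positivity) (by positivity)
  calc a * b * c = a / η ^ 2 * (η * b) * (η * c) := by field_simp
    _ ≤ _ := this
    _ = _ := by rw [div_pow, mul_pow, mul_pow, ← pow_mul]

theorem tendsto_integral_mul_mul_zero {u v w : ℕ → ℝ → ℝ} {K : ℝ}
    (hu : ∀ᶠ n in atTop, L3 (u n)) (hv : ∀ᶠ n in atTop, L3 (v n))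
    (hw : ∀ᶠ n in atTop, L3 (w n)) (hu0 : Tendsto (fun n => N3 (u n)) atTop (𝓝 0))
    (hvK : ∀ᶠ n in atTop, N3 (v n) ≤ K) (hwK : ∀ᶠ n in atTop, N3 (w n) ≤ K) :
    Tendsto (fun n => ∫ s in (0 : ℝ)..1, |u n s * v n s * w n s|) atTop (𝓝 0) := by
  rw [Metric.tendsto_atTop']
  intro ε hε
  have hK : 0 ≤ K := by
    obtain ⟨n, hn⟩ := hvK.exists
    exact (N3_nonneg _).trans hn
  -- First η makes the two bounded terms small; then n makes the first term small at this fixed η.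
  obtain ⟨η, hη, hηε⟩ : ∃ η : ℝ, 0 < η ∧ 2 * η ^ 3 * K < ε / 2 := by
    have : Tendsto (fun η : ℝ => 2 * η ^ 3 * K) (𝓝[>] 0) (𝓝 (2 * 0 ^ 3 * K)) :=
      (Continuous.tendsto (by fun_prop) 0).mono_left nhdsWithin_le_nhds
    have h2 := (this.eventually (gt_mem_nhds (show 2 * 0 ^ 3 * K < ε / 2 by simp; linarith))).and
      self_mem_nhdsWithin
    obtain ⟨η, h1, h2⟩ := h2.exists
    exact ⟨η, h2, h1⟩
  have h0 := hu0.eventually (gt_mem_nhds (show (0 : ℝ) < η ^ 6 * (ε / 2) by positivity))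
  obtain ⟨n₀, hn₀⟩ := eventually_atTop.1
    ((((hu.and hv).and hw).and (hvK.and hwK)).and h0)
  refine ⟨n₀, fun n hn => ?_⟩
  obtain ⟨⟨⟨⟨h1, h2⟩, h3⟩, h4, h5⟩, h6⟩ := hn₀ n hn.le
  have hnn : 0 ≤ ∫ s in (0 : ℝ)..1, |u n s * v n s * w n s| :=
    intervalIntegral.integral_nonneg zero_le_one fun _ _ => abs_nonneg _
  rw [Real.dist_eq, sub_zero, abs_of_nonneg hnn]
  have i1 := h1.cube.div_const (η ^ 6)
  have i2 := h2.cube.const_mul (η ^ 3)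
  have i3 := h3.cube.const_mul (η ^ 3)
  calc ∫ s in (0 : ℝ)..1, |u n s * v n s * w n s|
      ≤ ∫ s in (0 : ℝ)..1, (|u n s| ^ 3 / η ^ 6 + η ^ 3 * |v n s| ^ 3 + η ^ 3 * |w n s| ^ 3) := by
        refine intervalIntegral.integral_mono_on zero_le_one (h1.mul_mul h2 h3).abs
          ((i1.add i2).add i3) fun s _ => ?_
        rw [abs_mul, abs_mul]
        exact mul_mul_le_weighted (abs_nonneg _) (abs_nonneg _) (abs_nonneg _) hη
    _ = N3 (u n) / η ^ 6 + η ^ 3 * N3 (v n) + η ^ 3 * N3 (w n) := by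
        rw [intervalIntegral.integral_add (i1.add i2) i3, intervalIntegral.integral_add i1 i2,
          intervalIntegral.integral_div, intervalIntegral.integral_const_mul,
          intervalIntegral.integral_const_mul, N3, N3, N3]
    _ < ε / 2 + ε / 2 := by
        have e1 : N3 (u n) / η ^ 6 < ε / 2 := by
          rw [div_lt_iff₀ (by positivity)]; linarith
        have e2 : η ^ 3 * N3 (v n) ≤ η ^ 3 * K := mul_le_mul_of_nonneg_left h4 (by positivity)
        have e3 : η ^ 3 * N3 (w n) ≤ η ^ 3 * K := mul_le_mul_of_nonneg_left h5 (by positivity)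
        linarith
    _ = ε := by ring

/-- Jensen's inequality for the cube. -/
theorem cube_integral_le {u : ℝ → ℝ} {a b : ℝ} (hab : a ≤ b) (hu0 : ∀ s, 0 ≤ u s)
    (hu : IntervalIntegrable u volume a b)
    (hu3 : IntervalIntegrable (fun s => u s ^ 3) volume a b) :
    (∫ s in a..b, u s) ^ 3 ≤ (b - a) ^ 2 * ∫ s in a..b, u s ^ 3 := by
  rcases hab.eq_or_lt with rfl | hlt
  · simp
  set I := ∫ s in a..b, u s with hI
  have hI0 : 0 ≤ I := intervalIntegral.integral_nonneg hab fun s _ => hu0 s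
  have hl : 0 < b - a := by linarith
  set m := I / (b - a) with hm
  have hm0 : 0 ≤ m := by positivity
  -- The cube lies above its tangent at the mean m, because u³ - m³ - 3m²(u - m) = (u - m)²(u + 2m).
  have h1 : ∫ s in a..b, (m ^ 3 + 3 * m ^ 2 * (u s - m)) ≤ ∫ s in a..b, u s ^ 3 := by
    refine intervalIntegral.integral_mono_on hab
      ((_root_.intervalIntegrable_const).add ((hu.sub _root_.intervalIntegrable_const).const_mul _))
      hu3 fun s _ => ?_
    have := hu0 s
    nlinarith [mul_nonneg (sq_nonneg (u s - m)) (by linarith : 0 ≤ u s + 2 * m)]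
  rw [intervalIntegral.integral_add _root_.intervalIntegrable_const
    ((hu.sub _root_.intervalIntegrable_const).const_mul _), intervalIntegral.integral_const_mul,
    intervalIntegral.integral_sub hu _root_.intervalIntegrable_const,
    intervalIntegral.integral_const, intervalIntegral.integral_const, ← hI] at h1
  have hIm : I = (b - a) * m := by rw [hm]; field_simp
  simp only [smul_eq_mul] at h1
  calc I ^ 3 = (b - a) ^ 2 * ((b - a) * m ^ 3 + 3 * m ^ 2 * (I - (b - a) * m)) := by
        rw [hIm]; ring
    _ ≤ _ := mul_le_mul_of_nonneg_left h1 (by positivity)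

/-- The left end point has to be left out, because the functions below that are constant on cells
jump there. -/
theorem integral_congr_Ioc {f g : ℝ → ℝ} {a b : ℝ} (hab : a ≤ b) (h : ∀ s ∈ Ioc a b, f s = g s) :
    ∫ s in a..b, f s = ∫ s in a..b, g s := by
  rw [intervalIntegral.integral_of_le hab, intervalIntegral.integral_of_le hab]
  exact setIntegral_congr_fun measurableSet_Ioc h

theorem integral_mono_Ioc {f g : ℝ → ℝ} {a b : ℝ} (hab : a ≤ b)
    (hf : IntervalIntegrable f volume a b) (hg : IntervalIntegrable g volume a b)
    (h : ∀ s ∈ Ioc a b, f s ≤ g s) : ∫ s in a..b, f s ≤ ∫ s in a..b, g s := by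
  rw [intervalIntegral.integral_of_le hab, intervalIntegral.integral_of_le hab]
  rw [intervalIntegrable_iff_integrableOn_Ioc_of_le hab] at hf hg
  exact setIntegral_mono_on hf hg measurableSet_Ioc h

theorem abs_integral_le_of_le {f g : ℝ → ℝ} {a b : ℝ} (hab : a ≤ b)
    (hg : IntervalIntegrable g volume a b)
    (h : ∀ s ∈ Ioc a b, |f s| ≤ g s) : |∫ s in a..b, f s| ≤ ∫ s in a..b, g s := by
  rw [← Real.norm_eq_abs]
  exact intervalIntegral.norm_integral_le_of_norm_le hab (Eventually.of_forall h) hg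

theorem integral_le_of_subinterval {g : ℝ → ℝ} {a b : ℝ} (hg : IntervalIntegrable g volume 0 1)
    (hg0 : ∀ s, 0 ≤ g s) (ha : 0 ≤ a) (hab : a ≤ b) (hb : b ≤ 1) :
    ∫ s in a..b, g s ≤ ∫ s in (0 : ℝ)..1, g s :=
  intervalIntegral.integral_mono_interval ha hab hb (Eventually.of_forall hg0) hg

theorem intervalIntegrable_sub {g : ℝ → ℝ} {a b : ℝ} (hg : IntervalIntegrable g volume 0 1)
    (ha : a ∈ Icc (0 : ℝ) 1) (hb : b ∈ Icc (0 : ℝ) 1) : IntervalIntegrable g volume a b := by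
  refine hg.mono_set ?_
  rw [uIcc_of_le zero_le_one]
  exact uIcc_subset_Icc ha hb

/-! ### Averages over grid cells -/

/-- Average of `u` over the grid interval that contains `s`. -/
def avg (n : ℕ) (u : ℝ → ℝ) (s : ℝ) : ℝ := n * ∫ r in (lo n s)..(lo n s + 1 / n), u r

theorem avg_eq {n k : ℕ} (hn : 0 < n) (u : ℝ → ℝ) {s : ℝ} (h1 : (k : ℝ) / n < s)
    (h2 : s ≤ ((k : ℝ) + 1) / n) :
    avg n u s = n * ∫ r in ((k : ℝ) / n)..(((k : ℝ) + 1) / n), u r := by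
  rw [avg, lo_eq hn h1 h2, add_div]

theorem measurable_avg (n : ℕ) (u : ℝ → ℝ) : Measurable (avg n u) :=
  measurable_cell_comp n (g := fun k _ => n * ∫ r in ((k : ℝ) / n)..((k : ℝ) / n + 1 / n), u r)
    fun _ => measurable_const

theorem cell_length {n k : ℕ} : ((k : ℝ) + 1) / n - (k : ℝ) / n = 1 / n := by
  rw [add_div]; ring

theorem L3_avg {n : ℕ} (hn : 0 < n) {u : ℝ → ℝ} (hu : IntervalIntegrable u volume 0 1) :
    L3 (avg n u) := by
  refine MemLp.of_bound (measurable_avg n u).aestronglyMeasurable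
    (n * ∫ r in (0 : ℝ)..1, |u r|) ?_
  filter_upwards [ae_restrict_mem measurableSet_Ioc] with s hs
  obtain ⟨h1, h2, h3⟩ := lo_bounds hn hs.1 hs.2
  rw [avg, norm_mul, Real.norm_natCast]
  refine mul_le_mul_of_nonneg_left ?_ (by positivity)
  refine (intervalIntegral.norm_integral_le_integral_norm (by linarith)).trans ?_
  exact integral_le_of_subinterval hu.abs (fun _ => abs_nonneg _) (lo_nonneg n s) (by linarith) h3

/-- Averaging contracts the L³ norm, by Jensen's inequality on each cell. -/
theorem N3_avg_le {n : ℕ} (hn : 0 < n) {u : ℝ → ℝ} (hu : L3 u) : N3 (avg n u) ≤ N3 u := by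
  have hn' : (0 : ℝ) < n := by exact_mod_cast hn
  have e := integral_eq_sum_cells hn (L3_avg hn hu.intervalIntegrable).cube le_rfl
  have e' := integral_eq_sum_cells hn hu.cube le_rfl
  rw [div_self hn'.ne'] at e e'
  rw [N3, N3, e, e']
  refine Finset.sum_le_sum fun k hk => ?_
  rw [Finset.mem_range] at hk
  have hc := cell_le (n := n) (k := k)
  rw [integral_congr_Ioc hc (g := fun _ =>
    |n * ∫ r in ((k : ℝ) / n)..(((k : ℝ) + 1) / n), u r| ^ 3) fun s hs => by
      rw [avg_eq hn u hs.1 hs.2], intervalIntegral.integral_const, cell_length, smul_eq_mul,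
    abs_mul, mul_pow, Nat.abs_cast]
  have h1 : |∫ r in ((k : ℝ) / n)..(((k : ℝ) + 1) / n), u r| ≤
      ∫ r in ((k : ℝ) / n)..(((k : ℝ) + 1) / n), |u r| :=
    intervalIntegral.abs_integral_le_integral_abs hc
  have h2 := cube_integral_le hc (fun s => abs_nonneg (u s))
    (intervalIntegrable_cell hk hu.intervalIntegrable).abs (intervalIntegrable_cell hk hu.cube)
  rw [cell_length] at h2
  have h3 := (pow_le_pow_left₀ (abs_nonneg _) h1 3).trans h2
  calc _ ≤ 1 / (n : ℝ) * (n ^ 3 * ((1 / n) ^ 2 *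
        ∫ s in ((k : ℝ) / n)..(((k : ℝ) + 1) / n), |u s| ^ 3)) := by gcongr
    _ = _ := by field_simp

theorem avg_sub {n : ℕ} (hn : 0 < n) {u g : ℝ → ℝ} (hu : IntervalIntegrable u volume 0 1)
    (hg : IntervalIntegrable g volume 0 1) {s : ℝ} (hs : s ∈ Ioc (0 : ℝ) 1) :
    avg n (fun r => u r - g r) s = avg n u s - avg n g s := by
  obtain ⟨h1, h2, h3⟩ := lo_bounds hn hs.1 hs.2
  have hm1 : lo n s ∈ Icc (0 : ℝ) 1 := ⟨lo_nonneg n s, by linarith [hs.2]⟩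
  have hm2 : lo n s + 1 / n ∈ Icc (0 : ℝ) 1 := ⟨by linarith [hs.1], h3⟩
  rw [avg, intervalIntegral.integral_sub (intervalIntegrable_sub hu hm1 hm2)
    (intervalIntegrable_sub hg hm1 hm2), avg, avg]
  ring

theorem abs_sub_avg_le {n : ℕ} (hn : 0 < n) {g : ℝ → ℝ} (hg : IntervalIntegrable g volume 0 1)
    {δ ε : ℝ} (h : ∀ a s, a ∈ Icc (0 : ℝ) 1 → s ∈ Icc (0 : ℝ) 1 → |s - a| < δ → |g s - g a| ≤ ε)
    (hδ : 1 / (n : ℝ) < δ) {s : ℝ} (hs : s ∈ Ioc (0 : ℝ) 1) : |g s - avg n g s| ≤ ε := by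
  obtain ⟨h1, h2, h3⟩ := lo_bounds hn hs.1 hs.2
  have hn' : (0 : ℝ) < n := by exact_mod_cast hn
  have hl0 := lo_nonneg n s
  have hm1 : lo n s ∈ Icc (0 : ℝ) 1 := ⟨lo_nonneg n s, by linarith [hs.2]⟩
  have hm2 : lo n s + 1 / n ∈ Icc (0 : ℝ) 1 := ⟨by linarith [hs.1], h3⟩
  have e : g s - avg n g s = n * ∫ r in (lo n s)..(lo n s + 1 / n), (g s - g r) := by
    rw [intervalIntegral.integral_sub _root_.intervalIntegrable_const
      (intervalIntegrable_sub hg hm1 hm2), intervalIntegral.integral_const, avg, smul_eq_mul]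
    field_simp
    ring
  rw [e, abs_mul, Nat.abs_cast]
  have : |∫ r in (lo n s)..(lo n s + 1 / n), (g s - g r)| ≤
      ∫ r in (lo n s)..(lo n s + 1 / n), ε :=
    abs_integral_le_of_le (by linarith) _root_.intervalIntegrable_const fun r hr =>
      h r s ⟨by linarith [hr.1], by linarith [hr.2]⟩ ⟨hs.1.le, hs.2⟩ (by
        rw [abs_lt]; constructor <;> linarith [hr.1, hr.2])
  rw [intervalIntegral.integral_const, smul_eq_mul] at this
  calc _ ≤ (n : ℝ) * ((lo n s + 1 / n - lo n s) * ε) := by gcongr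
    _ = ε := by field_simp; ring

theorem add_cube_le {a b c : ℝ} (ha : 0 ≤ a) (hb : 0 ≤ b) (hc : 0 ≤ c) :
    (a + b + c) ^ 3 ≤ 9 * (a ^ 3 + b ^ 3 + c ^ 3) := by
  nlinarith [mul_nonneg (add_nonneg ha hb) (sq_nonneg (a - b)),
    mul_nonneg (add_nonneg hb hc) (sq_nonneg (b - c)),
    mul_nonneg (add_nonneg ha hc) (sq_nonneg (a - c)),
    mul_nonneg hc (sq_nonneg (a - b)), mul_nonneg ha (sq_nonneg (b - c)),
    mul_nonneg hb (sq_nonneg (a - c))]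

theorem exists_continuous_N3_sub_le {u : ℝ → ℝ} (hu : L3 u) {ε : ℝ} (hε : 0 < ε) :
    ∃ g : ℝ → ℝ, Continuous g ∧ L3 g ∧ N3 (fun s => u s - g s) ≤ ε := by
  have hu' : MemLp u (ENNReal.ofReal 3) (volume.restrict (Ioc (0 : ℝ) 1)) := by
    have : ENNReal.ofReal 3 = 3 := by simp
    rw [this]; exact hu
  obtain ⟨g, hg, hg3⟩ := hu'.exists_boundedContinuous_integral_rpow_sub_le (by norm_num) hε
  refine ⟨g, g.continuous, ?_, ?_⟩
  · have : ENNReal.ofReal 3 = 3 := by simp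
    rw [this] at hg3; exact hg3
  · rw [N3, intervalIntegral.integral_of_le zero_le_one]
    refine le_trans (le_of_eq ?_) hg
    congr 1
    ext s
    rw [Real.norm_eq_abs]
    norm_cast

/-- Uniform continuity settles continuous functions; density in L³ and the contraction property of
averaging give the rest. -/
theorem tendsto_N3_sub_avg {u : ℝ → ℝ} (hu : L3 u) :
    Tendsto (fun n => N3 fun s => u s - avg n u s) atTop (𝓝 0) := by
  rw [Metric.tendsto_atTop']
  intro ε hε
  -- Three terms of size ε/54 and the factor 9 of `add_cube_le` make ε/2.
  obtain ⟨g, hgc, hg, hug⟩ := exists_continuous_N3_sub_le hu (ε := ε / 54) (by positivity)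
  obtain ⟨η, hη, hη3⟩ : ∃ η : ℝ, 0 < η ∧ η ^ 3 ≤ ε / 54 := by
    refine ⟨min 1 (ε / 54), by positivity, ?_⟩
    have h1 : min 1 (ε / 54) ≤ 1 := min_le_left _ _
    have h0 : 0 ≤ min 1 (ε / 54) := by positivity
    calc _ ≤ min 1 (ε / 54) := by
          calc (min 1 (ε / 54)) ^ 3 ≤ (min 1 (ε / 54)) ^ 1 := pow_le_pow_of_le_one h0 h1 (by norm_num)
            _ = _ := pow_one _
      _ ≤ _ := min_le_right _ _
  obtain ⟨δ, hδ, h⟩ := continuousOn_unif hgc.continuousOn η hη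
  obtain ⟨n₀, hn₀⟩ := exists_nat_gt (1 / δ)
  refine ⟨n₀, fun n hn => ?_⟩
  have hn0 : 0 < n := by omega
  have hn' : (0 : ℝ) < n := by exact_mod_cast hn0
  have hnδ : 1 / (n : ℝ) < δ := by
    rw [div_lt_iff₀ hn']
    rw [div_lt_iff₀ hδ] at hn₀
    have : (n₀ : ℝ) < n := by exact_mod_cast hn
    nlinarith
  rw [Real.dist_eq, sub_zero, abs_of_nonneg (N3_nonneg _)]
  have hug' := hu.sub hg
  have i1 := hug'.cube
  have i3 := (L3_avg hn0 hug'.intervalIntegrable).cube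
  have ic : IntervalIntegrable (fun _ : ℝ => η ^ 3) volume 0 1 := _root_.intervalIntegrable_const
  calc N3 (fun s => u s - avg n u s)
      ≤ ∫ s in (0 : ℝ)..1, 9 * (|u s - g s| ^ 3 + η ^ 3 + |avg n (fun r => u r - g r) s| ^ 3) := by
        refine integral_mono_Ioc zero_le_one
          (hu.sub (L3_avg hn0 hu.intervalIntegrable)).cube (((i1.add ic).add i3).const_mul 9)
          fun s hs => ?_
        have e1 := abs_sub_avg_le hn0 hg.intervalIntegrable h hnδ hs
        have e2 := avg_sub hn0 hu.intervalIntegrable hg.intervalIntegrable hs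
        have e3 : |u s - avg n u s| ≤
            |u s - g s| + η + |avg n (fun r => u r - g r) s| := by
          have : u s - avg n u s = (u s - g s) + (g s - avg n g s) -
              avg n (fun r => u r - g r) s := by rw [e2]; ring
          rw [this]
          refine (abs_sub _ _).trans (add_le_add_left ((abs_add_le _ _).trans ?_) _)
          linarith
        exact (pow_le_pow_left₀ (abs_nonneg _) e3 3).trans
          (add_cube_le (abs_nonneg _) hη.le (abs_nonneg _))
    _ = 9 * (N3 (fun s => u s - g s) + η ^ 3 + N3 (avg n fun r => u r - g r)) := by
        rw [intervalIntegral.integral_const_mul, intervalIntegral.integral_add (i1.add ic) i3,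
          intervalIntegral.integral_add i1 ic, intervalIntegral.integral_const, N3, N3]
        simp
    _ ≤ 9 * (ε / 54 + ε / 54 + ε / 54) := by
        have := N3_avg_le hn0 hug'
        gcongr
        linarith
    _ < ε := by linarith

/-- Mean deviation of `u` from its averages over the grid intervals. -/
def dev (n : ℕ) (u : ℝ → ℝ) (s : ℝ) : ℝ := avg n (fun r => |u r - avg n u r|) s

theorem L3_dev {n : ℕ} (hn : 0 < n) {u : ℝ → ℝ} (hu : L3 u) : L3 (dev n u) :=
  L3_avg hn (hu.sub (L3_avg hn hu.intervalIntegrable)).intervalIntegrable.abs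

/-- The deviation is itself an average, of |u - avg u|, so contraction reduces it to the convergence
of averages. -/
theorem tendsto_N3_dev {u : ℝ → ℝ} (hu : L3 u) :
    Tendsto (fun n => N3 (dev n u)) atTop (𝓝 0) := by
  refine tendsto_of_tendsto_of_tendsto_of_le_of_le' tendsto_const_nhds (tendsto_N3_sub_avg hu)
    (Eventually.of_forall fun n => N3_nonneg _) ?_
  filter_upwards [eventually_gt_atTop 0] with n hn
  have := N3_avg_le hn (hu.sub (L3_avg hn hu.intervalIntegrable)).abs
  refine this.trans (le_of_eq ?_)
  simp [N3]

/-! ### Increments and iterated integrals since the last grid point -/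

/-- Increment of the primitive of `u` since the last grid point. -/
def W (n : ℕ) (u : ℝ → ℝ) (s : ℝ) : ℝ := ∫ r in (lo n s)..s, u r

/-- Iterated integral of `u` and `v` since the last grid point. -/
def E (n : ℕ) (u v : ℝ → ℝ) (s : ℝ) : ℝ := ∫ r in (lo n s)..s, (∫ p in (lo n s)..r, u p) * v r

theorem continuous_primitive {u : ℝ → ℝ} (hu : Integrable u) (a : ℝ) :
    Continuous fun s => ∫ r in a..s, u r :=
  intervalIntegral.continuous_primitive (fun _ _ => hu.intervalIntegrable) a

theorem intervalIntegrable_primitive_mul {u v : ℝ → ℝ} (hu : Integrable u) (hv : Integrable v)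
    (a b c : ℝ) : IntervalIntegrable (fun r => (∫ p in a..r, u p) * v r) volume b c :=
  hv.intervalIntegrable.continuousOn_mul (continuous_primitive hu a).continuousOn

theorem measurable_W (n : ℕ) {u : ℝ → ℝ} (hu : Integrable u) : Measurable (W n u) :=
  measurable_cell_comp n (g := fun k s => ∫ r in ((k : ℝ) / n)..s, u r)
    fun _ => (continuous_primitive hu _).measurable

theorem measurable_E (n : ℕ) {u v : ℝ → ℝ} (hu : Integrable u) (hv : Integrable v) :
    Measurable (E n u v) :=
  measurable_cell_comp n
    (g := fun k s => ∫ r in ((k : ℝ) / n)..s, (∫ p in ((k : ℝ) / n)..r, u p) * v r)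
    fun _ => (intervalIntegral.continuous_primitive
      (fun b c => intervalIntegrable_primitive_mul hu hv _ b c) _).measurable

theorem abs_primitive_le {u : ℝ → ℝ} (hu : Integrable u) {a r b : ℝ} (h1 : a ≤ r) (h2 : r ≤ b) :
    |∫ p in a..r, u p| ≤ ∫ p in a..b, |u p| :=
  (intervalIntegral.abs_integral_le_integral_abs h1).trans
    (intervalIntegral.integral_mono_interval le_rfl h1 h2
      (Eventually.of_forall fun _ => abs_nonneg _) hu.intervalIntegrable.abs)

theorem abs_W_le {n : ℕ} (hn : 0 < n) {u : ℝ → ℝ} (hu : Integrable u) {s : ℝ}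
    (hs : s ∈ Ioc (0 : ℝ) 1) : n * |W n u s| ≤ avg n (fun r => |u r|) s := by
  obtain ⟨h1, h2, h3⟩ := lo_bounds hn hs.1 hs.2
  exact mul_le_mul_of_nonneg_left (abs_primitive_le hu h1.le h2) (by positivity)

theorem abs_iterated_integral_le {u v : ℝ → ℝ} (hu : Integrable u) (hv : Integrable v)
    {a s : ℝ} (has : a ≤ s) :
    |∫ r in a..s, (∫ p in a..r, u p) * v r| ≤ (∫ r in a..s, |u r|) * ∫ r in a..s, |v r| := by
  rw [← intervalIntegral.integral_const_mul]
  refine abs_integral_le_of_le has (hv.intervalIntegrable.abs.const_mul _) fun r hr => ?_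
  rw [abs_mul]
  exact mul_le_mul_of_nonneg_right (abs_primitive_le hu hr.1.le hr.2) (abs_nonneg _)

/-- Integration by parts for absolutely continuous functions. It expresses the symmetric products of
increments in a second order Taylor term by iterated integrals. -/
theorem integral_primitive_mul_add {u v : ℝ → ℝ} (hu : Integrable u) (hv : Integrable v)
    (a s : ℝ) :
    (∫ r in a..s, u r) * (∫ r in a..s, v r) =
      (∫ r in a..s, (∫ p in a..r, u p) * v r) + ∫ r in a..s, (∫ p in a..r, v p) * u r := by
  have hU := hu.intervalIntegrable.absolutelyContinuousOnInterval_intervalIntegral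
    (a := a) (b := s) (c := a) (by simp)
  have hV := hv.intervalIntegrable.absolutelyContinuousOnInterval_intervalIntegral
    (a := a) (b := s) (c := a) (by simp)
  have h := hU.integral_deriv_mul_eq_sub hV
  simp only [intervalIntegral.integral_same, mul_zero, sub_zero] at h
  rw [← h, ← intervalIntegral.integral_add (intervalIntegrable_primitive_mul hu hv _ _ _)
    (intervalIntegrable_primitive_mul hv hu _ _ _)]
  refine intervalIntegral.integral_congr_ae ?_
  filter_upwards [(hu.intervalIntegrable (a := a) (b := s)).ae_hasDerivAt_integral,
    (hv.intervalIntegrable (a := a) (b := s)).ae_hasDerivAt_integral] with x hx1 hx2 hx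
  have hx' := uIoc_subset_uIcc hx
  rw [(hx1 hx' a (by simp)).deriv, (hx2 hx' a (by simp)).deriv]
  ring

theorem avg_eq_avg {n : ℕ} (hn : 0 < n) (u : ℝ → ℝ) {s r : ℝ} (hs : s ∈ Ioc (0 : ℝ) 1)
    (hr : r ∈ Ioc (lo n s) (lo n s + 1 / n)) : avg n u r = avg n u s := by
  obtain ⟨k, hk, e1, e2, e3⟩ := exists_cell hn hs.1 hs.2
  rw [lo_eq hn e1 e2, ← add_div] at hr
  rw [avg_eq hn u e1 e2, avg_eq hn u hr.1 hr.2]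

theorem dev_eq {n : ℕ} (hn : 0 < n) (u : ℝ → ℝ) {s : ℝ} (hs : s ∈ Ioc (0 : ℝ) 1) :
    dev n u s = n * ∫ r in (lo n s)..(lo n s + 1 / n), |u r - avg n u s| := by
  obtain ⟨h1, h2, h3⟩ := lo_bounds hn hs.1 hs.2
  rw [dev, avg]
  congr 1
  refine integral_congr_Ioc (by linarith) fun r hr => ?_
  rw [avg_eq_avg hn u hs hr]

theorem integral_sub_left_id (a s : ℝ) : ∫ r in a..s, (r - a) = (s - a) ^ 2 / 2 := by
  rw [intervalIntegral.integral_sub (by simp) (by simp), integral_id,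
    intervalIntegral.integral_const, smul_eq_mul]
  ring

/-- For functions constant on the cell the iterated integral is αβ(s - a)²/2. Replacing u and v by
their means, one at a time, costs their mean deviations. -/
theorem abs_E_sub_le {n : ℕ} (hn : 0 < n) {u v : ℝ → ℝ} (hu : Integrable u) (hv : Integrable v)
    {s : ℝ} (hs : s ∈ Ioc (0 : ℝ) 1) :
    |(n : ℝ) ^ 2 * E n u v s - avg n u s * avg n v s * ((n * (s - lo n s)) ^ 2 / 2)| ≤
      dev n u s * avg n (fun r => |v r|) s + |avg n u s| * dev n v s := by
  obtain ⟨h1, h2, h3⟩ := lo_bounds hn hs.1 hs.2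
  have hn' : (0 : ℝ) < n := by exact_mod_cast hn
  rw [dev_eq hn u hs, dev_eq hn v hs]
  rw [show avg n (fun r => |v r|) s = n * ∫ r in (lo n s)..(lo n s + 1 / n), |v r| from rfl]
  set α := avg n u s
  set β := avg n v s
  set a := lo n s
  have hci : ∀ (c x y : ℝ), IntervalIntegrable (fun _ : ℝ => c) volume x y :=
    fun c x y => _root_.intervalIntegrable_const
  have hra : ∀ x y, IntervalIntegrable (fun r : ℝ => r - a) volume x y := fun x y =>
    Continuous.intervalIntegrable (by fun_prop) _ _
  have hpr : ∀ r, ∫ p in a..r, (u p - α) = (∫ p in a..r, u p) - (r - a) * α := fun r => by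
    rw [intervalIntegral.integral_sub hu.intervalIntegrable (hci _ _ _),
      intervalIntegral.integral_const, smul_eq_mul]
  have e1 : E n u v s - α * β * ((s - a) ^ 2 / 2) =
      ∫ r in a..s, ((∫ p in a..r, (u p - α)) * v r + (r - a) * α * (v r - β)) := by
    rw [← integral_sub_left_id, E, ← intervalIntegral.integral_const_mul,
      ← intervalIntegral.integral_sub (intervalIntegrable_primitive_mul hu hv _ _ _)
        ((hra _ _).const_mul _)]
    congr 1
    ext r
    rw [hpr]
    ring
  have e2 : |E n u v s - α * β * ((s - a) ^ 2 / 2)| ≤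
      ∫ r in a..s, ((∫ p in a..(a + 1 / n), |u p - α|) * |v r| + 1 / n * |α| * |v r - β|) := by
    rw [e1]
    refine abs_integral_le_of_le h1.le ((hv.intervalIntegrable.abs.const_mul _).add
      ((hv.intervalIntegrable.sub (hci _ _ _)).abs.const_mul _)) fun r hr => ?_
    refine (abs_add_le _ _).trans (add_le_add ?_ ?_)
    · rw [abs_mul]
      refine mul_le_mul_of_nonneg_right ?_ (abs_nonneg _)
      exact (intervalIntegral.abs_integral_le_integral_abs hr.1.le).trans
        (intervalIntegral.integral_mono_interval le_rfl hr.1.le (hr.2.trans h2)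
          (Eventually.of_forall fun _ => abs_nonneg _)
          (hu.intervalIntegrable.sub (hci _ _ _)).abs)
    · rw [abs_mul, abs_mul, abs_of_pos (sub_pos.2 hr.1)]
      gcongr
      linarith [hr.2]
  have hvb : ∫ r in a..s, |v r| ≤ ∫ r in a..(a + 1 / n), |v r| :=
    intervalIntegral.integral_mono_interval le_rfl h1.le h2
      (Eventually.of_forall fun _ => abs_nonneg _) hv.intervalIntegrable.abs
  have hvb' : ∫ r in a..s, |v r - β| ≤ ∫ r in a..(a + 1 / n), |v r - β| :=
    intervalIntegral.integral_mono_interval le_rfl h1.le h2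
      (Eventually.of_forall fun _ => abs_nonneg _)
      (hv.intervalIntegrable.sub (hci _ _ _)).abs
  have hnn : 0 ≤ ∫ p in a..(a + 1 / n), |u p - α| :=
    intervalIntegral.integral_nonneg (by linarith) fun _ _ => abs_nonneg _
  rw [intervalIntegral.integral_add (hv.intervalIntegrable.abs.const_mul _)
    ((hv.intervalIntegrable.sub (hci _ _ _)).abs.const_mul _),
    intervalIntegral.integral_const_mul, intervalIntegral.integral_const_mul] at e2
  have e3 : |(n : ℝ) ^ 2 * E n u v s - α * β * ((n * (s - a)) ^ 2 / 2)| =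
      (n : ℝ) ^ 2 * |E n u v s - α * β * ((s - a) ^ 2 / 2)| := by
    conv_rhs => rw [← abs_of_nonneg (show (0 : ℝ) ≤ (n : ℝ) ^ 2 by positivity), ← abs_mul]
    congr 1
    ring
  rw [e3]
  calc _ ≤ (n : ℝ) ^ 2 * ((∫ p in a..(a + 1 / n), |u p - α|) * (∫ r in a..(a + 1 / n), |v r|) +
        1 / n * |α| * ∫ r in a..(a + 1 / n), |v r - β|) := by
        refine mul_le_mul_of_nonneg_left (e2.trans (add_le_add ?_ ?_)) (by positivity)
        · exact mul_le_mul_of_nonneg_left hvb hnn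
        · exact mul_le_mul_of_nonneg_left hvb' (by positivity)
    _ = _ := by field_simp

theorem E_bound {n : ℕ} (hn : 0 < n) {u v : ℝ → ℝ} (hu : Integrable u) (hv : Integrable v)
    {s : ℝ} (hs : s ∈ Ioc (0 : ℝ) 1) :
    (n : ℝ) ^ 2 * |E n u v s| ≤ avg n (fun r => |u r|) s * avg n (fun r => |v r|) s := by
  obtain ⟨h1, h2, h3⟩ := lo_bounds hn hs.1 hs.2
  have h := abs_iterated_integral_le hu hv h1.le
  have hb : ∀ {g : ℝ → ℝ}, Integrable g →
      ∫ r in (lo n s)..s, |g r| ≤ ∫ r in (lo n s)..(lo n s + 1 / n), |g r| := fun hg =>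
    intervalIntegral.integral_mono_interval le_rfl h1.le h2
      (Eventually.of_forall fun _ => abs_nonneg _) hg.intervalIntegrable.abs
  have hnn : ∀ {g : ℝ → ℝ}, 0 ≤ ∫ r in (lo n s)..s, |g r| := fun {g} =>
    intervalIntegral.integral_nonneg h1.le fun _ _ => abs_nonneg _
  rw [avg, avg]
  calc _ ≤ (n : ℝ) ^ 2 * ((∫ r in (lo n s)..(lo n s + 1 / n), |u r|) *
        ∫ r in (lo n s)..(lo n s + 1 / n), |v r|) := by
        refine mul_le_mul_of_nonneg_left (h.trans ?_) (by positivity)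
        exact mul_le_mul (hb hu) (hb hv) hnn (hnn.trans (hb hu))
    _ = _ := by ring

theorem N3_abs (u : ℝ → ℝ) : N3 (fun s => |u s|) = N3 u := by simp [N3]

theorem tendsto_integral_avg_mul {u v w : ℝ → ℝ} (hu : L3 u) (hv : L3 v) (hw : L3 w) :
    Tendsto (fun n => ∫ s in (0 : ℝ)..1, |avg n u s * avg n v s * avg n w s - u s * v s * w s|)
      atTop (𝓝 0) := by
  set K := N3 u + N3 v + N3 w
  have pu := N3_nonneg u
  have pv := N3_nonneg v
  have pw := N3_nonneg w
  have hpos := eventually_gt_atTop (0 : ℕ)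
  have A : ∀ {g : ℝ → ℝ}, L3 g → ∀ᶠ n in atTop, L3 (avg n g) := fun hg => by
    filter_upwards [hpos] with n hn using L3_avg hn hg.intervalIntegrable
  have D : ∀ {g : ℝ → ℝ}, L3 g → ∀ᶠ n in atTop, L3 (fun s => g s - avg n g s) := fun hg => by
    filter_upwards [hpos] with n hn using hg.sub (L3_avg hn hg.intervalIntegrable)
  have B : ∀ {g : ℝ → ℝ}, L3 g → N3 g ≤ K → ∀ᶠ n in atTop, N3 (avg n g) ≤ K := fun hg hK => by
    filter_upwards [hpos] with n hn using (N3_avg_le hn hg).trans hK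
  have t1 := tendsto_integral_mul_mul_zero (D hu) (A hv) (A hw) (tendsto_N3_sub_avg hu)
    (B hv (by simp only [K]; linarith)) (B hw (by simp only [K]; linarith))
  have t2 := tendsto_integral_mul_mul_zero (D hv) (Eventually.of_forall fun _ => hu) (A hw)
    (tendsto_N3_sub_avg hv) (K := K) (Eventually.of_forall fun _ => by simp only [K]; linarith)
    (B hw (by simp only [K]; linarith))
  have t3 := tendsto_integral_mul_mul_zero (D hw) (Eventually.of_forall fun _ => hu)
    (Eventually.of_forall fun _ => hv) (K := K)
    (tendsto_N3_sub_avg hw) (Eventually.of_forall fun _ => by simp only [K]; linarith)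
    (Eventually.of_forall fun _ => by simp only [K]; linarith)
  have t := (t1.add t2).add t3
  simp only [add_zero] at t
  refine tendsto_of_tendsto_of_tendsto_of_le_of_le' tendsto_const_nhds t
    (Eventually.of_forall fun n => intervalIntegral.integral_nonneg zero_le_one
      fun _ _ => abs_nonneg _) ?_
  filter_upwards [hpos] with n hn
  have au := L3_avg hn hu.intervalIntegrable
  have av := L3_avg hn hv.intervalIntegrable
  have aw := L3_avg hn hw.intervalIntegrable
  have i1 := ((hu.sub au).mul_mul av aw).abs
  have i2 := ((hv.sub av).mul_mul hu aw).abs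
  have i3 := ((hw.sub aw).mul_mul hu hv).abs
  rw [← intervalIntegral.integral_add i1 i2, ← intervalIntegral.integral_add (i1.add i2) i3]
  refine intervalIntegral.integral_mono_on zero_le_one
    ((au.mul_mul av aw).sub (hu.mul_mul hv hw)).abs ((i1.add i2).add i3) fun s _ => ?_
  -- One factor is exchanged at a time, so each term contains a single difference that tends to 0 in
  -- L³.
  rw [show avg n u s * avg n v s * avg n w s - u s * v s * w s =
    -((u s - avg n u s) * avg n v s * avg n w s) - (v s - avg n v s) * u s * avg n w s -
      (w s - avg n w s) * u s * v s by ring]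
  refine (abs_sub _ _).trans (add_le_add_left ((abs_sub _ _).trans ?_) _)
  rw [abs_neg]

theorem intervalIntegrable_of_bound {F G : ℝ → ℝ} (hF : Measurable F)
    (hG : IntervalIntegrable G volume 0 1) (h : ∀ s ∈ Ioc (0 : ℝ) 1, |F s| ≤ G s) :
    IntervalIntegrable F volume 0 1 := by
  rw [intervalIntegrable_iff_integrableOn_Ioc_of_le zero_le_one] at hG ⊢
  refine Integrable.mono' hG hF.aestronglyMeasurable ?_
  filter_upwards [ae_restrict_mem measurableSet_Ioc] with s hs using h s hs

theorem intervalIntegrable_of_bound' {F G : ℝ → ℝ}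
    (hF : AEStronglyMeasurable F (volume.restrict (Ioc (0 : ℝ) 1)))
    (hG : IntervalIntegrable G volume 0 1) (h : ∀ s ∈ Ioc (0 : ℝ) 1, |F s| ≤ G s) :
    IntervalIntegrable F volume 0 1 := by
  rw [intervalIntegrable_iff_integrableOn_Ioc_of_le zero_le_one] at hG ⊢
  refine Integrable.mono' hG hF ?_
  filter_upwards [ae_restrict_mem measurableSet_Ioc] with s hs using h s hs

theorem measurable_lo (n : ℕ) : Measurable (lo n) :=
  measurable_cell_comp n (g := fun k _ => (k : ℝ) / n) fun _ => measurable_const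

theorem scaled_offset_bounds {n : ℕ} (hn : 0 < n) {s : ℝ} (hs : s ∈ Ioc (0 : ℝ) 1) :
    0 ≤ n * (s - lo n s) ∧ n * (s - lo n s) ≤ 1 := by
  obtain ⟨h1, h2, -⟩ := lo_bounds hn hs.1 hs.2
  have hn' : (0 : ℝ) < n := by exact_mod_cast hn
  refine ⟨mul_nonneg hn'.le (by linarith), ?_⟩
  calc (n : ℝ) * (s - lo n s) ≤ n * (1 / n) := by gcongr; linarith
    _ = 1 := by field_simp

/-- `n²` times the iterated integral is asymptotically the product of the averages times
`(n (s - lo))² / 2`, in mean against an `L³` function. -/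
theorem tendsto_integral_E_sub {u v w : ℝ → ℝ} (hu : Integrable u) (hv : Integrable v)
    (hu3 : L3 u) (hv3 : L3 v) (hw3 : L3 w) :
    Tendsto (fun n : ℕ => ∫ s in (0 : ℝ)..1, |(n : ℝ) ^ 2 * E n u v s * w s -
      avg n u s * avg n v s * avg n w s * ((n * (s - lo n s)) ^ 2 / 2)|) atTop (𝓝 0) := by
  set K := N3 u + N3 v + N3 w
  have pu := N3_nonneg u
  have pv := N3_nonneg v
  have pw := N3_nonneg w
  have hpos := eventually_gt_atTop (0 : ℕ)
  have A : ∀ {g : ℝ → ℝ}, L3 g → ∀ᶠ n in atTop, L3 (avg n g) := fun hg => by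
    filter_upwards [hpos] with n hn using L3_avg hn hg.intervalIntegrable
  have B : ∀ {g : ℝ → ℝ}, L3 g → N3 g ≤ K → ∀ᶠ n in atTop, N3 (avg n g) ≤ K := fun hg hK => by
    filter_upwards [hpos] with n hn using (N3_avg_le hn hg).trans hK
  have D : ∀ {g : ℝ → ℝ}, L3 g → ∀ᶠ n in atTop, L3 (dev n g) := fun hg => by
    filter_upwards [hpos] with n hn using L3_dev hn hg
  have D' : ∀ {g : ℝ → ℝ}, L3 g → ∀ᶠ n in atTop, L3 (fun s => g s - avg n g s) := fun hg => by
    filter_upwards [hpos] with n hn using hg.sub (L3_avg hn hg.intervalIntegrable)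
  have t1 := tendsto_integral_mul_mul_zero (D hu3) (A hv3.abs) (Eventually.of_forall fun _ => hw3)
    (tendsto_N3_dev hu3) (B hv3.abs (by rw [N3_abs]; simp only [K]; linarith))
    (Eventually.of_forall fun _ => by simp only [K]; linarith)
  have t2 := tendsto_integral_mul_mul_zero (D hv3) (A hu3) (Eventually.of_forall fun _ => hw3)
    (tendsto_N3_dev hv3) (B hu3 (by simp only [K]; linarith))
    (Eventually.of_forall fun _ => by simp only [K]; linarith)
  have t3 := tendsto_integral_mul_mul_zero (D' hw3) (A hu3) (A hv3)
    (tendsto_N3_sub_avg hw3) (B hu3 (by simp only [K]; linarith))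
    (B hv3 (by simp only [K]; linarith))
  have t := (t1.add t2).add t3
  simp only [add_zero] at t
  refine tendsto_of_tendsto_of_tendsto_of_le_of_le' tendsto_const_nhds t
    (Eventually.of_forall fun n => intervalIntegral.integral_nonneg zero_le_one
      fun _ _ => abs_nonneg _) ?_
  filter_upwards [hpos] with n hn
  have au := L3_avg hn hu3.intervalIntegrable
  have av := L3_avg hn hv3.intervalIntegrable
  have av' := L3_avg hn hv3.intervalIntegrable.abs
  have aw := L3_avg hn hw3.intervalIntegrable
  have i1 := ((L3_dev hn hu3).mul_mul av' hw3).abs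
  have i2 := ((L3_dev hn hv3).mul_mul au hw3).abs
  have i3 := ((hw3.sub aw).mul_mul au av).abs
  have hb : ∀ s ∈ Ioc (0 : ℝ) 1, |(n : ℝ) ^ 2 * E n u v s * w s -
      avg n u s * avg n v s * avg n w s * ((n * (s - lo n s)) ^ 2 / 2)| ≤
      |dev n u s * avg n (fun r => |v r|) s * w s| + |dev n v s * avg n u s * w s| +
        |(w s - avg n w s) * avg n u s * avg n v s| := by
    intro s hs
    have e := abs_E_sub_le hn hu hv hs
    obtain ⟨o1, o2⟩ := scaled_offset_bounds hn hs
    set p := (n * (s - lo n s)) ^ 2 / 2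
    have hp : |p| ≤ 1 := by
      rw [abs_of_nonneg (by positivity)]
      have := pow_le_one₀ o1 o2 (n := 2)
      simp only [p]; linarith
    -- Two errors: the approximation of the iterated integral, multiplied by w, and the replacement
    -- of w by its average.
    rw [show (n : ℝ) ^ 2 * E n u v s * w s - avg n u s * avg n v s * avg n w s * p =
      ((n : ℝ) ^ 2 * E n u v s - avg n u s * avg n v s * p) * w s +
        (w s - avg n w s) * avg n u s * avg n v s * p by ring]
    refine (abs_add_le _ _).trans (add_le_add ?_ ?_)
    · rw [abs_mul]
      refine (mul_le_mul_of_nonneg_right e (abs_nonneg _)).trans ?_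
      rw [add_mul, abs_mul _ (w s), abs_mul _ (w s)]
      refine add_le_add (mul_le_mul_of_nonneg_right (le_abs_self _) (abs_nonneg _))
        (mul_le_mul_of_nonneg_right ?_ (abs_nonneg _))
      rw [abs_mul, mul_comm]
      exact mul_le_mul_of_nonneg_right (le_abs_self _) (abs_nonneg _)
    · rw [abs_mul]
      exact mul_le_of_le_one_right (abs_nonneg _) hp
  rw [← intervalIntegral.integral_add i1 i2, ← intervalIntegral.integral_add (i1.add i2) i3]
  refine integral_mono_Ioc zero_le_one ?_ ((i1.add i2).add i3) hb
  refine intervalIntegrable_of_bound' ?_ ((i1.add i2).add i3) fun s hs => by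
    rw [abs_abs]; exact hb s hs
  have m1 : Measurable fun s => (n : ℝ) ^ 2 * E n u v s :=
    (measurable_E n hu hv).const_mul _
  have m2 : Measurable fun s => (n * (s - lo n s)) ^ 2 / 2 :=
    (((measurable_id.sub (measurable_lo n)).const_mul _).pow_const 2).div_const 2
  have m3 : Measurable fun s => avg n u s * avg n v s * avg n w s :=
    ((measurable_avg n u).mul (measurable_avg n v)).mul (measurable_avg n w)
  exact ((m1.aestronglyMeasurable.mul hw3.aestronglyMeasurable).sub
    (m3.mul m2).aestronglyMeasurable).norm

/-! ### The factor 1/6 and the trilinear limit -/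

theorem abs_offset_sub_le {n : ℕ} (hn : 0 < n) {s : ℝ} (hs : s ∈ Ioc (0 : ℝ) 1) :
    |(n * (s - lo n s)) ^ 2 / 2 - 1 / 6| ≤ 1 := by
  obtain ⟨o1, o2⟩ := scaled_offset_bounds hn hs
  have := pow_le_one₀ o1 o2 (n := 2)
  rw [abs_le]
  constructor <;> nlinarith [sq_nonneg (n * (s - lo n s))]

/-- The mean of θ²/2 over [0,1] is 1/6. This is the source of the constant in the limit equation. -/
theorem integral_offset_cell {n k : ℕ} (hn : 0 < n) :
    ∫ s in ((k : ℝ) / n)..(((k : ℝ) + 1) / n), ((n * (s - (k : ℝ) / n)) ^ 2 / 2 - 1 / 6) = 0 := by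
  have hn' : (0 : ℝ) < n := by exact_mod_cast hn
  rw [intervalIntegral.integral_sub (Continuous.intervalIntegrable (by fun_prop) _ _)
    (Continuous.intervalIntegrable (by fun_prop) _ _), intervalIntegral.integral_div,
    intervalIntegral.integral_comp_sub_right (fun x => (n * x) ^ 2)]
  simp only [mul_pow, intervalIntegral.integral_const_mul, intervalIntegral.integral_const,
    integral_pow, sub_self, cell_length, smul_eq_mul]
  norm_num
  field_simp
  norm_num

theorem measurable_of_cell (n : ℕ) (g : ℕ → ℝ) : Measurable fun s => g (cell n s) :=
  measurable_cell_comp n (g := fun k _ => g k) fun _ => measurable_const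

theorem cell_lt {n : ℕ} (hn : 0 < n) {s : ℝ} (hs : s ∈ Ioc (0 : ℝ) 1) : cell n s < n := by
  obtain ⟨k, hk, -, -, e⟩ := exists_cell hn hs.1 hs.2
  rwa [e]

theorem intervalIntegrable_of_cell {n : ℕ} (hn : 0 < n) (g : ℕ → ℝ) :
    IntervalIntegrable (fun s => g (cell n s)) volume 0 1 := by
  refine intervalIntegrable_of_bound (G := fun _ => ∑ k ∈ Finset.range n, |g k|)
    (measurable_of_cell n g) _root_.intervalIntegrable_const fun s hs => ?_
  exact Finset.single_le_sum (f := fun k => |g k|) (fun k _ => abs_nonneg _)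
    (Finset.mem_range.2 (cell_lt hn hs))

/-- Against a function constant on cells, the centred offset integrates to 0 over every complete
cell, so only the unfinished last cell contributes. -/
theorem abs_integral_offset_le {n : ℕ} (hn : 0 < n) (g : ℕ → ℝ) {t : ℝ}
    (ht : t ∈ Ioc (0 : ℝ) 1) :
    |∫ s in (0 : ℝ)..t, g (cell n s) * ((n * (s - lo n s)) ^ 2 / 2 - 1 / 6)| ≤
      ∫ s in (lo n t)..t, |g (cell n s)| := by
  obtain ⟨k, hk, e1, e2, e3⟩ := exists_cell hn ht.1 ht.2
  have hi : IntervalIntegrable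
      (fun s => g (cell n s) * ((n * (s - lo n s)) ^ 2 / 2 - 1 / 6)) volume 0 1 := by
    refine intervalIntegrable_of_bound (G := fun s => |g (cell n s)|) ?_
      (intervalIntegrable_of_cell hn g).abs fun s hs => ?_
    · exact (measurable_of_cell n g).mul
        (((((measurable_id.sub (measurable_lo n)).const_mul _).pow_const 2).div_const 2).sub_const _)
    · rw [abs_mul]
      exact mul_le_of_le_one_right (abs_nonneg _) (abs_offset_sub_le hn hs)
  have hn' : (0 : ℝ) < n := by exact_mod_cast hn
  have hl : lo n t = (k : ℝ) / n := lo_eq hn e1 e2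
  have hk1 : (k : ℝ) / n ∈ Icc (0 : ℝ) 1 := ⟨by positivity, by linarith [ht.2]⟩
  have ht' : t ∈ Icc (0 : ℝ) 1 := ⟨ht.1.le, ht.2⟩
  rw [hl, ← intervalIntegral.integral_add_adjacent_intervals
    (intervalIntegrable_sub hi ⟨le_rfl, zero_le_one⟩ hk1) (intervalIntegrable_sub hi hk1 ht'),
    integral_eq_sum_cells hn hi hk.le, Finset.sum_eq_zero, zero_add]
  · refine abs_integral_le_of_le e1.le
      (intervalIntegrable_sub (intervalIntegrable_of_cell hn g).abs hk1 ht') fun s hs => ?_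
    rw [abs_mul]
    exact mul_le_of_le_one_right (abs_nonneg _)
      (abs_offset_sub_le hn ⟨lt_of_le_of_lt hk1.1 hs.1, hs.2.trans ht.2⟩)
  · intro j hj
    rw [integral_congr_Ioc cell_le (g := fun s => g j * ((n * (s - (j : ℝ) / n)) ^ 2 / 2 - 1 / 6))
      fun s hs => by rw [cell_eq hn hs.1 hs.2, lo_eq hn hs.1 hs.2],
      intervalIntegral.integral_const_mul, integral_offset_cell hn, mul_zero]

/-- Uniform continuity of the primitive of |g|. -/
theorem exists_small_grid_oscillation {g : ℝ → ℝ} (hg : IntervalIntegrable g volume 0 1)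
    {ε : ℝ} (hε : 0 < ε) :
    ∀ᶠ n : ℕ in atTop, ∀ t ∈ Ioc (0 : ℝ) 1, ∫ s in (lo n t)..(lo n t + 1 / n), |g s| ≤ ε := by
  have hac := hg.abs.absolutelyContinuousOnInterval_intervalIntegral (c := 0) (by simp)
  have hc := hac.continuousOn
  rw [uIcc_of_le zero_le_one] at hc
  obtain ⟨δ, hδ, h⟩ := continuousOn_unif hc ε hε
  obtain ⟨n₀, hn₀⟩ := exists_nat_gt (1 / δ)
  filter_upwards [eventually_gt_atTop n₀] with n hn t ht
  have hn0 : 0 < n := by omega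
  have hn' : (0 : ℝ) < n := by exact_mod_cast hn0
  have hnδ : 1 / (n : ℝ) < δ := by
    rw [div_lt_iff₀ hn']
    rw [div_lt_iff₀ hδ] at hn₀
    have : (n₀ : ℝ) < n := by exact_mod_cast hn
    nlinarith
  obtain ⟨h1, h2, h3⟩ := lo_bounds hn0 ht.1 ht.2
  have m1 : lo n t ∈ Icc (0 : ℝ) 1 := ⟨lo_nonneg n t, by linarith [ht.2]⟩
  have m2 : lo n t + 1 / n ∈ Icc (0 : ℝ) 1 := ⟨by linarith [ht.1], h3⟩
  have m0 : (0 : ℝ) ∈ Icc (0 : ℝ) 1 := ⟨le_rfl, zero_le_one⟩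
  have := h _ _ m1 m2 (by rw [add_sub_cancel_left, abs_of_pos (by positivity)]; exact hnδ)
  rw [intervalIntegral.integral_interval_sub_left (intervalIntegrable_sub hg.abs m0 m2)
    (intervalIntegrable_sub hg.abs m0 m1)] at this
  exact (le_abs_self _).trans this

/-- Limit of the weighted trilinear functionals that govern the error of the scheme. -/
theorem tendsto_trilinear {u v w : ℝ → ℝ} (hu : Integrable u) (hv : Integrable v)
    (hu3 : L3 u) (hv3 : L3 v) (hw3 : L3 w) {c : ℕ → ℕ → ℝ} {c₀ : ℝ → ℝ}
    (hc₀ : ContinuousOn c₀ (Icc 0 1))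
    (hc : ∀ ε > 0, ∀ᶠ n in atTop, ∀ s ∈ Ioc (0 : ℝ) 1, |c n (cell n s) - c₀ s| ≤ ε)
    {ε : ℝ} (hε : 0 < ε) :
    ∀ᶠ n : ℕ in atTop, ∀ t ∈ Icc (0 : ℝ) 1,
      |(∫ s in (0 : ℝ)..t, c n (cell n s) * ((n : ℝ) ^ 2 * E n u v s) * w s) -
        1 / 6 * ∫ s in (0 : ℝ)..t, c₀ s * (u s * v s * w s)| ≤ ε := by
  obtain ⟨M₀, hM₀⟩ := isCompact_Icc.exists_bound_of_continuousOn hc₀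
  set M := |M₀| + 1 with hM
  have hMpos : 0 < M := by positivity
  set I := ∫ s in (0 : ℝ)..1, |u s * v s * w s| with hI
  have hIi := (hu3.mul_mul hv3 hw3)
  have hI0 : 0 ≤ I := intervalIntegral.integral_nonneg zero_le_one fun _ _ => abs_nonneg _
  -- The four errors below are at most Mη, 2Mη, Mη and Iη.
  set η := ε / (4 * M + I + 1) with hη
  have hηpos : 0 < η := by positivity
  have t1 := (tendsto_integral_E_sub hu hv hu3 hv3 hw3).eventually (gt_mem_nhds hηpos)
  have t2 := (tendsto_integral_avg_mul hu3 hv3 hw3).eventually (gt_mem_nhds hηpos)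
  have t3 := exists_small_grid_oscillation hIi hηpos
  filter_upwards [t1, t2, t3, hc η hηpos, hc 1 one_pos, eventually_gt_atTop 0] with n a1 a2 a3 a4 a5 hn
  intro t ht
  rcases ht.1.eq_or_lt with h0 | h0
  · rw [← h0]; simp [hε.le]
  have ht' : t ∈ Ioc (0 : ℝ) 1 := ⟨h0, ht.2⟩
  have hm0 : (0 : ℝ) ∈ Icc (0 : ℝ) 1 := ⟨le_rfl, zero_le_one⟩
  obtain ⟨l1, l2, l3⟩ := lo_bounds hn ht'.1 ht'.2
  have hml : lo n t ∈ Icc (0 : ℝ) 1 := ⟨lo_nonneg n t, by linarith [ht.2]⟩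
  have hml' : lo n t + 1 / n ∈ Icc (0 : ℝ) 1 := ⟨by linarith, l3⟩
  have bC : ∀ s ∈ Ioc (0 : ℝ) 1, |c n (cell n s)| ≤ M := fun s hs => by
    have e1 := a5 s hs
    have e2 := hM₀ s ⟨hs.1.le, hs.2⟩
    rw [Real.norm_eq_abs] at e2
    have e3 := abs_sub_abs_le_abs_sub (c n (cell n s)) (c₀ s)
    have e4 := le_abs_self M₀
    linarith
  have au := L3_avg hn hu3.intervalIntegrable
  have av := L3_avg hn hv3.intervalIntegrable
  have aw := L3_avg hn hw3.intervalIntegrable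
  set C : ℝ → ℝ := fun s => c n (cell n s) with hC
  set A : ℝ → ℝ := fun s => avg n u s * avg n v s * avg n w s with hA
  set B : ℝ → ℝ := fun s => u s * v s * w s with hB
  set p : ℝ → ℝ := fun s => (n * (s - lo n s)) ^ 2 / 2 with hp
  set T : ℝ → ℝ := fun s => (n : ℝ) ^ 2 * E n u v s * w s with hT
  have mC : Measurable C := measurable_of_cell n _
  have mp : Measurable p :=
    (((measurable_id.sub (measurable_lo n)).const_mul _).pow_const 2).div_const 2
  have iA : IntervalIntegrable A volume 0 1 := au.mul_mul av aw
  have mA : Measurable A := ((measurable_avg n u).mul (measurable_avg n v)).mul (measurable_avg n w)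
  have iB : IntervalIntegrable B volume 0 1 := hIi
  have mB : AEStronglyMeasurable B (volume.restrict (Ioc (0 : ℝ) 1)) :=
    (hu3.aestronglyMeasurable.mul hv3.aestronglyMeasurable).mul hw3.aestronglyMeasurable
  have mT : AEStronglyMeasurable T (volume.restrict (Ioc (0 : ℝ) 1)) :=
    ((measurable_E n hu hv).const_mul _).aestronglyMeasurable.mul hw3.aestronglyMeasurable
  have iT : IntervalIntegrable T volume 0 1 := by
    refine intervalIntegrable_of_bound' mT ((L3_avg hn hu3.intervalIntegrable.abs).mul_mul
      (L3_avg hn hv3.intervalIntegrable.abs) hw3.abs) fun s hs => ?_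
    simp only [hT]
    rw [abs_mul, abs_mul, abs_of_nonneg (by positivity : (0 : ℝ) ≤ (n : ℝ) ^ 2)]
    exact mul_le_mul_of_nonneg_right (E_bound hn hu hv hs) (abs_nonneg _)
  have iCmul : ∀ {g : ℝ → ℝ}, AEStronglyMeasurable g (volume.restrict (Ioc (0 : ℝ) 1)) →
      IntervalIntegrable g volume 0 1 → IntervalIntegrable (fun s => C s * g s) volume 0 1 := by
    intro g mg ig
    refine intervalIntegrable_of_bound' (mC.aestronglyMeasurable.mul mg) (ig.abs.const_mul M)
      fun s hs => ?_
    rw [abs_mul]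
    exact mul_le_mul_of_nonneg_right (bC s hs) (abs_nonneg _)
  have iAp : IntervalIntegrable (fun s => A s * p s) volume 0 1 := by
    refine intervalIntegrable_of_bound (mA.mul mp) iA.abs fun s hs => ?_
    rw [abs_mul]
    refine mul_le_of_le_one_right (abs_nonneg _) ?_
    obtain ⟨o1, o2⟩ := scaled_offset_bounds hn hs
    have := pow_le_one₀ o1 o2 (n := 2)
    simp only [hp]
    rw [abs_of_nonneg (by positivity)]
    linarith
  have iCB := iCmul mB iB
  have iCA := iCmul mA.aestronglyMeasurable iA
  have iCT := iCmul mT iT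
  have iCAp : IntervalIntegrable (fun s => C s * (A s * p s)) volume 0 1 :=
    iCmul (mA.mul mp).aestronglyMeasurable iAp
  have iSub : ∀ {g : ℝ → ℝ}, IntervalIntegrable g volume 0 1 → IntervalIntegrable g volume 0 t :=
    fun hg => intervalIntegrable_sub hg hm0 ht
  have ic₀B : IntervalIntegrable (fun s => c₀ s * B s) volume 0 1 :=
    iB.continuousOn_mul (by rwa [uIcc_of_le zero_le_one])
  -- Four successive replacements: the iterated integral by averages times the offset p, then p by
  -- 1/6, the averages by the functions, and the discrete coefficient by c₀.
  have split : (∫ s in (0 : ℝ)..t, C s * ((n : ℝ) ^ 2 * E n u v s) * w s) -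
      1 / 6 * ∫ s in (0 : ℝ)..t, c₀ s * B s =
      (∫ s in (0 : ℝ)..t, C s * (T s - A s * p s)) + (∫ s in (0 : ℝ)..t, C s * A s * (p s - 1 / 6))
      + 1 / 6 * (∫ s in (0 : ℝ)..t, C s * (A s - B s))
      + 1 / 6 * ∫ s in (0 : ℝ)..t, (C s - c₀ s) * B s := by
    have q1 : ∫ s in (0 : ℝ)..t, C s * (T s - A s * p s) =
        (∫ s in (0 : ℝ)..t, C s * T s) - ∫ s in (0 : ℝ)..t, C s * (A s * p s) := by
      rw [← intervalIntegral.integral_sub (iSub iCT) (iSub iCAp)]; congr 1; ext s; ring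
    have q2 : ∫ s in (0 : ℝ)..t, C s * A s * (p s - 1 / 6) =
        (∫ s in (0 : ℝ)..t, C s * (A s * p s)) - 1 / 6 * ∫ s in (0 : ℝ)..t, C s * A s := by
      rw [← intervalIntegral.integral_const_mul,
        ← intervalIntegral.integral_sub (iSub iCAp) ((iSub iCA).const_mul _)]
      congr 1; ext s; ring
    have q3 : ∫ s in (0 : ℝ)..t, C s * (A s - B s) =
        (∫ s in (0 : ℝ)..t, C s * A s) - ∫ s in (0 : ℝ)..t, C s * B s := by
      rw [← intervalIntegral.integral_sub (iSub iCA) (iSub iCB)]; congr 1; ext s; ring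
    have q4 : ∫ s in (0 : ℝ)..t, (C s - c₀ s) * B s =
        (∫ s in (0 : ℝ)..t, C s * B s) - ∫ s in (0 : ℝ)..t, c₀ s * B s := by
      rw [← intervalIntegral.integral_sub (iSub iCB) (iSub ic₀B)]; congr 1; ext s; ring
    have q5 : ∫ s in (0 : ℝ)..t, C s * ((n : ℝ) ^ 2 * E n u v s) * w s =
        ∫ s in (0 : ℝ)..t, C s * T s := by congr 1; ext s; simp only [hT]; ring
    rw [q1, q2, q3, q4, q5]; ring
  have hAB : ∫ s in (0 : ℝ)..t, |A s - B s| ≤ η :=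
    (integral_le_of_subinterval (iA.sub iB).abs (fun _ => abs_nonneg _) le_rfl ht.1 ht.2).trans a2.le
  have b1 : |∫ s in (0 : ℝ)..t, C s * (T s - A s * p s)| ≤ M * η := by
    refine (abs_integral_le_of_le ht.1 ((iSub (iT.sub iAp).abs).const_mul M) fun s hs => ?_).trans ?_
    · rw [abs_mul]
      exact mul_le_mul_of_nonneg_right (bC s ⟨hs.1, hs.2.trans ht.2⟩) (abs_nonneg _)
    · rw [intervalIntegral.integral_const_mul]
      refine mul_le_mul_of_nonneg_left (le_trans ?_ a1.le) hMpos.le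
      exact integral_le_of_subinterval (iT.sub iAp).abs (fun _ => abs_nonneg _) le_rfl ht.1 ht.2
  have b2 : |∫ s in (0 : ℝ)..t, C s * A s * (p s - 1 / 6)| ≤ M * (η + η) := by
    -- C and the averages depend on the cell only, so complete cells cancel. On the last one A is
    -- close to B in L¹, and B has small integral over any short cell.
    have := abs_integral_offset_le hn (fun k => c n k *
      ((n * ∫ r in ((k : ℝ) / n)..((k : ℝ) / n + 1 / n), u r) *
        (n * ∫ r in ((k : ℝ) / n)..((k : ℝ) / n + 1 / n), v r) *
        (n * ∫ r in ((k : ℝ) / n)..((k : ℝ) / n + 1 / n), w r))) ht'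
    refine (show _ ≤ ∫ s in (lo n t)..t, |C s * A s| from this).trans ?_
    have hle : ∫ s in (lo n t)..t, |C s * A s| ≤
        ∫ s in (lo n t)..t, M * (|A s - B s| + |B s|) := by
      refine integral_mono_Ioc l1.le (intervalIntegrable_sub iCA.abs hml ht)
        ((intervalIntegrable_sub ((iA.sub iB).abs.add iB.abs) hml ht).const_mul M) fun s hs => ?_
      rw [abs_mul]
      refine mul_le_mul (bC s ⟨lt_of_le_of_lt hml.1 hs.1, hs.2.trans ht.2⟩) ?_ (abs_nonneg _) hMpos.le
      have := abs_add_le (A s - B s) (B s)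
      rwa [sub_add_cancel] at this
    refine hle.trans ?_
    rw [intervalIntegral.integral_const_mul, intervalIntegral.integral_add
      (intervalIntegrable_sub (iA.sub iB).abs hml ht) (intervalIntegrable_sub iB.abs hml ht)]
    refine mul_le_mul_of_nonneg_left (add_le_add ?_ ?_) hMpos.le
    · exact (integral_le_of_subinterval (iA.sub iB).abs (fun _ => abs_nonneg _) hml.1 l1.le
        ht.2).trans a2.le
    · refine le_trans ?_ (a3 t ht')
      exact intervalIntegral.integral_mono_interval le_rfl l1.le l2
        (Eventually.of_forall fun _ => abs_nonneg _) (intervalIntegrable_sub iB.abs hml hml')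
  have b3 : |∫ s in (0 : ℝ)..t, C s * (A s - B s)| ≤ M * η := by
    refine (abs_integral_le_of_le ht.1 ((iSub (iA.sub iB).abs).const_mul M) fun s hs => ?_).trans ?_
    · rw [abs_mul]
      exact mul_le_mul_of_nonneg_right (bC s ⟨hs.1, hs.2.trans ht.2⟩) (abs_nonneg _)
    · rw [intervalIntegral.integral_const_mul]
      exact mul_le_mul_of_nonneg_left hAB hMpos.le
  have b4 : |∫ s in (0 : ℝ)..t, (C s - c₀ s) * B s| ≤ η * I := by
    refine (abs_integral_le_of_le ht.1 ((iSub iB.abs).const_mul η) fun s hs => ?_).trans ?_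
    · rw [abs_mul]
      exact mul_le_mul_of_nonneg_right (a4 s ⟨hs.1, hs.2.trans ht.2⟩) (abs_nonneg _)
    · rw [intervalIntegral.integral_const_mul]
      exact mul_le_mul_of_nonneg_left (integral_le_of_subinterval iB.abs (fun _ => abs_nonneg _)
        le_rfl ht.1 ht.2) hηpos.le
  have hηε : η * (4 * M + I + 1) = ε := by rw [hη]; field_simp
  have hfin : |(∫ s in (0 : ℝ)..t, C s * ((n : ℝ) ^ 2 * E n u v s) * w s) -
      1 / 6 * ∫ s in (0 : ℝ)..t, c₀ s * B s| ≤ M * η + M * (η + η) + M * η + η * I := by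
    rw [split]
    refine (abs_add_le _ _).trans (add_le_add ((abs_add_le _ _).trans (add_le_add
      ((abs_add_le _ _).trans (add_le_add b1 b2)) ?_)) ?_)
    · rw [abs_mul, abs_of_pos (by norm_num : (0 : ℝ) < 1 / 6)]
      have := abs_nonneg (∫ s in (0 : ℝ)..t, C s * (A s - B s)); linarith
    · rw [abs_mul, abs_of_pos (by norm_num : (0 : ℝ) < 1 / 6)]
      have := abs_nonneg (∫ s in (0 : ℝ)..t, (C s - c₀ s) * B s); linarith
  refine hfin.trans ?_
  nlinarith

/-! ### Uniform Taylor estimates -/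

section Taylor

variable {V : Type*} [NormedAddCommGroup V] [NormedSpace ℝ V]

theorem norm_fderiv_sub_le_of_second {φ : V → ℝ} (hφ : ContDiff ℝ 2 φ) {z : V} {L : V →L[ℝ] V →L[ℝ] ℝ}
    {ε δ : ℝ} (h : ∀ x, ‖x - z‖ ≤ δ → ‖fderiv ℝ (fderiv ℝ φ) x - L‖ ≤ ε) {x : V}
    (hx : ‖x - z‖ ≤ δ) : ‖fderiv ℝ φ x - fderiv ℝ φ z - L (x - z)‖ ≤ ε * ‖x - z‖ := by
  have hd : Differentiable ℝ (fderiv ℝ φ) :=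
    (hφ.fderiv_right (m := 1) (by norm_num)).differentiable (by norm_num)
  have hδ : 0 ≤ δ := (norm_nonneg _).trans hx
  have := (convex_closedBall z δ).norm_image_sub_le_of_norm_hasFDerivWithin_le
    (f := fun x => fderiv ℝ φ x - L x) (f' := fun x => fderiv ℝ (fderiv ℝ φ) x - L) (C := ε)
    (fun x _ => ((hd x).hasFDerivAt.sub L.hasFDerivAt).hasFDerivWithinAt)
    (fun x hx => h x (by rwa [mem_closedBall_iff_norm] at hx))
    (Metric.mem_closedBall_self hδ) (mem_closedBall_iff_norm.2 hx)
  rw [map_sub, show fderiv ℝ φ x - fderiv ℝ φ z - (L x - L z) =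
    fderiv ℝ φ x - L x - (fderiv ℝ φ z - L z) by abel]
  exact this

/-- Mean value inequality along the segment for φ minus its quadratic model with Hessian L. The case
L = 0 gives the quadratic remainder bound, and L the second derivative at z gives the second order
expansion. -/
theorem abs_taylor_le_of_second {φ : V → ℝ} (hφ : ContDiff ℝ 2 φ) {z : V}
    {L : V →L[ℝ] V →L[ℝ] ℝ}
    {ε δ : ℝ} (hε : 0 ≤ ε) (h : ∀ x, ‖x - z‖ ≤ δ → ‖fderiv ℝ (fderiv ℝ φ) x - L‖ ≤ ε) {k : V}
    (hk : ‖k‖ ≤ δ) :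
    |φ (z + k) - φ z - fderiv ℝ φ z k - 1 / 2 * L k k| ≤ ε * ‖k‖ ^ 2 := by
  have hd : Differentiable ℝ φ := hφ.differentiable (by norm_num)
  set g : ℝ → ℝ := fun t => φ (z + t • k) - t * fderiv ℝ φ z k - t ^ 2 / 2 * L k k with hg
  have hder : ∀ t, HasDerivAt g (fderiv ℝ φ (z + t • k) k - fderiv ℝ φ z k - t * L k k) t := by
    intro t
    have h1 : HasDerivAt (fun t : ℝ => z + t • k) k t := by
      simpa using ((hasDerivAt_id t).smul_const k).const_add z
    have h2 := (hd (z + t • k)).hasFDerivAt.comp_hasDerivAt t h1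
    have h3 : HasDerivAt (fun t : ℝ => t * fderiv ℝ φ z k) (fderiv ℝ φ z k) t := by
      simpa using (hasDerivAt_id t).mul_const (fderiv ℝ φ z k)
    have h4 : HasDerivAt (fun t : ℝ => t ^ 2 / 2 * L k k) (t * L k k) t := by
      have := ((hasDerivAt_pow 2 t).div_const 2).mul_const (L k k)
      have e : ((2 : ℕ) : ℝ) * t ^ (2 - 1) / 2 = t := by norm_num
      rw [e] at this
      exact this
    exact (h2.sub h3).sub h4
  have hb : ∀ t ∈ Ico (0 : ℝ) 1,
      ‖fderiv ℝ φ (z + t • k) k - fderiv ℝ φ z k - t * L k k‖ ≤ ε * ‖k‖ ^ 2 := by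
    intro t ht
    have hn : ‖z + t • k - z‖ ≤ ‖k‖ := by
      rw [add_sub_cancel_left, norm_smul, Real.norm_eq_abs, abs_of_nonneg ht.1]
      exact mul_le_of_le_one_left (norm_nonneg _) ht.2.le
    have := norm_fderiv_sub_le_of_second hφ h (hn.trans hk)
    have e : fderiv ℝ φ (z + t • k) k - fderiv ℝ φ z k - t * L k k =
        (fderiv ℝ φ (z + t • k) - fderiv ℝ φ z - L (z + t • k - z)) k := by
      simp
    rw [e]
    calc _ ≤ ‖fderiv ℝ φ (z + t • k) - fderiv ℝ φ z - L (z + t • k - z)‖ * ‖k‖ :=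
          ContinuousLinearMap.le_opNorm _ _
      _ ≤ (ε * ‖k‖) * ‖k‖ := by
          refine mul_le_mul_of_nonneg_right (this.trans ?_) (norm_nonneg _)
          exact mul_le_mul_of_nonneg_left hn hε
      _ = _ := by ring
  have := norm_image_sub_le_of_norm_deriv_le_segment_01' (f := g)
    (fun t _ => (hder t).hasDerivWithinAt) hb
  rw [Real.norm_eq_abs] at this
  convert this using 2
  simp [hg]
  ring

/-- Uniform bounds for a `C²` function and its Taylor expansions. -/
structure TameBound (φ : V → ℝ) (M : ℝ) : Prop where
  nonneg : 0 ≤ M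
  val : ∀ x, |φ x| ≤ M
  deriv : ∀ x h, |fderiv ℝ φ x h| ≤ M * ‖h‖
  lip : ∀ x z, |φ x - φ z| ≤ M * ‖x - z‖
  taylor : ∀ z h, |φ (z + h) - φ z - fderiv ℝ φ z h| ≤ M * ‖h‖ ^ 2
  second : ∀ z h k, |fderiv ℝ (fderiv ℝ φ) z h k| ≤ M * ‖h‖ * ‖k‖

theorem TameBound.mono {φ : V → ℝ} {M M' : ℝ} (h : TameBound φ M) (hM : M ≤ M') :
    TameBound φ M' where
  nonneg := h.nonneg.trans hM
  val x := (h.val x).trans hM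
  deriv x k := (h.deriv x k).trans (by gcongr)
  lip x z := (h.lip x z).trans (by gcongr)
  taylor z k := (h.taylor z k).trans (by gcongr)
  second z k l := (h.second z k l).trans (by gcongr)

theorem exists_tameBound {φ : V → ℝ} (hφ : ContDiff ℝ 2 φ) (hs : HasCompactSupport φ) :
    ∃ M, TameBound φ M := by
  obtain ⟨M0, h0⟩ := hφ.continuous.bounded_above_of_compact_support hs
  have hc1 : ContDiff ℝ 1 (fderiv ℝ φ) := hφ.fderiv_right (m := 1) (by norm_num)
  obtain ⟨M1, h1⟩ := hc1.continuous.bounded_above_of_compact_support (hs.fderiv ℝ)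
  obtain ⟨M2, h2⟩ := (hc1.continuous_fderiv (by norm_num)).bounded_above_of_compact_support
    ((hs.fderiv ℝ).fderiv ℝ)
  have p0 := (norm_nonneg _).trans (h0 0)
  have p1 := (norm_nonneg _).trans (h1 0)
  have p2 := (norm_nonneg _).trans (h2 0)
  refine ⟨M0 + M1 + M2, by linarith, fun x => (h0 x).trans (by linarith), fun x h => ?_,
    fun x z => ?_, fun z h => ?_, fun z h k => ?_⟩
  · exact ((fderiv ℝ φ x).le_opNorm h).trans
      (mul_le_mul_of_nonneg_right ((h1 x).trans (by linarith)) (norm_nonneg _))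
  · have := convex_univ.norm_image_sub_le_of_norm_fderiv_le (𝕜 := ℝ) (f := φ) (C := M1)
      (fun x _ => (hφ.differentiable (by norm_num)) x) (fun x _ => h1 x) (mem_univ z) (mem_univ x)
    exact this.trans (mul_le_mul_of_nonneg_right (by linarith) (norm_nonneg _))
  · have := abs_taylor_le_of_second (L := 0) hφ (z := z) (δ := ‖h‖) p2
      (fun x _ => by rw [sub_zero]; exact h2 x) (k := h) le_rfl
    simp only [zero_apply, mul_zero, sub_zero] at this
    exact this.trans (mul_le_mul_of_nonneg_right (by linarith) (by positivity))
  · refine ((fderiv ℝ (fderiv ℝ φ) z).le_opNorm₂ h k).trans ?_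
    have := h2 z
    gcongr
    linarith

/-- Compact support makes the second derivative uniformly continuous, so δ does not depend on the
base point. -/
theorem exists_taylor_second {φ : V → ℝ} (hφ : ContDiff ℝ 2 φ) (hs : HasCompactSupport φ)
    {ε : ℝ} (hε : 0 < ε) : ∃ δ > 0, ∀ z h : V, ‖h‖ ≤ δ →
      |φ (z + h) - φ z - fderiv ℝ φ z h - 1 / 2 * fderiv ℝ (fderiv ℝ φ) z h h| ≤ ε * ‖h‖ ^ 2 := by
  have hc1 : ContDiff ℝ 1 (fderiv ℝ φ) := hφ.fderiv_right (m := 1) (by norm_num)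
  have hu : UniformContinuous (fderiv ℝ (fderiv ℝ φ)) :=
    ((hs.fderiv ℝ).fderiv ℝ).uniformContinuous_of_continuous
      (hc1.continuous_fderiv (by norm_num))
  obtain ⟨δ, hδ, h⟩ := @Metric.uniformContinuous_iff V (V →L[ℝ] V →L[ℝ] ℝ) _ _ _ |>.1 hu ε hε
  refine ⟨δ / 2, by positivity, fun z k hk => ?_⟩
  refine abs_taylor_le_of_second hφ hε.le (δ := δ / 2) (fun x hx => ?_) hk
  rw [← dist_eq_norm] at hx
  have := (h (a := x) (b := z) (by linarith)).le
  exact (le_of_eq (dist_eq_norm (fderiv ℝ (fderiv ℝ φ) x) (fderiv ℝ (fderiv ℝ φ) z)).symm).trans this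

end Taylor

/-! ### Integral representation of the scheme -/

section Representation

/-- `Y` is the primitive on `[0,1]` of the path `y`, whose coordinates are integrable on `ℝ` and
cube integrable on `(0,1]`. -/
structure IsPrimitive {d : ℕ} (Y y : ℝ → Fin d → ℝ) : Prop where
  integrable : ∀ l, Integrable fun s => y s l
  cubic : ∀ l, L3 fun s => y s l
  eq : ∀ t ∈ Icc (0 : ℝ) 1, ∀ l, Y t l = ∫ s in (0 : ℝ)..t, y s l

variable {q d : ℕ} {f : (Fin q → ℝ) → Matrix (Fin q) (Fin d) ℝ} {x₀ : Fin q → ℝ}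
  {Y y : ℝ → Fin d → ℝ}

theorem IsPrimitive.sub_eq (h : IsPrimitive Y y) {a t : ℝ} (ha : a ∈ Icc (0 : ℝ) 1)
    (ht : t ∈ Icc (0 : ℝ) 1) (l : Fin d) : Y t l - Y a l = ∫ s in a..t, y s l := by
  rw [h.eq t ht, h.eq a ha, intervalIntegral.integral_interval_sub_left
    (h.integrable l).intervalIntegrable (h.integrable l).intervalIntegrable]

theorem IsPrimitive.continuousOn (h : IsPrimitive Y y) (l : Fin d) :
    ContinuousOn (fun s => Y s l) (Icc 0 1) :=
  (continuous_primitive (h.integrable l) 0).continuousOn.congr fun t ht => h.eq t ht l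

theorem IsPrimitive.stieltjes_eq (h : IsPrimitive Y y) {g : ℝ → ℝ}
    (hg : ContinuousOn g (Icc 0 1)) (j : Fin d) {a t : ℝ} (ha : 0 ≤ a) (hat : a ≤ t)
    (ht : t ≤ 1) : stieltjes g (fun s => Y s j) a t = ∫ s in a..t, g s * y s j :=
  stieltjes_eq_intervalIntegral (h.integrable j).intervalIntegrable (fun t ht => h.eq t ht j)
    hg ha hat ht

theorem step_eq (h : IsPrimitive Y y) (f : (Fin q → ℝ) → Matrix (Fin q) (Fin d) ℝ)
    (x : Fin q → ℝ) {a t : ℝ} (ha : 0 ≤ a) (hat : a ≤ t) (ht : t ≤ 1) (i : Fin q) :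
    step f Y x a t i = x i + ∑ j, f x i j * (∫ s in a..t, y s j) +
      ∑ l, ∑ j, ((f x)ᵀ * Df f i x) l j *
        ∫ r in a..t, (∫ p in a..r, y p l) * y r j := by
  have ha' : a ∈ Icc (0 : ℝ) 1 := ⟨ha, hat.trans ht⟩
  have ht' : t ∈ Icc (0 : ℝ) 1 := ⟨ha.trans hat, ht⟩
  rw [step]
  congr 1
  · congr 1
    exact Finset.sum_congr rfl fun j _ => by rw [h.sub_eq ha' ht']
  · refine Finset.sum_congr rfl fun l _ => Finset.sum_congr rfl fun j _ => ?_
    have hc : ContinuousOn (fun s => Y s l - Y a l) (Icc 0 1) :=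
      (h.continuousOn l).sub continuousOn_const
    rw [h.stieltjes_eq hc j ha hat ht]
    congr 1
    refine integral_congr_Ioc hat fun r hr => ?_
    rw [h.sub_eq ha' ⟨ha.trans hr.1.le, hr.2.trans ht⟩]

/-- Value of the scheme at the last grid point before `s`. -/
def base (f : (Fin q → ℝ) → Matrix (Fin q) (Fin d) ℝ) (x₀ : Fin q → ℝ) (Y : ℝ → Fin d → ℝ)
    (n : ℕ) (s : ℝ) : Fin q → ℝ := grid f x₀ Y n (cell n s)

/-- Density of the scheme with respect to `dY`. -/
def rate (f : (Fin q → ℝ) → Matrix (Fin q) (Fin d) ℝ) (x₀ : Fin q → ℝ) (Y y : ℝ → Fin d → ℝ)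
    (n : ℕ) (i : Fin q) (j : Fin d) (s : ℝ) : ℝ :=
  f (base f x₀ Y n s) i j +
    ∑ l, ((f (base f x₀ Y n s))ᵀ * Df f i (base f x₀ Y n s)) l j * W n (fun r => y r l) s

theorem lo_mem {n : ℕ} (hn : 0 < n) {t : ℝ} (ht : t ∈ Icc (0 : ℝ) 1) :
    lo n t ∈ Icc (0 : ℝ) 1 ∧ lo n t ≤ t := by
  rcases ht.1.eq_or_lt with h0 | h0
  · rw [← h0, lo_zero]; simp
  · obtain ⟨h1, -, -⟩ := lo_bounds hn h0 ht.2
    exact ⟨⟨lo_nonneg n t, h1.le.trans ht.2⟩, h1.le⟩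

theorem scheme_eq_step (f : (Fin q → ℝ) → Matrix (Fin q) (Fin d) ℝ) (x₀ : Fin q → ℝ)
    (Y : ℝ → Fin d → ℝ) (n : ℕ) (t : ℝ) :
    scheme f x₀ Y n t = step f Y (base f x₀ Y n t) (lo n t) t := rfl

theorem scheme_eq (h : IsPrimitive Y y) (f : (Fin q → ℝ) → Matrix (Fin q) (Fin d) ℝ)
    (x₀ : Fin q → ℝ) {n : ℕ} (hn : 0 < n) {t : ℝ} (ht : t ∈ Icc (0 : ℝ) 1) (i : Fin q) :
    scheme f x₀ Y n t i = base f x₀ Y n t i +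
      ∑ j, f (base f x₀ Y n t) i j * W n (fun r => y r j) t +
      ∑ l, ∑ j, ((f (base f x₀ Y n t))ᵀ * Df f i (base f x₀ Y n t)) l j *
        E n (fun r => y r l) (fun r => y r j) t := by
  obtain ⟨h1, h2⟩ := lo_mem hn ht
  rw [scheme_eq_step, step_eq h f _ h1.1 h2 ht.2]
  rfl

theorem intervalIntegrable_cell_mul {n : ℕ} (hn : 0 < n) (g : ℕ → ℝ) {w : ℝ → ℝ}
    (hw : IntervalIntegrable w volume 0 1) :
    IntervalIntegrable (fun s => g (cell n s) * w s) volume 0 1 := by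
  have hw' := (intervalIntegrable_iff_integrableOn_Ioc_of_le zero_le_one).1 hw
  refine intervalIntegrable_of_bound' (G := fun s => (∑ k ∈ Finset.range n, |g k|) * |w s|)
    ((measurable_of_cell n g).aestronglyMeasurable.mul hw'.aestronglyMeasurable)
    (hw.abs.const_mul _) fun s hs => ?_
  rw [abs_mul]
  exact mul_le_mul_of_nonneg_right (Finset.single_le_sum (f := fun k => |g k|)
    (fun k _ => abs_nonneg _) (Finset.mem_range.2 (cell_lt hn hs))) (abs_nonneg _)

theorem abs_W_le_integral {n : ℕ} (hn : 0 < n) {u : ℝ → ℝ} (hu : Integrable u) {s : ℝ}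
    (hs : s ∈ Ioc (0 : ℝ) 1) : |W n u s| ≤ ∫ r in (0 : ℝ)..1, |u r| := by
  obtain ⟨h1, h2, h3⟩ := lo_bounds hn hs.1 hs.2
  exact (abs_primitive_le hu h1.le le_rfl).trans (integral_le_of_subinterval
    hu.intervalIntegrable.abs (fun _ => abs_nonneg _) (lo_nonneg n s) h1.le hs.2)

theorem intervalIntegrable_W_mul {n : ℕ} (hn : 0 < n) {u v : ℝ → ℝ} (hu : Integrable u)
    (hv : Integrable v) : IntervalIntegrable (fun s => W n u s * v s) volume 0 1 := by
  refine intervalIntegrable_of_bound' (G := fun s => (∫ r in (0 : ℝ)..1, |u r|) * |v s|)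
    ((measurable_W n hu).aestronglyMeasurable.mul hv.aestronglyMeasurable.restrict)
    (hv.intervalIntegrable.abs.const_mul _) fun s hs => ?_
  rw [abs_mul]
  exact mul_le_mul_of_nonneg_right (abs_W_le_integral hn hu hs) (abs_nonneg _)

theorem intervalIntegrable_rate_mul (h : IsPrimitive Y y)
    (f : (Fin q → ℝ) → Matrix (Fin q) (Fin d) ℝ) (x₀ : Fin q → ℝ) {n : ℕ} (hn : 0 < n)
    (i : Fin q) (j : Fin d) :
    IntervalIntegrable (fun s => rate f x₀ Y y n i j s * y s j) volume 0 1 := by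
  have e : (fun s => rate f x₀ Y y n i j s * y s j) = fun s =>
      f (base f x₀ Y n s) i j * y s j +
        ∑ l, ((f (base f x₀ Y n s))ᵀ * Df f i (base f x₀ Y n s)) l j *
          (W n (fun r => y r l) s * y s j) := by
    ext s
    rw [rate, add_mul, Finset.sum_mul]
    simp only [mul_assoc]
  rw [e]
  have h1 := intervalIntegrable_cell_mul hn (fun k => f (grid f x₀ Y n k) i j)
    (h.integrable j).intervalIntegrable
  have h2 : ∀ l ∈ Finset.univ, IntervalIntegrable (fun s =>
      ((f (base f x₀ Y n s))ᵀ * Df f i (base f x₀ Y n s)) l j *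
        (W n (fun r => y r l) s * y s j)) volume 0 1 := fun l _ =>
    intervalIntegrable_cell_mul hn
      (fun k => ((f (grid f x₀ Y n k))ᵀ * Df f i (grid f x₀ Y n k)) l j)
      (intervalIntegrable_W_mul hn (h.integrable l) (h.integrable j))
  have h3 := IntervalIntegrable.sum Finset.univ h2
  have h4 := h1.add h3
  refine h4.congr fun s _ => ?_
  simp [base]

theorem intervalIntegrable_sum_rate (h : IsPrimitive Y y)
    (f : (Fin q → ℝ) → Matrix (Fin q) (Fin d) ℝ) (x₀ : Fin q → ℝ) {n : ℕ} (hn : 0 < n)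
    (i : Fin q) :
    IntervalIntegrable (fun s => ∑ j, rate f x₀ Y y n i j s * y s j) volume 0 1 := by
  have := IntervalIntegrable.sum Finset.univ
    fun j (_ : j ∈ Finset.univ) => intervalIntegrable_rate_mul h f x₀ hn i j
  exact this.congr fun s _ => by simp

/-- On one cell the coefficients are frozen and the rate is affine in the increments; integrated
against dY it reproduces the step, the increments giving the iterated integrals. -/
theorem integral_rate_cell (h : IsPrimitive Y y) (f : (Fin q → ℝ) → Matrix (Fin q) (Fin d) ℝ)
    (x₀ : Fin q → ℝ) {n k : ℕ} (hn : 0 < n) (hk : k < n) {t : ℝ} (h1 : (k : ℝ) / n ≤ t)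
    (h2 : t ≤ ((k : ℝ) + 1) / n) (i : Fin q) :
    step f Y (grid f x₀ Y n k) ((k : ℝ) / n) t i = grid f x₀ Y n k i +
      ∫ s in ((k : ℝ) / n)..t, ∑ j, rate f x₀ Y y n i j s * y s j := by
  have ht1 : t ≤ 1 := (cell_Ioc_subset hk ⟨h1, h2⟩).2
  have ha : 0 ≤ (k : ℝ) / n := by positivity
  rw [step_eq h f _ ha h1 ht1, add_assoc]
  congr 1
  set z := grid f x₀ Y n k
  have e : ∫ s in ((k : ℝ) / n)..t, ∑ j, rate f x₀ Y y n i j s * y s j =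
      ∫ s in ((k : ℝ) / n)..t, ((∑ j, f z i j * y s j) + ∑ l, ∑ j, ((f z)ᵀ * Df f i z) l j *
        ((∫ p in ((k : ℝ) / n)..s, y p l) * y s j)) := by
    refine integral_congr_Ioc h1 fun s hs => ?_
    have hb : base f x₀ Y n s = z := by rw [base, cell_eq hn hs.1 (hs.2.trans h2)]
    have hl : lo n s = (k : ℝ) / n := lo_eq hn hs.1 (hs.2.trans h2)
    rw [Finset.sum_comm, ← Finset.sum_add_distrib]
    refine Finset.sum_congr rfl fun j _ => ?_
    rw [rate, hb, add_mul, Finset.sum_mul]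
    simp only [W, hl, mul_assoc]
  have i1 : ∀ j ∈ Finset.univ, IntervalIntegrable (fun s => f z i j * y s j) volume
      ((k : ℝ) / n) t := fun j _ => (h.integrable j).intervalIntegrable.const_mul _
  have i2 : ∀ l j, IntervalIntegrable (fun s => ((f z)ᵀ * Df f i z) l j *
      ((∫ p in ((k : ℝ) / n)..s, y p l) * y s j)) volume ((k : ℝ) / n) t := fun l j =>
    (intervalIntegrable_primitive_mul (h.integrable l) (h.integrable j) _ _ _).const_mul _
  have i2' : ∀ l ∈ Finset.univ, IntervalIntegrable (fun s => ∑ j, ((f z)ᵀ * Df f i z) l j *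
      ((∫ p in ((k : ℝ) / n)..s, y p l) * y s j)) volume ((k : ℝ) / n) t := fun l _ =>
    (IntervalIntegrable.sum Finset.univ fun j (_ : j ∈ Finset.univ) => i2 l j).congr
      fun s _ => by simp
  have i1s : IntervalIntegrable (fun s => ∑ j, f z i j * y s j) volume ((k : ℝ) / n) t :=
    (IntervalIntegrable.sum Finset.univ i1).congr fun s _ => by simp
  have i2s : IntervalIntegrable (fun s => ∑ l, ∑ j, ((f z)ᵀ * Df f i z) l j *
      ((∫ p in ((k : ℝ) / n)..s, y p l) * y s j)) volume ((k : ℝ) / n) t :=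
    (IntervalIntegrable.sum Finset.univ i2').congr fun s _ => by simp
  rw [e, intervalIntegral.integral_add i1s i2s, intervalIntegral.integral_finsetSum i1,
    intervalIntegral.integral_finsetSum i2']
  congr 1
  · exact Finset.sum_congr rfl fun j _ => by rw [intervalIntegral.integral_const_mul]
  · refine Finset.sum_congr rfl fun l _ => ?_
    rw [intervalIntegral.integral_finsetSum fun j _ => i2 l j]
    exact Finset.sum_congr rfl fun j _ => by rw [intervalIntegral.integral_const_mul]

theorem grid_eq_integral (h : IsPrimitive Y y) (f : (Fin q → ℝ) → Matrix (Fin q) (Fin d) ℝ)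
    (x₀ : Fin q → ℝ) {n : ℕ} (hn : 0 < n) (i : Fin q) {k : ℕ} (hk : k ≤ n) :
    grid f x₀ Y n k i = x₀ i + ∫ s in (0 : ℝ)..((k : ℝ) / n),
      ∑ j, rate f x₀ Y y n i j s * y s j := by
  have hn' : (0 : ℝ) < n := by exact_mod_cast hn
  rw [integral_eq_sum_cells hn (intervalIntegrable_sum_rate h f x₀ hn i) hk]
  induction k with
  | zero => simp [grid]
  | succ k ih =>
    rw [grid, integral_rate_cell h f x₀ hn hk cell_le le_rfl, ih (by omega),
      Finset.sum_range_succ, add_assoc]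

/-- Integral representation of the scheme for an absolutely continuous driving path. -/
theorem scheme_eq_integral (h : IsPrimitive Y y) (f : (Fin q → ℝ) → Matrix (Fin q) (Fin d) ℝ)
    (x₀ : Fin q → ℝ) {n : ℕ} (hn : 0 < n) {t : ℝ} (ht : t ∈ Icc (0 : ℝ) 1) (i : Fin q) :
    scheme f x₀ Y n t i = x₀ i + ∫ s in (0 : ℝ)..t, ∑ j, rate f x₀ Y y n i j s * y s j := by
  rcases ht.1.eq_or_lt with h0 | h0
  · rw [scheme_eq_step, ← h0, base, cell_zero, lo_zero, step_eq h f _ le_rfl le_rfl zero_le_one]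
    simp [grid]
  · obtain ⟨k, hk, e1, e2, e3⟩ := exists_cell hn h0 ht.2
    have hi := intervalIntegrable_sum_rate h f x₀ hn i
    have hm : (k : ℝ) / n ∈ Icc (0 : ℝ) 1 := ⟨by positivity, e1.le.trans ht.2⟩
    rw [scheme_eq_step, base, e3, lo_eq hn e1 e2, integral_rate_cell h f x₀ hn hk e1.le e2,
      grid_eq_integral h f x₀ hn i hk.le, add_assoc,
      intervalIntegral.integral_add_adjacent_intervals
        (intervalIntegrable_sub hi ⟨le_rfl, zero_le_one⟩ hm) (intervalIntegrable_sub hi hm ht)]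

end Representation

/-! ### Linear Volterra equations -/

section Volterra

variable {q : ℕ} {b : Fin q → ℝ → Fin q → ℝ}

theorem intervalIntegrable_finset_sum {ι : Type*} {s : Finset ι} {g : ι → ℝ → ℝ} {a c : ℝ}
    (h : ∀ i ∈ s, IntervalIntegrable (g i) volume a c) :
    IntervalIntegrable (fun t => ∑ i ∈ s, g i t) volume a c :=
  (IntervalIntegrable.sum s h).congr fun t _ => by simp

theorem intervalIntegrable_dotProduct (hb : ∀ i k, IntervalIntegrable (fun s => b i s k) volume 0 1)
    {V : ℝ → Fin q → ℝ} (hV : ContinuousOn V (Icc 0 1)) (i : Fin q) :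
    IntervalIntegrable (fun s => V s ⬝ᵥ b i s) volume 0 1 := by
  refine intervalIntegrable_finset_sum fun k _ => (hb i k).continuousOn_mul ?_
  rw [uIcc_of_le zero_le_one]
  exact (continuous_apply k).comp_continuousOn hV

/-- Kernel that dominates the linear map with matrix `b`. -/
def kernel (b : Fin q → ℝ → Fin q → ℝ) (s : ℝ) : ℝ := ∑ i, ∑ k, |b i s k|

theorem kernel_nonneg (b : Fin q → ℝ → Fin q → ℝ) (s : ℝ) : 0 ≤ kernel b s :=
  Finset.sum_nonneg fun _ _ => Finset.sum_nonneg fun _ _ => abs_nonneg _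

theorem intervalIntegrable_kernel
    (hb : ∀ i k, IntervalIntegrable (fun s => b i s k) volume 0 1) :
    IntervalIntegrable (kernel b) volume 0 1 :=
  intervalIntegrable_finset_sum fun i _ => intervalIntegrable_finset_sum fun k _ => (hb i k).abs

theorem abs_dotProduct_le_kernel (v : Fin q → ℝ) (i : Fin q) (s : ℝ) :
    |v ⬝ᵥ b i s| ≤ kernel b s * ‖v‖ := by
  calc |v ⬝ᵥ b i s| ≤ ∑ k, |v k * b i s k| := Finset.abs_sum_le_sum_abs _ _
    _ ≤ ∑ k, |b i s k| * ‖v‖ := Finset.sum_le_sum fun k _ => by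
        rw [abs_mul, mul_comm]
        exact mul_le_mul_of_nonneg_left (norm_le_pi_norm v k) (abs_nonneg _)
    _ = (∑ k, |b i s k|) * ‖v‖ := by rw [Finset.sum_mul]
    _ ≤ kernel b s * ‖v‖ := mul_le_mul_of_nonneg_right
        (Finset.single_le_sum (f := fun i => ∑ k, |b i s k|)
          (fun _ _ => Finset.sum_nonneg fun _ _ => abs_nonneg _) (Finset.mem_univ i))
        (norm_nonneg _)

theorem intervalIntegrable_kernel_mul
    (hb : ∀ i k, IntervalIntegrable (fun s => b i s k) volume 0 1)
    {V : ℝ → Fin q → ℝ} (hV : ContinuousOn V (Icc 0 1)) :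
    IntervalIntegrable (fun s => kernel b s * ‖V s‖) volume 0 1 := by
  refine (intervalIntegrable_kernel hb).mul_continuousOn ?_
  rw [uIcc_of_le zero_le_one]
  exact hV.norm

/-- The source Z cancels in the difference, which solves the homogeneous equation up to 2ε;
Grönwall's inequality applies. No regularity of Z is involved. -/
theorem norm_sub_le_of_approx_volterra
    (hb : ∀ i k, IntervalIntegrable (fun s => b i s k) volume 0 1)
    {Z V V' : ℝ → Fin q → ℝ} (hV : ContinuousOn V (Icc 0 1)) (hV' : ContinuousOn V' (Icc 0 1))
    {ε : ℝ} (hε : 0 ≤ ε)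
    (h : ∀ t ∈ Icc (0 : ℝ) 1, ∀ i, |V t i - (∫ s in (0 : ℝ)..t, V s ⬝ᵥ b i s) + Z t i| ≤ ε)
    (h' : ∀ t ∈ Icc (0 : ℝ) 1, ∀ i, |V' t i - (∫ s in (0 : ℝ)..t, V' s ⬝ᵥ b i s) + Z t i| ≤ ε) :
    ∀ t ∈ Icc (0 : ℝ) 1,
      ‖V t - V' t‖ ≤ 2 * (2 * ε) * Real.exp (2 * ∫ s in (0 : ℝ)..1, kernel b s) := by
  have hs : ContinuousOn (fun t => V t - V' t) (Icc 0 1) := hV.sub hV'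
  refine gronwall_of_integrable (by positivity) (intervalIntegrable_kernel hb) (kernel_nonneg b)
    hs.norm fun t ht => ?_
  have h0 : (0 : ℝ) ∈ Icc (0 : ℝ) 1 := ⟨le_rfl, zero_le_one⟩
  have hpos : 0 ≤ ∫ s in (0 : ℝ)..t, kernel b s * ‖V s - V' s‖ :=
    intervalIntegral.integral_nonneg ht.1 fun s _ => mul_nonneg (kernel_nonneg b s) (norm_nonneg _)
  refine (pi_norm_le_iff_of_nonneg (by positivity)).2 fun i => ?_
  have i1 := intervalIntegrable_sub (intervalIntegrable_dotProduct hb hV i) h0 ht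
  have i2 := intervalIntegrable_sub (intervalIntegrable_dotProduct hb hV' i) h0 ht
  have e : (∫ s in (0 : ℝ)..t, V s ⬝ᵥ b i s) - (∫ s in (0 : ℝ)..t, V' s ⬝ᵥ b i s) =
      ∫ s in (0 : ℝ)..t, (V s - V' s) ⬝ᵥ b i s := by
    rw [← intervalIntegral.integral_sub i1 i2]
    simp only [sub_dotProduct]
  have hb' := abs_integral_le_of_le (f := fun s => (V s - V' s) ⬝ᵥ b i s) ht.1
    (intervalIntegrable_sub (intervalIntegrable_kernel_mul hb hs) h0 ht)
    fun s _ => abs_dotProduct_le_kernel (V s - V' s) i s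
  have a1 := abs_le.1 (h t ht i)
  have a2 := abs_le.1 (h' t ht i)
  have a3 := abs_le.1 hb'
  rw [Real.norm_eq_abs, Pi.sub_apply, abs_le]
  constructor <;> linarith [a1.1, a1.2, a2.1, a2.2, a3.1, a3.2]

/-- A linear Volterra equation has at most one continuous solution. -/
theorem volterra_unique (hb : ∀ i k, IntervalIntegrable (fun s => b i s k) volume 0 1)
    {Z V V' : ℝ → Fin q → ℝ} (hV : ContinuousOn V (Icc 0 1)) (hV' : ContinuousOn V' (Icc 0 1))
    (h : ∀ t ∈ Icc (0 : ℝ) 1, ∀ i, V t i = (∫ s in (0 : ℝ)..t, V s ⬝ᵥ b i s) - Z t i)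
    (h' : ∀ t ∈ Icc (0 : ℝ) 1, ∀ i, V' t i = (∫ s in (0 : ℝ)..t, V' s ⬝ᵥ b i s) - Z t i) :
    EqOn V V' (Icc 0 1) := by
  intro t ht
  have := norm_sub_le_of_approx_volterra hb (Z := Z) hV hV' le_rfl
    (fun t ht i => by rw [h t ht i]; simp) (fun t ht i => by rw [h' t ht i]; simp) t ht
  simp only [mul_zero, zero_mul] at this
  exact sub_eq_zero.1 (norm_le_zero_iff.1 this)

/-- Approximate solutions of a linear Volterra equation converge uniformly to a solution. -/
theorem exists_volterra_limit (hb : ∀ i k, IntervalIntegrable (fun s => b i s k) volume 0 1)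
    {Z : ℝ → Fin q → ℝ} {V : ℕ → ℝ → Fin q → ℝ} (hV : ∀ᶠ n in atTop, ContinuousOn (V n) (Icc 0 1))
    (h : ∀ ε > 0, ∀ᶠ n in atTop, ∀ t ∈ Icc (0 : ℝ) 1, ∀ i,
      |V n t i - (∫ s in (0 : ℝ)..t, V n s ⬝ᵥ b i s) + Z t i| ≤ ε) :
    ∃ U : ℝ → Fin q → ℝ, TendstoUniformlyOn V U atTop (Icc 0 1) ∧ ContinuousOn U (Icc 0 1) ∧
      ∀ t ∈ Icc (0 : ℝ) 1, ∀ i, U t i = (∫ s in (0 : ℝ)..t, U s ⬝ᵥ b i s) - Z t i := by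
  set L := Real.exp (2 * ∫ s in (0 : ℝ)..1, kernel b s) with hL
  have hLp : 0 < L := Real.exp_pos _
  have hcau : UniformCauchySeqOn V atTop (Icc 0 1) := by
    rw [Metric.uniformCauchySeqOn_iff]
    intro ε hε
    -- The stability bound is 4L times the residual, hence ε/2.
    obtain ⟨N, hN⟩ := eventually_atTop.1 ((h (ε / (8 * L)) (by positivity)).and hV)
    refine ⟨N, fun m hm n hn t ht => ?_⟩
    have := norm_sub_le_of_approx_volterra hb (hN m hm).2 (hN n hn).2 (by positivity) (hN m hm).1
      (hN n hn).1 t ht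
    rw [dist_eq_norm]
    refine this.trans_lt ?_
    have e : 2 * (2 * (ε / (8 * L))) * L = ε / 2 := by field_simp; norm_num
    rw [← hL, e]
    linarith
  have hpt : ∀ t, ∃ u : Fin q → ℝ, t ∈ Icc (0 : ℝ) 1 → Tendsto (fun n => V n t) atTop (𝓝 u) := by
    intro t
    by_cases ht : t ∈ Icc (0 : ℝ) 1
    · obtain ⟨u, hu⟩ := cauchySeq_tendsto_of_complete (hcau.cauchySeq ht)
      exact ⟨u, fun _ => hu⟩
    -- Outside [0,1] the limit is arbitrary.
    · exact ⟨0, fun h => absurd h ht⟩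
  choose U hU using hpt
  have hunif := hcau.tendstoUniformlyOn_of_tendsto hU
  have hUc : ContinuousOn U (Icc 0 1) := hunif.continuousOn hV.frequently
  refine ⟨U, hunif, hUc, fun t ht i => ?_⟩
  have h0 : (0 : ℝ) ∈ Icc (0 : ℝ) 1 := ⟨le_rfl, zero_le_one⟩
  set K := ∫ s in (0 : ℝ)..1, kernel b s
  have hK : 0 ≤ K := intervalIntegral.integral_nonneg zero_le_one fun s _ => kernel_nonneg b s
  have hlim : |U t i - (∫ s in (0 : ℝ)..t, U s ⬝ᵥ b i s) + Z t i| ≤ 0 := by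
    refine le_of_forall_pos_le_add fun ε hε => ?_
    -- One η for the residual, one for the distance of V n to U at time t, and Kη for that distance
    -- under the integral.
    set η := ε / (2 + K) with hη
    have hηp : 0 < η := by positivity
    obtain ⟨n, ⟨h1, h2⟩, h3⟩ := ((h η hηp).and hV |>.and
      (Metric.tendstoUniformlyOn_iff.1 hunif η hηp)).exists
    have hs : ContinuousOn (fun t => U t - V n t) (Icc 0 1) := hUc.sub h2
    have i1 := intervalIntegrable_sub (intervalIntegrable_dotProduct hb hUc i) h0 ht
    have i2 := intervalIntegrable_sub (intervalIntegrable_dotProduct hb h2 i) h0 ht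
    have e : (∫ s in (0 : ℝ)..t, U s ⬝ᵥ b i s) - (∫ s in (0 : ℝ)..t, V n s ⬝ᵥ b i s) =
        ∫ s in (0 : ℝ)..t, (U s - V n s) ⬝ᵥ b i s := by
      rw [← intervalIntegral.integral_sub i1 i2]
      simp only [sub_dotProduct]
    have hb' := abs_integral_le_of_le (f := fun s => (U s - V n s) ⬝ᵥ b i s)
      (g := fun s => kernel b s * η) ht.1
      (intervalIntegrable_sub ((intervalIntegrable_kernel hb).mul_const η) h0 ht)
      fun s hs => (abs_dotProduct_le_kernel (U s - V n s) i s).trans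
        (mul_le_mul_of_nonneg_left (by
          rw [← dist_eq_norm]; exact (h3 s ⟨hs.1.le, hs.2.trans ht.2⟩).le) (kernel_nonneg b s))
    rw [intervalIntegral.integral_mul_const] at hb'
    have hK' : (∫ s in (0 : ℝ)..t, kernel b s) * η ≤ K * η :=
      mul_le_mul_of_nonneg_right (integral_le_of_subinterval (intervalIntegrable_kernel hb)
        (kernel_nonneg b) le_rfl ht.1 ht.2) hηp.le
    have d1 : |U t i - V n t i| ≤ η := by
      have := (norm_le_pi_norm (U t - V n t) i).trans
        ((dist_eq_norm (U t) (V n t)).symm.le.trans (h3 t ht).le)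
      exact this
    have e2 : ε = 2 * η + K * η := by rw [hη]; field_simp
    have a1 := abs_le.1 (h1 t ht i)
    have a2 := abs_le.1 d1
    have a3 := abs_le.1 hb'
    rw [abs_le]
    constructor <;> linarith [a1.1, a1.2, a2.1, a2.2, a3.1, a3.2]
  linarith [abs_nonpos_iff.1 hlim]

end Volterra

/-! ### Second order expansion of the defect of one step -/

section Expansion

variable {q d : ℕ} {f : (Fin q → ℝ) → Matrix (Fin q) (Fin d) ℝ}

theorem clm_eq_sum_single (T : (Fin q → ℝ) →L[ℝ] ℝ) (h : Fin q → ℝ) :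
    T h = ∑ k, h k * T (Pi.single k 1) := by
  conv_lhs => rw [← Finset.univ_sum_single h]
  rw [map_sum]
  refine Finset.sum_congr rfl fun k _ => ?_
  rw [← smul_eq_mul, ← map_smul, ← Pi.single_smul, smul_eq_mul, mul_one]

theorem fderiv_eq_sum (φ : (Fin q → ℝ) → ℝ) (z h : Fin q → ℝ) :
    fderiv ℝ φ z h = ∑ k, h k * partialD k φ z := clm_eq_sum_single _ h

theorem hess_apply {φ : (Fin q → ℝ) → ℝ} (hφ : ContDiff ℝ 2 φ) (z : Fin q → ℝ) (k l : Fin q) :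
    hess φ z k l = fderiv ℝ (fderiv ℝ φ) z (Pi.single l 1) (Pi.single k 1) := by
  have hd : Differentiable ℝ (fderiv ℝ φ) :=
    (hφ.fderiv_right (m := 1) (by norm_num)).differentiable (by norm_num)
  have h := (ContinuousLinearMap.apply ℝ ℝ (Pi.single k 1 : Fin q → ℝ)).hasFDerivAt.comp z
    (hd z).hasFDerivAt
  have e : partialD k φ = (ContinuousLinearMap.apply ℝ ℝ (Pi.single k 1 : Fin q → ℝ)) ∘ fderiv ℝ φ :=
    rfl
  rw [hess, Matrix.of_apply, partialD, e, h.fderiv]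
  rfl

theorem fderiv_fderiv_eq_sum {φ : (Fin q → ℝ) → ℝ} (hφ : ContDiff ℝ 2 φ) (z w : Fin q → ℝ) :
    fderiv ℝ (fderiv ℝ φ) z w w = ∑ k, ∑ l, w k * hess φ z k l * w l := by
  rw [clm_eq_sum_single (fderiv ℝ (fderiv ℝ φ) z w) w]
  refine Finset.sum_congr rfl fun k _ => ?_
  have := clm_eq_sum_single
    ((ContinuousLinearMap.apply ℝ ℝ (Pi.single k 1 : Fin q → ℝ)).comp (fderiv ℝ (fderiv ℝ φ) z)) w
  simp only [ContinuousLinearMap.comp_apply, ContinuousLinearMap.apply_apply] at this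
  rw [this, Finset.mul_sum]
  exact Finset.sum_congr rfl fun l _ => by rw [hess_apply hφ]; ring

/-- Coefficients of the second order term in the expansion of `f^{ij}` along the scheme. -/
def quad (f : (Fin q → ℝ) → Matrix (Fin q) (Fin d) ℝ) (i : Fin q) (j : Fin d) (x : Fin q → ℝ)
    (l m : Fin d) : ℝ :=
  (∑ k, partialD k (fun z => f z i j) x * ((f x)ᵀ * Df f k x) l m) +
    1 / 2 * (((f x)ᵀ * hess (fun z => f z i j) x * f x) l m +
      ((f x)ᵀ * hess (fun z => f z i j) x * f x) m l)

/-- Moves the symmetrisation of the Hessian part from the coefficient to F. For iterated integrals F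
l m + F m l is a product of increments. -/
theorem sum_quad_mul (i : Fin q) (j : Fin d) (x : Fin q → ℝ) (F : Fin d → Fin d → ℝ) :
    ∑ l, ∑ m, quad f i j x l m * F l m =
      (∑ k, (∑ l, ∑ m, ((f x)ᵀ * Df f k x) l m * F l m) * partialD k (fun z => f z i j) x) +
      1 / 2 * ∑ l, ∑ m, ((f x)ᵀ * hess (fun z => f z i j) x * f x) l m * (F l m + F m l) := by
  have e1 : ∑ k, (∑ l, ∑ m, ((f x)ᵀ * Df f k x) l m * F l m) * partialD k (fun z => f z i j) x =
      ∑ l, ∑ m, (∑ k, partialD k (fun z => f z i j) x * ((f x)ᵀ * Df f k x) l m) * F l m := by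
    simp only [Finset.sum_mul]
    rw [Finset.sum_comm]
    refine Finset.sum_congr rfl fun l _ => ?_
    rw [Finset.sum_comm]
    exact Finset.sum_congr rfl fun m _ => Finset.sum_congr rfl fun k _ => by ring
  set H := (f x)ᵀ * hess (fun z => f z i j) x * f x with hH
  have e2 : ∑ l, ∑ m, H l m * (F l m + F m l) = ∑ l, ∑ m, (H l m + H m l) * F l m := by
    simp only [mul_add, add_mul, Finset.sum_add_distrib]
    congr 1
    rw [Finset.sum_comm]
  rw [e1, e2, Finset.mul_sum, ← Finset.sum_add_distrib]
  refine Finset.sum_congr rfl fun l _ => ?_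
  rw [Finset.mul_sum, ← Finset.sum_add_distrib]
  refine Finset.sum_congr rfl fun m _ => ?_
  rw [quad, ← hH]
  ring

theorem dotProduct_mulVec_eq_sum {m : ℕ} (u : Fin m → ℝ) (A : Matrix (Fin m) (Fin m) ℝ) :
    u ⬝ᵥ (A *ᵥ u) = ∑ l, ∑ k, A l k * (u l * u k) := by
  simp only [dotProduct, Matrix.mulVec, Finset.mul_sum]
  exact Finset.sum_congr rfl fun l _ => Finset.sum_congr rfl fun k _ => by ring

/-- Explains the matrix G of the limit equation: on a symmetric argument u uᵀ the symmetrisation in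
`quad` has no effect. -/
theorem sum_quad_mul_mul (i : Fin q) (j : Fin d) (x : Fin q → ℝ) (u : Fin d → ℝ) :
    ∑ l, ∑ m, quad f i j x l m * (u l * u m) = u ⬝ᵥ ((G f i j x * f x) *ᵥ u) := by
  rw [sum_quad_mul, G, Matrix.add_mul, Matrix.add_mulVec, dotProduct_add, add_comm]
  congr 1
  · rw [dotProduct_mulVec_eq_sum, Finset.mul_sum]
    refine Finset.sum_congr rfl fun l _ => ?_
    rw [Finset.mul_sum]
    exact Finset.sum_congr rfl fun m _ => by ring
  · rw [dotProduct_mulVec_eq_sum]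
    simp only [Matrix.sum_mul, Matrix.smul_mul, Matrix.sum_apply, Matrix.smul_apply, smul_eq_mul,
      Finset.sum_mul]
    refine Eq.trans ?_ ((Finset.sum_congr rfl fun l _ => Finset.sum_comm).trans Finset.sum_comm).symm
    refine Finset.sum_congr rfl fun k _ => ?_
    rw [Finset.sum_comm]
    refine Finset.sum_congr rfl fun l _ => Finset.sum_congr rfl fun m _ => ?_
    -- G contains the transpose of the matrix in the scheme; the two have the same quadratic form.
    have : ((Df f k x)ᵀ * f x) l m = ((f x)ᵀ * Df f k x) m l := by
      rw [← Matrix.transpose_apply ((f x)ᵀ * Df f k x), Matrix.transpose_mul,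
        Matrix.transpose_transpose]
    rw [this]
    ring

/-- Here w stands for increments, F for iterated integrals, and `hF` for integration by parts. The
sum consists of the derivative along the second order displacement and the Hessian term of the first
order one. -/
theorem sum_quad_eq_taylor {i : Fin q} {j : Fin d} (hφ : ContDiff ℝ 2 fun x => f x i j)
    (x : Fin q → ℝ) {w : Fin d → ℝ} {F : Fin d → Fin d → ℝ} (hF : ∀ l m, w l * w m = F l m + F m l) :
    ∑ l, ∑ m, quad f i j x l m * F l m =
      fderiv ℝ (fun x => f x i j) x (fun k => ∑ l, ∑ m, ((f x)ᵀ * Df f k x) l m * F l m) +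
      1 / 2 * fderiv ℝ (fderiv ℝ fun x => f x i j) x (f x *ᵥ w) (f x *ᵥ w) := by
  rw [sum_quad_mul, fderiv_eq_sum, fderiv_fderiv_eq_sum hφ]
  congr 2
  simp only [← hF]
  have e : ∀ (H : Matrix (Fin q) (Fin q) ℝ) (v : Fin q → ℝ),
      ∑ k, ∑ l, v k * H k l * v l = v ⬝ᵥ (H *ᵥ v) := fun H v => by
    rw [dotProduct_mulVec_eq_sum]
    exact Finset.sum_congr rfl fun l _ => Finset.sum_congr rfl fun k _ => by ring
  rw [e, ← dotProduct_mulVec_eq_sum, Matrix.mul_assoc, ← Matrix.mulVec_mulVec,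
    ← Matrix.mulVec_mulVec, Matrix.dotProduct_mulVec, Matrix.vecMul_transpose]

variable {M : ℝ}

theorem abs_partialD_le (hM : ∀ i j, TameBound (fun x => f x i j) M) (i k : Fin q) (j : Fin d)
    (x : Fin q → ℝ) : |partialD k (fun z => f z i j) x| ≤ M := by
  have := (hM i j).deriv x (Pi.single k 1)
  rw [Pi.norm_single, norm_one, mul_one] at this
  exact this

theorem abs_transpose_mul_Df_le (hM : ∀ i j, TameBound (fun x => f x i j) M) (i : Fin q)
    (x : Fin q → ℝ) (l m : Fin d) : |((f x)ᵀ * Df f i x) l m| ≤ q * M ^ 2 := by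
  rw [Matrix.mul_apply]
  refine (Finset.abs_sum_le_sum_abs _ _).trans ?_
  calc ∑ k, |(f x)ᵀ l k * Df f i x k m| ≤ ∑ _k : Fin q, M ^ 2 := Finset.sum_le_sum fun k _ => by
        rw [abs_mul, sq]
        exact mul_le_mul ((hM k l).val x) (abs_partialD_le hM i k m x) (abs_nonneg _)
          (hM k l).nonneg
    _ = _ := by simp

theorem norm_mulVec_le (hM0 : 0 ≤ M) (hM : ∀ i j, TameBound (fun x => f x i j) M)
    (x : Fin q → ℝ) {w : Fin d → ℝ}
    {v : ℝ} (hw : ∑ l, |w l| ≤ v) : ‖f x *ᵥ w‖ ≤ M * v := by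
  have hv : 0 ≤ v := (Finset.sum_nonneg fun _ _ => abs_nonneg _).trans hw
  refine (pi_norm_le_iff_of_nonneg (by positivity)).2 fun i => ?_
  calc |∑ j, f x i j * w j| ≤ ∑ j, |f x i j * w j| := Finset.abs_sum_le_sum_abs _ _
    _ ≤ ∑ j, M * |w j| := Finset.sum_le_sum fun j _ => by
        rw [abs_mul]; exact mul_le_mul_of_nonneg_right ((hM i j).val x) (abs_nonneg _)
    _ = M * ∑ j, |w j| := by rw [Finset.mul_sum]
    _ ≤ M * v := by gcongr

theorem norm_second_le (hM : ∀ i j, TameBound (fun x => f x i j) M)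
    (x : Fin q → ℝ) {F : Fin d → Fin d → ℝ} {v : ℝ} (hF : ∑ l, ∑ m, |F l m| ≤ v ^ 2) :
    ‖fun k => ∑ l, ∑ m, ((f x)ᵀ * Df f k x) l m * F l m‖ ≤ q * M ^ 2 * v ^ 2 := by
  refine (pi_norm_le_iff_of_nonneg (by positivity)).2 fun k => ?_
  rw [Real.norm_eq_abs]
  calc |∑ l, ∑ m, ((f x)ᵀ * Df f k x) l m * F l m|
      ≤ ∑ l, ∑ m, |((f x)ᵀ * Df f k x) l m * F l m| :=
        (Finset.abs_sum_le_sum_abs _ _).trans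
          (Finset.sum_le_sum fun l _ => Finset.abs_sum_le_sum_abs _ _)
    _ ≤ ∑ l, ∑ m, (q * M ^ 2) * |F l m| := Finset.sum_le_sum fun l _ =>
        Finset.sum_le_sum fun m _ => by
          rw [abs_mul]
          exact mul_le_mul_of_nonneg_right (abs_transpose_mul_Df_le hM k x l m) (abs_nonneg _)
    _ = q * M ^ 2 * ∑ l, ∑ m, |F l m| := by simp only [Finset.mul_sum]
    _ ≤ _ := by gcongr

theorem sum_transpose_mul_Df_mul (i : Fin q) (j : Fin d) (x : Fin q → ℝ) (w : Fin d → ℝ) :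
    ∑ l, ((f x)ᵀ * Df f i x) l j * w l = fderiv ℝ (fun x => f x i j) x (f x *ᵥ w) := by
  rw [fderiv_eq_sum]
  simp only [Matrix.mul_apply, Matrix.mulVec, dotProduct, Finset.sum_mul]
  rw [Finset.sum_comm]
  refine Finset.sum_congr rfl fun k _ => Finset.sum_congr rfl fun l _ => ?_
  rw [Matrix.transpose_apply, Df, Matrix.of_apply]
  ring

/-- First order defect of one step of the scheme. -/
theorem abs_defect_le (hM0 : 0 ≤ M) (hM : ∀ i j, TameBound (fun x => f x i j) M) (i : Fin q)
    (j : Fin d)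
    {T : ℝ} (x : Fin q → ℝ) {w : Fin d → ℝ} {F : Fin d → Fin d → ℝ} {v : ℝ} (hvT : v ≤ T)
    (hw : ∑ l, |w l| ≤ v) (hF : ∑ l, ∑ m, |F l m| ≤ v ^ 2) :
    |f (x + (f x *ᵥ w + fun k => ∑ l, ∑ m, ((f x)ᵀ * Df f k x) l m * F l m)) i j -
        (f x i j + ∑ l, ((f x)ᵀ * Df f i x) l j * w l)| ≤
      (M * (M + q * M ^ 2 * T) ^ 2 + M * (q * M ^ 2)) * v ^ 2 := by
  have hv : 0 ≤ v := (Finset.sum_nonneg fun _ _ => abs_nonneg _).trans hw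
  have n1 := norm_mulVec_le hM0 hM x hw
  have n2 := norm_second_le hM x hF
  rw [sum_transpose_mul_Df_mul]
  set p := f x *ᵥ w
  set r := fun k => ∑ l, ∑ m, ((f x)ᵀ * Df f k x) l m * F l m
  have n3 : ‖p + r‖ ≤ (M + q * M ^ 2 * T) * v := by
    refine (norm_add_le _ _).trans ?_
    have : (q : ℝ) * M ^ 2 * v ^ 2 ≤ q * M ^ 2 * T * v := by
      rw [sq v, ← mul_assoc]; gcongr
    linarith
  have t1 := (hM i j).taylor x (p + r)
  have t2 := (hM i j).deriv x r
  -- The correction term of the scheme is the derivative along the first order displacement p. There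
  -- remain the Taylor remainder at p + r and the derivative along r, both of order v².
  have e : f (x + (p + r)) i j - (f x i j + fderiv ℝ (fun x => f x i j) x p) =
      (f (x + (p + r)) i j - f x i j - fderiv ℝ (fun x => f x i j) x (p + r)) +
        fderiv ℝ (fun x => f x i j) x r := by
    rw [map_add]; ring
  rw [e]
  refine (abs_add_le _ _).trans ?_
  have s1 : M * ‖p + r‖ ^ 2 ≤ M * ((M + q * M ^ 2 * T) * v) ^ 2 := by gcongr
  have s2 : M * ‖r‖ ≤ M * (q * M ^ 2 * v ^ 2) := by gcongr
  calc _ ≤ M * ((M + q * M ^ 2 * T) * v) ^ 2 + M * (q * M ^ 2 * v ^ 2) :=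
        add_le_add (t1.trans s1) (t2.trans s2)
    _ = _ := by ring

/-- Second order expansion of the defect of one step of the scheme. -/
theorem exists_defect_expansion (hφ : ∀ i j, ContDiff ℝ 2 fun x => f x i j)
    (hs : ∀ i j, HasCompactSupport fun x => f x i j) (hM0 : 0 ≤ M)
    (hM : ∀ i j, TameBound (fun x => f x i j) M) (i : Fin q) (j : Fin d) {ε : ℝ} (hε : 0 < ε) :
    ∃ δ > 0, ∀ (x : Fin q → ℝ) (w : Fin d → ℝ) (F : Fin d → Fin d → ℝ) (v : ℝ), v ≤ δ →
      (∑ l, |w l| ≤ v) → (∑ l, ∑ m, |F l m| ≤ v ^ 2) → (∀ l m, w l * w m = F l m + F m l) →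
      |f (x + (f x *ᵥ w + fun k => ∑ l, ∑ m, ((f x)ᵀ * Df f k x) l m * F l m)) i j -
        (f x i j + ∑ l, ((f x)ᵀ * Df f i x) l j * w l) - ∑ l, ∑ m, quad f i j x l m * F l m| ≤
      ε * v ^ 2 := by
  set B := M + q * M ^ 2 with hB
  have hB0 : 0 ≤ B := by positivity
  obtain ⟨δ₁, hδ₁, h₁⟩ := exists_taylor_second (hφ i j) (hs i j) (ε := ε / (2 * (B ^ 2 + 1)))
    (by positivity)
  set C := M * (q * M ^ 2) * (B + M) with hC
  have hC0 : 0 ≤ C := by positivity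
  -- The bound 1 gives ‖p + r‖ ≤ Bv, the second keeps p + r within the range δ₁ of the expansion,
  -- and the third absorbs the terms Cv³ into εv².
  refine ⟨min 1 (min (δ₁ / (B + 1)) (ε / (C + 1))), by positivity, fun x w F v hv hw hF hwF => ?_⟩
  have hv0 : 0 ≤ v := (Finset.sum_nonneg fun _ _ => abs_nonneg _).trans hw
  have v1 : v ≤ 1 := hv.trans (min_le_left _ _)
  have v2 : v ≤ δ₁ / (B + 1) := hv.trans ((min_le_right _ _).trans (min_le_left _ _))
  have v3 : v ≤ ε / (C + 1) := hv.trans ((min_le_right _ _).trans (min_le_right _ _))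
  rw [le_div_iff₀ (by positivity)] at v2 v3
  have n1 := norm_mulVec_le hM0 hM x hw
  have n2 := norm_second_le hM x hF
  rw [sum_transpose_mul_Df_mul, sum_quad_eq_taylor (hφ i j) x hwF]
  set p := f x *ᵥ w
  set r := fun k => ∑ l, ∑ m, ((f x)ᵀ * Df f k x) l m * F l m
  have n3 : ‖p + r‖ ≤ B * v := by
    refine (norm_add_le _ _).trans ?_
    have : (q : ℝ) * M ^ 2 * v ^ 2 ≤ q * M ^ 2 * v := by
      gcongr; nlinarith
    rw [hB]; linarith
  have n4 : ‖p + r‖ ≤ δ₁ := n3.trans (by nlinarith)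
  have t1 := h₁ x (p + r) n4
  set L := fderiv ℝ (fderiv ℝ fun x => f x i j) x
  have t2 := (hM i j).second x r (p + r)
  have t3 := (hM i j).second x p r
  -- Besides the Taylor remainder only Hessian terms with at least one factor r survive, and these
  -- are of order v³.
  have e : f (x + (p + r)) i j - (f x i j + fderiv ℝ (fun x => f x i j) x p) -
      (fderiv ℝ (fun x => f x i j) x r + 1 / 2 * L p p) =
      (f (x + (p + r)) i j - f x i j - fderiv ℝ (fun x => f x i j) x (p + r) -
        1 / 2 * L (p + r) (p + r)) + 1 / 2 * (L r (p + r) + L p r) := by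
    have : L (p + r) (p + r) = L p p + L p r + L r (p + r) := by
      rw [map_add L, add_apply, map_add (L p)]
    rw [this, map_add]; ring
  rw [e]
  refine (abs_add_le _ _).trans ?_
  have s1 : ε / (2 * (B ^ 2 + 1)) * ‖p + r‖ ^ 2 ≤ ε / 2 * v ^ 2 := by
    calc _ ≤ ε / (2 * (B ^ 2 + 1)) * (B * v) ^ 2 := by gcongr
      _ = ε / 2 * v ^ 2 * (B ^ 2 / (B ^ 2 + 1)) := by field_simp
      _ ≤ ε / 2 * v ^ 2 * 1 := by
          gcongr
          rw [div_le_one (by positivity)]; linarith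
      _ = _ := mul_one _
  have s2 : |1 / 2 * (L r (p + r) + L p r)| ≤ ε / 2 * v ^ 2 := by
    rw [abs_mul, abs_of_pos (by norm_num : (0 : ℝ) < 1 / 2)]
    have u1 : |L r (p + r)| ≤ M * (q * M ^ 2 * v ^ 2) * (B * v) := t2.trans (by gcongr)
    have u2 : |L p r| ≤ M * (M * v) * (q * M ^ 2 * v ^ 2) := t3.trans (by gcongr)
    have u3 := abs_add_le (L r (p + r)) (L p r)
    have u4 : M * (q * M ^ 2 * v ^ 2) * (B * v) + M * (M * v) * (q * M ^ 2 * v ^ 2) =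
        C * v * v ^ 2 := by rw [hC]; ring
    have u5 : C * v * v ^ 2 ≤ ε * v ^ 2 := by
      gcongr; nlinarith
    linarith
  linarith

end Expansion

/-! ### Density and variation of the error -/

section ErrorBound

theorem eVariationOn_le_of_control {V : Type*} [PseudoEMetricSpace V] {u : ℝ → V} {w : ℝ → ℝ}
    (hw : MonotoneOn w (Icc 0 1))
    (h : ∀ s ∈ Icc (0 : ℝ) 1, ∀ t ∈ Icc (0 : ℝ) 1, s ≤ t →
      edist (u t) (u s) ≤ ENNReal.ofReal (w t - w s)) :
    eVariationOn u (Icc 0 1) ≤ ENNReal.ofReal (w 1 - w 0) := by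
  refine iSup_le fun p => ?_
  obtain ⟨m, p, hp, hps⟩ := p
  calc ∑ i ∈ Finset.range m, edist (u (p (i + 1))) (u (p i))
      ≤ ∑ i ∈ Finset.range m, ENNReal.ofReal (w (p (i + 1)) - w (p i)) :=
        Finset.sum_le_sum fun i _ => h _ (hps i) _ (hps (i + 1)) (hp i.le_succ)
    _ = ENNReal.ofReal (∑ i ∈ Finset.range m, (w (p (i + 1)) - w (p i))) :=
        (ENNReal.ofReal_sum_of_nonneg fun i _ =>
          sub_nonneg.2 (hw (hps i) (hps (i + 1)) (hp i.le_succ))).symm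
    _ = ENNReal.ofReal (w (p m) - w (p 0)) := by rw [Finset.sum_range_sub fun i => w (p i)]
    _ ≤ ENNReal.ofReal (w 1 - w 0) := ENNReal.ofReal_le_ofReal (sub_le_sub
        (hw (hps m) ⟨zero_le_one, le_rfl⟩ (hps m).2) (hw ⟨le_rfl, zero_le_one⟩ (hps 0) (hps 0).1))

theorem eVariationOn_le_of_density {q : ℕ} {u : ℝ → Fin q → ℝ} {ρ : Fin q → ℝ → ℝ} {g : ℝ → ℝ}
    (hρ : ∀ i, IntervalIntegrable (ρ i) volume 0 1)
    (hu : ∀ t ∈ Icc (0 : ℝ) 1, ∀ i, u t i = u 0 i + ∫ s in (0 : ℝ)..t, ρ i s)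
    (hg : IntervalIntegrable g volume 0 1) (hg0 : ∀ s, 0 ≤ g s)
    (h : ∀ i, ∀ s ∈ Ioc (0 : ℝ) 1, |ρ i s| ≤ g s) :
    eVariationOn u (Icc 0 1) ≤ ENNReal.ofReal (∫ s in (0 : ℝ)..1, g s) := by
  have h0 : (0 : ℝ) ∈ Icc (0 : ℝ) 1 := ⟨le_rfl, zero_le_one⟩
  have hsub : ∀ s ∈ Icc (0 : ℝ) 1, ∀ t ∈ Icc (0 : ℝ) 1,
      (∫ r in (0 : ℝ)..t, g r) - (∫ r in (0 : ℝ)..s, g r) = ∫ r in s..t, g r := fun s hs t ht =>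
    intervalIntegral.integral_interval_sub_left (intervalIntegrable_sub hg h0 ht)
      (intervalIntegrable_sub hg h0 hs)
  have key := eVariationOn_le_of_control (u := u) (w := fun t => ∫ s in (0 : ℝ)..t, g s) ?_ ?_
  · simpa using key
  · intro s hs t ht hst
    have := intervalIntegral.integral_nonneg (μ := volume) hst fun r (_ : r ∈ Icc s t) => hg0 r
    have e := hsub s hs t ht
    simp only
    linarith
  · intro s hs t ht hst
    rw [hsub s hs t ht, edist_dist]
    refine ENNReal.ofReal_le_ofReal ?_
    rw [dist_eq_norm]
    refine (pi_norm_le_iff_of_nonneg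
      (intervalIntegral.integral_nonneg hst fun r _ => hg0 r)).2 fun i => ?_
    have e : u t i - u s i = ∫ r in s..t, ρ i r := by
      rw [hu t ht, hu s hs, ← intervalIntegral.integral_interval_sub_left
        (intervalIntegrable_sub (hρ i) h0 ht) (intervalIntegrable_sub (hρ i) h0 hs)]
      ring
    rw [Pi.sub_apply, e, Real.norm_eq_abs]
    exact abs_integral_le_of_le hst (intervalIntegrable_sub hg hs ht) fun r hr =>
      h i r ⟨hs.1.trans_lt hr.1, hr.2.trans ht.2⟩

variable {q d : ℕ} {f : (Fin q → ℝ) → Matrix (Fin q) (Fin d) ℝ} {x₀ : Fin q → ℝ}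
  {Y y : ℝ → Fin d → ℝ} {X : ℝ → Fin q → ℝ}

/-- The `ℓ¹` norm of the density `y`. -/
def mass (y : ℝ → Fin d → ℝ) (s : ℝ) : ℝ := ∑ l, |y s l|

theorem mass_nonneg (y : ℝ → Fin d → ℝ) (s : ℝ) : 0 ≤ mass y s :=
  Finset.sum_nonneg fun _ _ => abs_nonneg _

theorem IsPrimitive.integrable_mass (h : IsPrimitive Y y) : Integrable (mass y) :=
  integrable_finsetSum _ fun l _ => (h.integrable l).abs

theorem IsPrimitive.cubic_mass (h : IsPrimitive Y y) : L3 (mass y) :=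
  memLp_finsetSum _ fun l _ => (h.cubic l).abs

theorem sum_abs_primitive_le (h : IsPrimitive Y y) {a s : ℝ} :
    ∑ l, ∫ r in a..s, |y r l| = ∫ r in a..s, mass y r := by
  rw [← intervalIntegral.integral_finsetSum fun l _ => (h.integrable l).abs.intervalIntegrable]
  rfl

theorem sum_abs_W_le (h : IsPrimitive Y y) {n : ℕ} (hn : 0 < n) {s : ℝ}
    (hs : s ∈ Ioc (0 : ℝ) 1) : ∑ l, |W n (fun r => y r l) s| ≤ W n (mass y) s := by
  obtain ⟨h1, -, -⟩ := lo_bounds hn hs.1 hs.2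
  rw [W, ← sum_abs_primitive_le h]
  exact Finset.sum_le_sum fun l _ => intervalIntegral.abs_integral_le_integral_abs h1.le

theorem sum_abs_E_le (h : IsPrimitive Y y) {n : ℕ} (hn : 0 < n) {s : ℝ}
    (hs : s ∈ Ioc (0 : ℝ) 1) :
    ∑ l, ∑ m, |E n (fun r => y r l) (fun r => y r m) s| ≤ W n (mass y) s ^ 2 := by
  obtain ⟨h1, -, -⟩ := lo_bounds hn hs.1 hs.2
  rw [W, ← sum_abs_primitive_le h, sq, Finset.sum_mul_sum]
  exact Finset.sum_le_sum fun l _ => Finset.sum_le_sum fun m _ =>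
    abs_iterated_integral_le (h.integrable l) (h.integrable m) h1.le

theorem W_mul_W (h : IsPrimitive Y y) (n : ℕ) (s : ℝ) (l m : Fin d) :
    W n (fun r => y r l) s * W n (fun r => y r m) s =
      E n (fun r => y r l) (fun r => y r m) s + E n (fun r => y r m) (fun r => y r l) s :=
  integral_primitive_mul_add (h.integrable l) (h.integrable m) _ _

theorem W_mass_nonneg {n : ℕ} (hn : 0 < n) {s : ℝ} (hs : s ∈ Ioc (0 : ℝ) 1) :
    0 ≤ W n (mass y) s :=
  intervalIntegral.integral_nonneg (lo_bounds hn hs.1 hs.2).1.le fun r _ => mass_nonneg y r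

theorem W_mass_le (h : IsPrimitive Y y) {n : ℕ} (hn : 0 < n) {s : ℝ} (hs : s ∈ Ioc (0 : ℝ) 1) :
    W n (mass y) s ≤ ∫ r in (0 : ℝ)..1, mass y r := by
  obtain ⟨h1, -, -⟩ := lo_bounds hn hs.1 hs.2
  exact integral_le_of_subinterval h.integrable_mass.intervalIntegrable (mass_nonneg y)
    (lo_nonneg n s) h1.le hs.2

theorem eventually_W_mass_le (h : IsPrimitive Y y) {ε : ℝ} (hε : 0 < ε) :
    ∀ᶠ n : ℕ in atTop, ∀ s ∈ Ioc (0 : ℝ) 1, W n (mass y) s ≤ ε := by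
  filter_upwards [exists_small_grid_oscillation h.integrable_mass.intervalIntegrable hε,
    eventually_gt_atTop 0] with n h1 hn s hs
  obtain ⟨b1, b2, -⟩ := lo_bounds hn hs.1 hs.2
  exact (le_abs_self _).trans ((abs_primitive_le h.integrable_mass b1.le b2).trans (h1 s hs))

theorem intervalIntegrable_sq_W_mul_mass (h : IsPrimitive Y y) {n : ℕ} (hn : 0 < n) :
    IntervalIntegrable (fun s => W n (mass y) s ^ 2 * mass y s) volume 0 1 := by
  refine intervalIntegrable_of_bound' (G := fun s => (∫ r in (0 : ℝ)..1, mass y r) ^ 2 * mass y s)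
    (((measurable_W n h.integrable_mass).pow_const 2).aestronglyMeasurable.mul
      h.integrable_mass.aestronglyMeasurable.restrict)
    (h.integrable_mass.intervalIntegrable.const_mul _) fun s hs => ?_
  have := W_mass_nonneg (y := y) hn hs
  have h2 := W_mass_le h hn hs
  have h3 := mass_nonneg y s
  rw [abs_of_nonneg (by positivity)]
  gcongr

/-- Source of the rate n⁻². Since nW is at most the average of the mass, n² W² mass is bounded by a
product of three L³ functions, and averaging does not increase the L³ norm. -/
theorem integral_sq_W_mul_mass_le (h : IsPrimitive Y y) {n : ℕ} (hn : 0 < n) :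
    ∫ s in (0 : ℝ)..1, W n (mass y) s ^ 2 * mass y s ≤ 3 * N3 (mass y) / n ^ 2 := by
  have hn' : (0 : ℝ) < n := by exact_mod_cast hn
  have ha := L3_avg hn h.integrable_mass.intervalIntegrable
  have hi := intervalIntegrable_sq_W_mul_mass h hn
  rw [le_div_iff₀ (by positivity), mul_comm, ← intervalIntegral.integral_const_mul]
  have key : ∫ s in (0 : ℝ)..1, (n : ℝ) ^ 2 * (W n (mass y) s ^ 2 * mass y s) ≤
      ∫ s in (0 : ℝ)..1, (2 * |avg n (mass y) s| ^ 3 + |mass y s| ^ 3) := by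
    refine integral_mono_Ioc zero_le_one (hi.const_mul _)
      ((ha.cube.const_mul 2).add h.cubic_mass.cube) fun s hs => ?_
    have w0 := W_mass_nonneg (y := y) hn hs
    have w1 := abs_W_le hn h.integrable_mass hs
    simp only [abs_of_nonneg (mass_nonneg y _), abs_of_nonneg w0] at w1
    have h3 := mass_nonneg y s
    have a0 : 0 ≤ avg n (mass y) s := le_trans (by positivity) w1
    have := mul_mul_le_add_cubes a0 a0 h3
    rw [abs_of_nonneg a0, abs_of_nonneg h3]
    calc (n : ℝ) ^ 2 * (W n (mass y) s ^ 2 * mass y s) = (n * W n (mass y) s) ^ 2 * mass y s := by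
          ring
      _ ≤ avg n (mass y) s ^ 2 * mass y s := by gcongr
      _ ≤ _ := by nlinarith
  refine key.trans ?_
  rw [intervalIntegral.integral_add (ha.cube.const_mul 2) h.cubic_mass.cube,
    intervalIntegral.integral_const_mul]
  have := N3_avg_le hn h.cubic_mass
  simp only [N3] at this ⊢
  linarith

/-- Displays the scheme as base point plus displacement of first and second order, the form required
by the Taylor estimates. -/
theorem scheme_eq_add (h : IsPrimitive Y y) (f : (Fin q → ℝ) → Matrix (Fin q) (Fin d) ℝ)
    (x₀ : Fin q → ℝ) {n : ℕ} (hn : 0 < n) {t : ℝ} (ht : t ∈ Icc (0 : ℝ) 1) :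
    scheme f x₀ Y n t = base f x₀ Y n t +
      (f (base f x₀ Y n t) *ᵥ (fun l => W n (fun r => y r l) t) + fun k => ∑ l, ∑ m,
        ((f (base f x₀ Y n t))ᵀ * Df f k (base f x₀ Y n t)) l m *
          E n (fun r => y r l) (fun r => y r m) t) := by
  ext i
  rw [scheme_eq h f x₀ hn ht i, add_assoc]
  rfl

theorem abs_sum_mul_le_mass {a : Fin d → ℝ} {B : ℝ} (ha : ∀ j, |a j| ≤ B) (s : ℝ) :
    |∑ j, a j * y s j| ≤ B * mass y s := by
  rw [mass, Finset.mul_sum]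
  refine (Finset.abs_sum_le_sum_abs _ _).trans (Finset.sum_le_sum fun j _ => ?_)
  rw [abs_mul]
  exact mul_le_mul_of_nonneg_right (ha j) (abs_nonneg _)

theorem intervalIntegrable_sum_solution (h : IsPrimitive Y y)
    (hf : ∀ i j, Continuous fun x => f x i j) (hX : ContinuousOn X (Icc 0 1)) (i : Fin q) :
    IntervalIntegrable (fun s => ∑ j, f (X s) i j * y s j) volume 0 1 := by
  refine intervalIntegrable_finset_sum fun j _ =>
    (h.integrable j).intervalIntegrable.continuousOn_mul ?_
  rw [uIcc_of_le zero_le_one]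
  exact (hf i j).comp_continuousOn hX

theorem solution_eq_integral (h : IsPrimitive Y y) (hf : ∀ i j, Continuous fun x => f x i j)
    (hX : IsSolution f x₀ Y X) {t : ℝ} (ht : t ∈ Icc (0 : ℝ) 1) (i : Fin q) :
    X t i = x₀ i + ∫ s in (0 : ℝ)..t, ∑ j, f (X s) i j * y s j := by
  have hc : ∀ j, ContinuousOn (fun s => f (X s) i j) (Icc 0 1) := fun j =>
    (hf i j).comp_continuousOn hX.1
  rw [hX.2 t ht i, intervalIntegral.integral_finsetSum fun j _ => by
    refine (h.integrable j).intervalIntegrable.continuousOn_mul ((hc j).mono ?_)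
    rw [uIcc_of_le ht.1]
    exact Icc_subset_Icc_right ht.2]
  congr 1
  exact Finset.sum_congr rfl fun j _ => h.stieltjes_eq (hc j) j le_rfl ht.1 ht.2

theorem error_eq_integral (h : IsPrimitive Y y) (hf : ∀ i j, Continuous fun x => f x i j)
    (hX : IsSolution f x₀ Y X) {n : ℕ} (hn : 0 < n) {t : ℝ} (ht : t ∈ Icc (0 : ℝ) 1)
    (i : Fin q) :
    scheme f x₀ Y n t i - X t i =
      ∫ s in (0 : ℝ)..t, ∑ j, (rate f x₀ Y y n i j s - f (X s) i j) * y s j := by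
  have h0 : (0 : ℝ) ∈ Icc (0 : ℝ) 1 := ⟨le_rfl, zero_le_one⟩
  simp only [sub_mul, Finset.sum_sub_distrib]
  rw [intervalIntegral.integral_sub
    (intervalIntegrable_sub (intervalIntegrable_sum_rate h f x₀ hn i) h0 ht)
    (intervalIntegrable_sub (intervalIntegrable_sum_solution h hf hX.1 i) h0 ht),
    scheme_eq_integral h f x₀ hn ht, solution_eq_integral h hf hX ht]
  ring

theorem intervalIntegrable_error (h : IsPrimitive Y y) (hf : ∀ i j, Continuous fun x => f x i j)
    (hX : ContinuousOn X (Icc 0 1)) {n : ℕ} (hn : 0 < n) (i : Fin q) :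
    IntervalIntegrable (fun s => ∑ j, (rate f x₀ Y y n i j s - f (X s) i j) * y s j)
      volume 0 1 := by
  simp only [sub_mul, Finset.sum_sub_distrib]
  exact (intervalIntegrable_sum_rate h f x₀ hn i).sub (intervalIntegrable_sum_solution h hf hX i)

theorem continuousOn_of_eq_integral {q : ℕ} {u : ℝ → Fin q → ℝ} {ρ : Fin q → ℝ → ℝ}
    {a : Fin q → ℝ} (hρ : ∀ i, IntervalIntegrable (ρ i) volume 0 1)
    (hu : ∀ t ∈ Icc (0 : ℝ) 1, ∀ i, u t i = a i + ∫ s in (0 : ℝ)..t, ρ i s) :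
    ContinuousOn u (Icc 0 1) := by
  refine continuousOn_pi.2 fun i => ?_
  have hc := ((hρ i).absolutelyContinuousOnInterval_intervalIntegral (c := 0) (by simp)).continuousOn
  rw [uIcc_of_le zero_le_one] at hc
  exact (continuousOn_const.add hc).congr fun t ht => hu t ht i

theorem continuousOn_scheme (h : IsPrimitive Y y) (f : (Fin q → ℝ) → Matrix (Fin q) (Fin d) ℝ)
    (x₀ : Fin q → ℝ) {n : ℕ} (hn : 0 < n) : ContinuousOn (scheme f x₀ Y n) (Icc 0 1) :=
  continuousOn_of_eq_integral (fun i => intervalIntegrable_sum_rate h f x₀ hn i)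
    fun _ ht i => scheme_eq_integral h f x₀ hn ht i

/-- The scheme has finite variation error for every single `n`. -/
theorem exists_variation_bound_single (h : IsPrimitive Y y)
    (hf : ∀ i j, Continuous fun x => f x i j) (hX : IsSolution f x₀ Y X) {n : ℕ} (hn : 0 < n) :
    eVariationOn (fun t => scheme f x₀ Y n t - X t) (Icc 0 1) < ⊤ := by
  have h0 : (0 : ℝ) ∈ Icc (0 : ℝ) 1 := ⟨le_rfl, zero_le_one⟩
  have hi := fun i => intervalIntegrable_error (x₀ := x₀) h hf hX.1 hn i
  refine (eVariationOn_le_of_density (ρ := fun i s =>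
    ∑ j, (rate f x₀ Y y n i j s - f (X s) i j) * y s j) hi ?_
    (intervalIntegrable_finset_sum fun i (_ : i ∈ Finset.univ) => (hi i).abs)
    (fun s => Finset.sum_nonneg fun _ _ => abs_nonneg _) fun i s _ => ?_).trans_lt
    ENNReal.ofReal_lt_top
  · intro t ht i
    simp only [Pi.sub_apply]
    rw [error_eq_integral h hf hX hn ht, error_eq_integral h hf hX hn h0]
    simp
  · exact Finset.single_le_sum (f := fun i =>
      |∑ j, (rate f x₀ Y y n i j s - f (X s) i j) * y s j|) (fun _ _ => abs_nonneg _)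
      (Finset.mem_univ i)

/-! ### Order n⁻² for coefficients with uniform bounds -/

section Tame

variable {M : ℝ}

theorem abs_rate_sub_scheme_le (hM0 : 0 ≤ M) (hM : ∀ i j, TameBound (fun x => f x i j) M)
    (h : IsPrimitive Y y) {n : ℕ} (hn : 0 < n) (i : Fin q) (j : Fin d) {s : ℝ}
    (hs : s ∈ Ioc (0 : ℝ) 1) :
    |f (scheme f x₀ Y n s) i j - rate f x₀ Y y n i j s| ≤
      (M * (M + q * M ^ 2 * ∫ r in (0 : ℝ)..1, mass y r) ^ 2 + M * (q * M ^ 2)) *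
        W n (mass y) s ^ 2 := by
  rw [scheme_eq_add h f x₀ hn (Ioc_subset_Icc_self hs)]
  exact abs_defect_le hM0 hM i j _ (W_mass_le h hn hs) (sum_abs_W_le h hn hs) (sum_abs_E_le h hn hs)

theorem eventually_rate_expansion (hφ : ∀ i j, ContDiff ℝ 2 fun x => f x i j)
    (hs : ∀ i j, HasCompactSupport fun x => f x i j) (hM0 : 0 ≤ M)
    (hM : ∀ i j, TameBound (fun x => f x i j) M) (h : IsPrimitive Y y) {ε : ℝ} (hε : 0 < ε) :
    ∀ᶠ n : ℕ in atTop, ∀ i j, ∀ s ∈ Ioc (0 : ℝ) 1,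
      |f (scheme f x₀ Y n s) i j - rate f x₀ Y y n i j s - ∑ l, ∑ m,
        quad f i j (base f x₀ Y n s) l m * E n (fun r => y r l) (fun r => y r m) s| ≤
      ε * W n (mass y) s ^ 2 := by
  rw [eventually_all]
  intro i
  rw [eventually_all]
  intro j
  obtain ⟨δ, hδ, H⟩ := exists_defect_expansion hφ hs hM0 hM i j hε
  filter_upwards [eventually_W_mass_le h hδ, eventually_gt_atTop 0] with n h1 hn s hs
  rw [scheme_eq_add h f x₀ hn (Ioc_subset_Icc_self hs)]
  exact H _ _ _ _ (h1 s hs) (sum_abs_W_le h hn hs) (sum_abs_E_le h hn hs) (W_mul_W h n s)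

/-- The density of the error is controlled by the error and the squared oscillation. -/
theorem abs_error_density_le (hM0 : 0 ≤ M) (hM : ∀ i j, TameBound (fun x => f x i j) M)
    (h : IsPrimitive Y y) {n : ℕ} (hn : 0 < n) (i : Fin q) {s : ℝ} (hs : s ∈ Ioc (0 : ℝ) 1) :
    |∑ j, (rate f x₀ Y y n i j s - f (X s) i j) * y s j| ≤
      M * mass y s * ‖scheme f x₀ Y n s - X s‖ +
      (M * (M + q * M ^ 2 * ∫ r in (0 : ℝ)..1, mass y r) ^ 2 + M * (q * M ^ 2)) *
        (W n (mass y) s ^ 2 * mass y s) := by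
  set C := M * (M + q * M ^ 2 * ∫ r in (0 : ℝ)..1, mass y r) ^ 2 + M * (q * M ^ 2)
  have := abs_sum_mul_le_mass (y := y) (a := fun j => rate f x₀ Y y n i j s - f (X s) i j)
    (B := M * ‖scheme f x₀ Y n s - X s‖ + C * W n (mass y) s ^ 2) (fun j => by
      have a1 := abs_le.1 (abs_rate_sub_scheme_le (x₀ := x₀) hM0 hM h hn i j hs)
      have a2 := abs_le.1 ((hM i j).lip (scheme f x₀ Y n s) (X s))
      rw [abs_le]
      constructor <;> linarith [a1.1, a1.2, a2.1, a2.2]) s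
  refine this.trans (le_of_eq ?_)
  ring

/-- The error of the scheme is of order `n⁻²`, in variation as well. -/
theorem exists_error_bound (hφ : ∀ i j, ContDiff ℝ 2 fun x => f x i j) (hM0 : 0 ≤ M)
    (hM : ∀ i j, TameBound (fun x => f x i j) M)
    (h : IsPrimitive Y y) (hX : IsSolution f x₀ Y X) :
    ∃ C : ℝ, 0 ≤ C ∧ ∀ n : ℕ, 0 < n →
      (∀ t ∈ Icc (0 : ℝ) 1, ‖scheme f x₀ Y n t - X t‖ ≤ C / n ^ 2) ∧
      eVariationOn (fun t => scheme f x₀ Y n t - X t) (Icc 0 1) ≤ ENNReal.ofReal (C / n ^ 2) := by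
  have hf : ∀ i j, Continuous fun x => f x i j := fun i j => (hφ i j).continuous
  have h0 : (0 : ℝ) ∈ Icc (0 : ℝ) 1 := ⟨le_rfl, zero_le_one⟩
  set T := ∫ r in (0 : ℝ)..1, mass y r with hT
  have hT0 : 0 ≤ T := intervalIntegral.integral_nonneg zero_le_one fun r _ => mass_nonneg y r
  set C₁ := M * (M + q * M ^ 2 * T) ^ 2 + M * (q * M ^ 2) with hC₁
  have hC₁0 : 0 ≤ C₁ := by positivity
  have hN := N3_nonneg (mass y)
  set C₂ := C₁ * (3 * N3 (mass y)) with hC₂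
  have hC₂0 : 0 ≤ C₂ := by positivity
  set C₃ := 2 * C₂ * Real.exp (2 * ∫ s in (0 : ℝ)..1, M * mass y s) with hC₃
  have hC₃0 : 0 ≤ C₃ := by positivity
  -- C₂ comes from the local defects and C₃ from Grönwall's inequality. In the variation the error
  -- re-enters through the Lipschitz term, which adds M T C₃.
  refine ⟨C₃ + (M * T * C₃ + C₂), by positivity, fun n hn => ?_⟩
  have hn' : (0 : ℝ) < n := by exact_mod_cast hn
  have hUc : ContinuousOn (fun t => scheme f x₀ Y n t - X t) (Icc 0 1) :=
    (continuousOn_scheme h f x₀ hn).sub hX.1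
  have hi1 : IntervalIntegrable (fun s => M * mass y s * ‖scheme f x₀ Y n s - X s‖)
      volume 0 1 := by
    refine (h.integrable_mass.intervalIntegrable.const_mul M).mul_continuousOn ?_
    rw [uIcc_of_le zero_le_one]
    exact hUc.norm
  have hi2 := (intervalIntegrable_sq_W_mul_mass h hn).const_mul C₁
  have hsm := integral_sq_W_mul_mass_le h hn
  have hW0 : ∀ s, 0 ≤ C₁ * (W n (mass y) s ^ 2 * mass y s) := fun s =>
    mul_nonneg hC₁0 (mul_nonneg (sq_nonneg _) (mass_nonneg y s))
  have hI2 : ∫ s in (0 : ℝ)..1, C₁ * (W n (mass y) s ^ 2 * mass y s) ≤ C₂ / n ^ 2 := by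
    rw [intervalIntegral.integral_const_mul]
    calc _ ≤ C₁ * (3 * N3 (mass y) / n ^ 2) := by gcongr
      _ = _ := by rw [hC₂]; ring
  have hb : ∀ t ∈ Icc (0 : ℝ) 1, ‖scheme f x₀ Y n t - X t‖ ≤ C₃ / n ^ 2 := by
    have := gronwall_of_integrable (A := C₂ / n ^ 2) (k := fun s => M * mass y s)
      (φ := fun t => ‖scheme f x₀ Y n t - X t‖) (by positivity)
      (h.integrable_mass.intervalIntegrable.const_mul M)
      (fun s => mul_nonneg hM0 (mass_nonneg y s)) hUc.norm fun t ht => by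
        have hp1 : 0 ≤ ∫ s in (0 : ℝ)..t, M * mass y s * ‖scheme f x₀ Y n s - X s‖ :=
          intervalIntegral.integral_nonneg ht.1 fun s _ =>
            mul_nonneg (mul_nonneg hM0 (mass_nonneg y s)) (norm_nonneg _)
        refine (pi_norm_le_iff_of_nonneg (by positivity)).2 fun i => ?_
        rw [Pi.sub_apply, error_eq_integral h hf hX hn ht, Real.norm_eq_abs]
        refine (abs_integral_le_of_le ht.1 (intervalIntegrable_sub (hi1.add hi2) h0 ht)
          fun s hs => abs_error_density_le hM0 hM h hn i ⟨hs.1, hs.2.trans ht.2⟩).trans ?_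
        rw [intervalIntegral.integral_add (intervalIntegrable_sub hi1 h0 ht)
          (intervalIntegrable_sub hi2 h0 ht), add_comm]
        have := integral_le_of_subinterval hi2 hW0 le_rfl ht.1 ht.2
        linarith
    intro t ht
    refine (this t ht).trans (le_of_eq ?_)
    rw [hC₃]; ring
  refine ⟨fun t ht => (hb t ht).trans ?_, ?_⟩
  · gcongr
    have : 0 ≤ M * T * C₃ + C₂ := by positivity
    linarith
  · refine (eVariationOn_le_of_density (ρ := fun i s =>
      ∑ j, (rate f x₀ Y y n i j s - f (X s) i j) * y s j)
      (fun i => intervalIntegrable_error h hf hX.1 hn i) ?_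
      (g := fun s => M * mass y s * (C₃ / n ^ 2) + C₁ * (W n (mass y) s ^ 2 * mass y s))
      (((h.integrable_mass.intervalIntegrable.const_mul M).mul_const _).add hi2) ?_ ?_).trans ?_
    · intro t ht i
      simp only [Pi.sub_apply]
      rw [error_eq_integral h hf hX hn ht, error_eq_integral h hf hX hn h0]
      simp
    · intro s
      have := hW0 s
      have := mass_nonneg y s
      positivity
    · intro i s hs
      refine (abs_error_density_le hM0 hM h hn i hs).trans ?_
      have := mass_nonneg y s
      have := hb s (Ioc_subset_Icc_self hs)
      gcongr
    · refine ENNReal.ofReal_le_ofReal ?_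
      rw [intervalIntegral.integral_add
        ((h.integrable_mass.intervalIntegrable.const_mul M).mul_const _) hi2,
        intervalIntegral.integral_mul_const, intervalIntegral.integral_const_mul, ← hT]
      have : C₃ + (M * T * C₃ + C₂) = M * T * C₃ + C₂ + C₃ := by ring
      have h4 : 0 ≤ C₃ / (n : ℝ) ^ 2 := by positivity
      rw [this, add_div, add_div, ← mul_div_assoc]
      linarith

end Tame

end ErrorBound

/-! ### Convergence of the normalised error -/

section Limit

variable {q d : ℕ} {f : (Fin q → ℝ) → Matrix (Fin q) (Fin d) ℝ} {x₀ : Fin q → ℝ}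
  {Y y : ℝ → Fin d → ℝ} {X : ℝ → Fin q → ℝ}

theorem continuous_partialD {φ : (Fin q → ℝ) → ℝ} (hφ : ContDiff ℝ 2 φ) (k : Fin q) :
    Continuous (partialD k φ) :=
  (hφ.continuous_fderiv (by norm_num)).clm_apply continuous_const

theorem continuous_hess {φ : (Fin q → ℝ) → ℝ} (hφ : ContDiff ℝ 2 φ) (k l : Fin q) :
    Continuous fun x => hess φ x k l := by
  have hc1 : ContDiff ℝ 1 (fderiv ℝ φ) := hφ.fderiv_right (m := 1) (by norm_num)
  simp only [hess_apply hφ]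
  exact ((hc1.continuous_fderiv (by norm_num)).clm_apply continuous_const).clm_apply
    continuous_const

theorem continuous_quad (hφ : ∀ i j, ContDiff ℝ 2 fun x => f x i j) (i : Fin q) (j l m : Fin d) :
    Continuous fun x => quad f i j x l m := by
  have h0 : ∀ i j, Continuous fun x => f x i j := fun i j => (hφ i j).continuous
  have h1 : ∀ i j k, Continuous (partialD k fun x => f x i j) :=
    fun i j k => continuous_partialD (hφ i j) k
  have h2 : ∀ k l, Continuous fun x => hess (fun z => f z i j) x k l :=
    fun k l => continuous_hess (hφ i j) k l
  simp only [quad, Matrix.mul_apply, Matrix.transpose_apply, Df, Matrix.of_apply]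
  fun_prop

theorem exists_uniform_modulus {V : Type*} [PseudoMetricSpace V] {u : ℝ → V}
    (hu : ContinuousOn u (Icc 0 1)) {ε : ℝ} (hε : 0 < ε) :
    ∃ δ > 0, ∀ s ∈ Icc (0 : ℝ) 1, ∀ t ∈ Icc (0 : ℝ) 1, |s - t| < δ → dist (u s) (u t) < ε :=
  Metric.uniformContinuousOn_iff.1 (isCompact_Icc.uniformContinuousOn_of_continuous hu) ε hε

theorem eventually_comp_close {g : (Fin q → ℝ) → ℝ} (hg : Continuous g)
    (hX : ContinuousOn X (Icc 0 1)) {Xn : ℕ → ℝ → Fin q → ℝ}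
    (h : ∀ ε > 0, ∀ᶠ n in atTop, ∀ s ∈ Ioc (0 : ℝ) 1, dist (Xn n s) (X s) ≤ ε) {ε : ℝ}
    (hε : 0 < ε) : ∀ᶠ n in atTop, ∀ s ∈ Ioc (0 : ℝ) 1, |g (Xn n s) - g (X s)| ≤ ε := by
  obtain ⟨R, hR⟩ := (isCompact_Icc.image_of_continuousOn hX).isBounded.subset_closedBall 0
  have hu := (isCompact_closedBall (0 : Fin q → ℝ) (R + 1)).uniformContinuousOn_of_continuous
    hg.continuousOn
  obtain ⟨δ, hδ, H⟩ := Metric.uniformContinuousOn_iff.1 hu ε hε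
  filter_upwards [h (min (δ / 2) 1) (by positivity)] with n hn s hs
  have hd := hn s hs
  have hXs : dist (X s) 0 ≤ R := hR ⟨s, Ioc_subset_Icc_self hs, rfl⟩
  have h1 : X s ∈ Metric.closedBall (0 : Fin q → ℝ) (R + 1) := by
    rw [Metric.mem_closedBall]; linarith
  have h2 : Xn n s ∈ Metric.closedBall (0 : Fin q → ℝ) (R + 1) := by
    rw [Metric.mem_closedBall]
    linarith [dist_triangle (Xn n s) (X s) 0, hd.trans (min_le_right _ _)]
  rw [← Real.dist_eq]
  exact (H _ h2 _ h1 (by linarith [hd.trans (min_le_left _ _)])).le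

theorem base_eq_scheme (h : IsPrimitive Y y) (f : (Fin q → ℝ) → Matrix (Fin q) (Fin d) ℝ)
    (x₀ : Fin q → ℝ) {n : ℕ} (hn : 0 < n) {s : ℝ} (hs : s ∈ Ioc (0 : ℝ) 1) :
    base f x₀ Y n s = scheme f x₀ Y n (lo n s) := by
  ext i
  rw [base, grid_eq_integral h f x₀ hn i (cell_lt hn hs).le,
    scheme_eq_integral h f x₀ hn (lo_mem hn (Ioc_subset_Icc_self hs)).1, lo]

/-- The grid value is the scheme at the last grid point, hence near X there, and X moves little
within a cell. -/
theorem eventually_base_close (hX : ContinuousOn X (Icc 0 1)) (h : IsPrimitive Y y)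
    (hU : ∀ ε > 0, ∀ᶠ n : ℕ in atTop, ∀ t ∈ Icc (0 : ℝ) 1, ‖scheme f x₀ Y n t - X t‖ ≤ ε)
    {ε : ℝ} (hε : 0 < ε) :
    ∀ᶠ n in atTop, ∀ s ∈ Ioc (0 : ℝ) 1, dist (base f x₀ Y n s) (X s) ≤ ε := by
  obtain ⟨δ, hδ, H⟩ := exists_uniform_modulus hX (half_pos hε)
  have ht : ∀ᶠ n : ℕ in atTop, 1 / (n : ℝ) < δ :=
    (tendsto_order.1 tendsto_one_div_atTop_nhds_zero_nat).2 δ hδ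
  filter_upwards [hU (ε / 2) (by positivity), ht, eventually_gt_atTop 0] with n h1 h2 hn s hs
  obtain ⟨b1, b2, -⟩ := lo_bounds hn hs.1 hs.2
  have hl := (lo_mem hn (Ioc_subset_Icc_self hs)).1
  rw [base_eq_scheme h f x₀ hn hs]
  have d1 := h1 _ hl
  rw [← dist_eq_norm] at d1
  have d2 := H _ hl s (Ioc_subset_Icc_self hs) (by rw [abs_lt]; constructor <;> linarith)
  linarith [dist_triangle (scheme f x₀ Y n (lo n s)) (X (lo n s)) (X s)]

theorem dotProduct_Df_mulVec (i : Fin q) (x u : Fin q → ℝ) (v : Fin d → ℝ) :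
    u ⬝ᵥ (Df f i x *ᵥ v) = ∑ j, fderiv ℝ (fun z => f z i j) x u * v j := by
  simp only [fderiv_eq_sum, dotProduct, Matrix.mulVec, Finset.mul_sum, Finset.sum_mul]
  rw [Finset.sum_comm]
  exact Finset.sum_congr rfl fun j _ => Finset.sum_congr rfl fun k _ => by
    rw [Df, Matrix.of_apply]; ring

theorem intervalIntegrable_Df_mulVec (hφ : ∀ i j, ContDiff ℝ 2 fun x => f x i j)
    (hX : ContinuousOn X (Icc 0 1)) (hy : ∀ j, IntervalIntegrable (fun s => y s j) volume 0 1)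
    (i k : Fin q) : IntervalIntegrable (fun s => (Df f i (X s) *ᵥ y s) k) volume 0 1 := by
  change IntervalIntegrable (fun s => ∑ j, partialD k (fun z => f z i j) (X s) * y s j) volume 0 1
  refine intervalIntegrable_finset_sum fun j _ => (hy j).continuousOn_mul ?_
  rw [uIcc_of_le zero_le_one]
  exact (continuous_partialD (hφ i j) k).comp_continuousOn hX

theorem errorSolution_unique (hφ : ∀ i j, ContDiff ℝ 2 fun x => f x i j)
    (hX : ContinuousOn X (Icc 0 1)) (hy : ∀ j, IntervalIntegrable (fun s => y s j) volume 0 1)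
    {U V : ℝ → Fin q → ℝ} (hU : IsErrorSolution f y X U) (hV : IsErrorSolution f y X V) :
    EqOn V U (Icc 0 1) :=
  volterra_unique (intervalIntegrable_Df_mulVec hφ hX hy) hV.1 hU.1 hV.2.2 hU.2.2

theorem intervalIntegrable_E_mul {n : ℕ} (hn : 0 < n) {u v w : ℝ → ℝ} (hu : Integrable u)
    (hv : Integrable v) (hw : Integrable w) :
    IntervalIntegrable (fun s => (n : ℝ) ^ 2 * E n u v s * w s) volume 0 1 := by
  have hn' : (0 : ℝ) < n := by exact_mod_cast hn
  refine intervalIntegrable_of_bound' (G := fun s =>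
      ((n * ∫ r in (0 : ℝ)..1, |u r|) * (n * ∫ r in (0 : ℝ)..1, |v r|)) * |w s|)
    (((measurable_E n hu hv).const_mul _).aestronglyMeasurable.mul
      hw.aestronglyMeasurable.restrict)
    (hw.intervalIntegrable.abs.const_mul _) fun s hs => ?_
  obtain ⟨h1, h2, h3⟩ := lo_bounds hn hs.1 hs.2
  have hb : ∀ {g : ℝ → ℝ}, Integrable g →
      0 ≤ avg n (fun r => |g r|) s ∧ avg n (fun r => |g r|) s ≤ n * ∫ r in (0 : ℝ)..1, |g r| :=
    fun hg => ⟨mul_nonneg hn'.le (intervalIntegral.integral_nonneg (by linarith)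
      fun _ _ => abs_nonneg _), mul_le_mul_of_nonneg_left (integral_le_of_subinterval
        hg.abs.intervalIntegrable (fun _ => abs_nonneg _) (lo_nonneg n s) (by linarith) h3) hn'.le⟩
  have hE := E_bound hn hu hv hs
  rw [abs_mul, abs_mul, abs_of_nonneg (by positivity : (0 : ℝ) ≤ (n : ℝ) ^ 2)]
  exact mul_le_mul_of_nonneg_right (hE.trans (mul_le_mul (hb hu).2 (hb hv).2 (hb hv).1
    ((hb hu).1.trans (hb hu).2))) (abs_nonneg _)

theorem intervalIntegrable_quad_mul (hφ : ∀ i j, ContDiff ℝ 2 fun x => f x i j)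
    (hX : ContinuousOn X (Icc 0 1)) (h : IsPrimitive Y y) (i : Fin q) (j l m : Fin d) :
    IntervalIntegrable (fun s => quad f i j (X s) l m * (y s l * y s m * y s j)) volume 0 1 := by
  refine ((h.cubic l).mul_mul (h.cubic m) (h.cubic j)).continuousOn_mul ?_
  rw [uIcc_of_le zero_le_one]
  exact (continuous_quad hφ i j l m).comp_continuousOn hX

theorem source_eq_sum (hφ : ∀ i j, ContDiff ℝ 2 fun x => f x i j)
    (hX : ContinuousOn X (Icc 0 1)) (h : IsPrimitive Y y) {t : ℝ} (ht : t ∈ Icc (0 : ℝ) 1)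
    (i : Fin q) :
    1 / 6 * ∑ j, ∫ s in (0 : ℝ)..t, (y s ⬝ᵥ ((G f i j (X s) * f (X s)) *ᵥ y s)) * y s j =
      ∑ j, ∑ l, ∑ m, 1 / 6 * ∫ s in (0 : ℝ)..t, quad f i j (X s) l m * (y s l * y s m * y s j) := by
  have h0 : (0 : ℝ) ∈ Icc (0 : ℝ) 1 := ⟨le_rfl, zero_le_one⟩
  simp only [Finset.mul_sum]
  refine Finset.sum_congr rfl fun j _ => ?_
  have e : ∀ s, (y s ⬝ᵥ ((G f i j (X s) * f (X s)) *ᵥ y s)) * y s j =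
      ∑ l, ∑ m, quad f i j (X s) l m * (y s l * y s m * y s j) := fun s => by
    rw [← sum_quad_mul_mul, Finset.sum_mul]
    refine Finset.sum_congr rfl fun l _ => ?_
    rw [Finset.sum_mul]
    exact Finset.sum_congr rfl fun m _ => by ring
  have hi : ∀ l m, IntervalIntegrable (fun s => quad f i j (X s) l m * (y s l * y s m * y s j))
      volume 0 t := fun l m => intervalIntegrable_sub
    (intervalIntegrable_quad_mul hφ hX h i j l m) h0 ht
  simp only [e]
  rw [intervalIntegral.integral_finsetSum fun l _ =>
    intervalIntegrable_finset_sum fun m _ => hi l m, Finset.mul_sum]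
  refine Finset.sum_congr rfl fun l _ => ?_
  rw [intervalIntegral.integral_finsetSum fun m _ => hi l m, Finset.mul_sum]

/-- Convergence of the normalised error for compactly supported coefficients. -/
theorem exists_errorSolution_limit (hφ : ∀ i j, ContDiff ℝ 2 fun x => f x i j)
    (hs : ∀ i j, HasCompactSupport fun x => f x i j) {M : ℝ} (hM0 : 0 ≤ M)
    (hM : ∀ i j, TameBound (fun x => f x i j) M) (h : IsPrimitive Y y)
    (hX : IsSolution f x₀ Y X) :
    ∃ U : ℝ → Fin q → ℝ, TendstoUniformlyOn
      (fun (n : ℕ) t => (n : ℝ) ^ 2 • (scheme f x₀ Y n t - X t)) U atTop (Icc 0 1) ∧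
      IsErrorSolution f y X U := by
  have h0 : (0 : ℝ) ∈ Icc (0 : ℝ) 1 := ⟨le_rfl, zero_le_one⟩
  have hf : ∀ i j, Continuous fun x => f x i j := fun i j => (hφ i j).continuous
  obtain ⟨C, hC0, hC⟩ := exists_error_bound hφ hM0 hM h hX
  have hy : ∀ j, IntervalIntegrable (fun s => y s j) volume 0 1 :=
    fun j => (h.integrable j).intervalIntegrable
  have hbi := intervalIntegrable_Df_mulVec (f := f) hφ hX.1 hy
  have hsq : Tendsto (fun n : ℕ => 1 / (n : ℝ) ^ 2) atTop (𝓝 0) :=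
    tendsto_const_nhds.div_atTop ((tendsto_pow_atTop (by norm_num)).comp
      tendsto_natCast_atTop_atTop)
  have hsmall : ∀ K ε : ℝ, 0 < ε → ∀ᶠ n : ℕ in atTop, K / (n : ℝ) ^ 2 ≤ ε := fun K ε hε => by
    have := hsq.const_mul K
    rw [mul_zero] at this
    filter_upwards [(tendsto_order.1 this).2 ε hε] with n hn
    rw [← mul_one_div]
    exact hn.le
  have hUc : ∀ ε > 0, ∀ᶠ n : ℕ in atTop, ∀ t ∈ Icc (0 : ℝ) 1, ‖scheme f x₀ Y n t - X t‖ ≤ ε := by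
    intro ε hε
    filter_upwards [hsmall C ε hε, eventually_gt_atTop 0] with n h1 hn t ht
    exact ((hC n hn).1 t ht).trans h1
  set T := ∫ r in (0 : ℝ)..1, mass y r with hT
  have hT0 : 0 ≤ T := intervalIntegral.integral_nonneg zero_le_one fun r _ => mass_nonneg y r
  have hN := N3_nonneg (mass y)
  set Z : ℝ → Fin q → ℝ := fun t i =>
    1 / 6 * ∑ j, ∫ s in (0 : ℝ)..t, (y s ⬝ᵥ ((G f i j (X s) * f (X s)) *ᵥ y s)) * y s j with hZ
  have htri : ∀ ε > 0, ∀ᶠ n : ℕ in atTop, ∀ i j l m, ∀ t ∈ Icc (0 : ℝ) 1,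
      |(∫ s in (0 : ℝ)..t, quad f i j (base f x₀ Y n s) l m *
          ((n : ℝ) ^ 2 * E n (fun r => y r l) (fun r => y r m) s) * y s j) -
        1 / 6 * ∫ s in (0 : ℝ)..t, quad f i j (X s) l m * (y s l * y s m * y s j)| ≤ ε := by
    intro ε hε
    simp only [eventually_all]
    intro i j l m
    exact tendsto_trilinear (h.integrable l) (h.integrable m) (h.cubic l) (h.cubic m) (h.cubic j)
      (c := fun n k => quad f i j (grid f x₀ Y n k) l m)
      ((continuous_quad hφ i j l m).comp_continuousOn hX.1)
      (fun ε hε => eventually_comp_close (continuous_quad hφ i j l m) hX.1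
        (fun ε hε => eventually_base_close hX.1 h hUc hε) hε) hε
  have hVc : ∀ᶠ n : ℕ in atTop,
      ContinuousOn (fun t => (n : ℝ) ^ 2 • (scheme f x₀ Y n t - X t)) (Icc 0 1) := by
    filter_upwards [eventually_gt_atTop 0] with n hn
    have : ContinuousOn (fun t => scheme f x₀ Y n t - X t) (Icc 0 1) :=
      (continuousOn_scheme h f x₀ hn).sub hX.1
    exact this.const_smul ((n : ℝ) ^ 2)
  obtain ⟨U, hU1, hU2, hU3⟩ := exists_volterra_limit
    (b := fun i s => Df f i (X s) *ᵥ y s) (Z := Z) hbi hVc fun ε hε => by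
      -- The density estimate `hmain` costs (T + 3 N3)η, and the d³ trilinear limits in `hPZ` cost η
      -- each.
      set η := ε / (T + 3 * N3 (mass y) + (d : ℝ) ^ 3 + 1) with hη
      have hηp : 0 < η := by positivity
      filter_upwards [htri η hηp, eventually_rate_expansion (x₀ := x₀) hφ hs hM0 hM h hηp,
        hsmall (M * C ^ 2) η hηp, eventually_gt_atTop 0, hVc] with n hn1 hn2 hn3 hn hVn t ht i
      have hn' : (0 : ℝ) < n := by exact_mod_cast hn
      have i1 := intervalIntegrable_sub
        ((intervalIntegrable_error (x₀ := x₀) h hf hX.1 hn i).const_mul ((n : ℝ) ^ 2)) h0 ht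
      have i2 := intervalIntegrable_sub (intervalIntegrable_dotProduct
        (b := fun i s => Df f i (X s) *ᵥ y s) hbi hVn i) h0 ht
      have i3 : ∀ j l m, IntervalIntegrable (fun s => quad f i j (base f x₀ Y n s) l m *
          ((n : ℝ) ^ 2 * E n (fun r => y r l) (fun r => y r m) s) * y s j) volume 0 t := by
        intro j l m
        have := intervalIntegrable_cell_mul hn (fun k => quad f i j (grid f x₀ Y n k) l m)
          (intervalIntegrable_E_mul hn (h.integrable l) (h.integrable m) (h.integrable j))
        refine (intervalIntegrable_sub this h0 ht).congr fun s _ => ?_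
        simp only [base, mul_assoc]
      have i3' : IntervalIntegrable (fun s => ∑ j, ∑ l, ∑ m, quad f i j (base f x₀ Y n s) l m *
          ((n : ℝ) ^ 2 * E n (fun r => y r l) (fun r => y r m) s) * y s j) volume 0 t :=
        intervalIntegrable_finset_sum fun j _ => intervalIntegrable_finset_sum fun l _ =>
          intervalIntegrable_finset_sum fun m _ => i3 j l m
      have eP : ∫ s in (0 : ℝ)..t, ∑ j, ∑ l, ∑ m, quad f i j (base f x₀ Y n s) l m *
          ((n : ℝ) ^ 2 * E n (fun r => y r l) (fun r => y r m) s) * y s j =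
          ∑ j, ∑ l, ∑ m, ∫ s in (0 : ℝ)..t, quad f i j (base f x₀ Y n s) l m *
          ((n : ℝ) ^ 2 * E n (fun r => y r l) (fun r => y r m) s) * y s j := by
        rw [intervalIntegral.integral_finsetSum fun j _ => intervalIntegrable_finset_sum fun l _ =>
          intervalIntegrable_finset_sum fun m _ => i3 j l m]
        refine Finset.sum_congr rfl fun j _ => ?_
        rw [intervalIntegral.integral_finsetSum fun l _ =>
          intervalIntegrable_finset_sum fun m _ => i3 j l m]
        refine Finset.sum_congr rfl fun l _ => ?_
        rw [intervalIntegral.integral_finsetSum fun m _ => i3 j l m]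
      have hPZ : |(∫ s in (0 : ℝ)..t, ∑ j, ∑ l, ∑ m, quad f i j (base f x₀ Y n s) l m *
          ((n : ℝ) ^ 2 * E n (fun r => y r l) (fun r => y r m) s) * y s j) - Z t i| ≤
          d ^ 3 * η := by
        rw [eP, hZ]
        simp only
        rw [source_eq_sum hφ hX.1 h ht i]
        simp only [← Finset.sum_sub_distrib]
        refine (Finset.abs_sum_le_sum_abs _ _).trans ?_
        calc _ ≤ ∑ _j : Fin d, ∑ _l : Fin d, ∑ _m : Fin d, η := Finset.sum_le_sum fun j _ =>
              (Finset.abs_sum_le_sum_abs _ _).trans (Finset.sum_le_sum fun l _ =>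
                (Finset.abs_sum_le_sum_abs _ _).trans (Finset.sum_le_sum fun m _ =>
                  hn1 i j l m t ht))
          _ = d ^ 3 * η := by simp; ring
      have hV : ((n : ℝ) ^ 2 • (scheme f x₀ Y n t - X t)) i =
          ∫ s in (0 : ℝ)..t, (n : ℝ) ^ 2 *
            ∑ j, (rate f x₀ Y y n i j s - f (X s) i j) * y s j := by
        rw [intervalIntegral.integral_const_mul, ← error_eq_integral h hf hX hn ht]
        simp
      have hmain : |(∫ s in (0 : ℝ)..t, ((n : ℝ) ^ 2 *
            ∑ j, (rate f x₀ Y y n i j s - f (X s) i j) * y s j -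
          ((n : ℝ) ^ 2 • (scheme f x₀ Y n s - X s)) ⬝ᵥ (Df f i (X s) *ᵥ y s) +
          ∑ j, ∑ l, ∑ m, quad f i j (base f x₀ Y n s) l m *
            ((n : ℝ) ^ 2 * E n (fun r => y r l) (fun r => y r m) s) * y s j))| ≤
          η * T + η * (3 * N3 (mass y)) := by
        have hig := (h.integrable_mass.intervalIntegrable (a := 0) (b := 1)).const_mul η
        have hiw := (intervalIntegrable_sq_W_mul_mass h hn).const_mul (η * (n : ℝ) ^ 2)
        refine (abs_integral_le_of_le ht.1 (g := fun s => η * mass y s +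
          η * (n : ℝ) ^ 2 * (W n (mass y) s ^ 2 * mass y s))
          (intervalIntegrable_sub (hig.add hiw) h0 ht) fun s hs => ?_).trans ?_
        · have hs' : s ∈ Ioc (0 : ℝ) 1 := ⟨hs.1, hs.2.trans ht.2⟩
          -- The residual density splits into the Taylor remainder of f at X along the error, which
          -- is O(n⁻⁴) before scaling, and the remainder in the expansion of the one-step defect.
          have e : (n : ℝ) ^ 2 * ∑ j, (rate f x₀ Y y n i j s - f (X s) i j) * y s j -
              ((n : ℝ) ^ 2 • (scheme f x₀ Y n s - X s)) ⬝ᵥ (Df f i (X s) *ᵥ y s) +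
              ∑ j, ∑ l, ∑ m, quad f i j (base f x₀ Y n s) l m *
                ((n : ℝ) ^ 2 * E n (fun r => y r l) (fun r => y r m) s) * y s j =
              ∑ j, (n : ℝ) ^ 2 * ((f (scheme f x₀ Y n s) i j - f (X s) i j -
                fderiv ℝ (fun z => f z i j) (X s) (scheme f x₀ Y n s - X s)) -
                (f (scheme f x₀ Y n s) i j - rate f x₀ Y y n i j s - ∑ l, ∑ m,
                  quad f i j (base f x₀ Y n s) l m *
                    E n (fun r => y r l) (fun r => y r m) s)) * y s j := by
            rw [dotProduct_Df_mulVec, Finset.mul_sum, ← Finset.sum_sub_distrib,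
              ← Finset.sum_add_distrib]
            refine Finset.sum_congr rfl fun j _ => ?_
            have e1 : ∑ l, ∑ m, quad f i j (base f x₀ Y n s) l m *
                ((n : ℝ) ^ 2 * E n (fun r => y r l) (fun r => y r m) s) * y s j =
                (n : ℝ) ^ 2 * (∑ l, ∑ m, quad f i j (base f x₀ Y n s) l m *
                    E n (fun r => y r l) (fun r => y r m) s) * y s j := by
              simp only [Finset.mul_sum, Finset.sum_mul]
              exact Finset.sum_congr rfl fun l _ => Finset.sum_congr rfl fun m _ => by ring
            rw [e1, map_smul, smul_eq_mul]
            ring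
          rw [e]
          have hb := abs_sum_mul_le_mass (y := y) (a := fun j => (n : ℝ) ^ 2 *
              ((f (scheme f x₀ Y n s) i j - f (X s) i j -
                fderiv ℝ (fun z => f z i j) (X s) (scheme f x₀ Y n s - X s)) -
                (f (scheme f x₀ Y n s) i j - rate f x₀ Y y n i j s - ∑ l, ∑ m,
                  quad f i j (base f x₀ Y n s) l m *
                    E n (fun r => y r l) (fun r => y r m) s)))
            (B := η + (n : ℝ) ^ 2 * (η * W n (mass y) s ^ 2)) (fun j => by
              have t1 := (hM i j).taylor (X s) (scheme f x₀ Y n s - X s)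
              rw [add_sub_cancel] at t1
              have t2 := hn2 i j s hs'
              have t3 := (hC n hn).1 s (Ioc_subset_Icc_self hs')
              have t4 : M * ‖scheme f x₀ Y n s - X s‖ ^ 2 ≤ M * (C / n ^ 2) ^ 2 := by gcongr
              have t5 : (n : ℝ) ^ 2 * (M * (C / n ^ 2) ^ 2) = M * C ^ 2 / n ^ 2 := by
                field_simp
              rw [abs_mul, abs_of_nonneg (by positivity : (0 : ℝ) ≤ (n : ℝ) ^ 2)]
              calc _ ≤ (n : ℝ) ^ 2 * (M * (C / n ^ 2) ^ 2 + η * W n (mass y) s ^ 2) := by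
                    refine mul_le_mul_of_nonneg_left ((abs_sub _ _).trans
                      (add_le_add (t1.trans t4) t2)) (by positivity)
                _ ≤ _ := by rw [mul_add, t5]; linarith) s
          refine hb.trans (le_of_eq ?_)
          ring
        · have p1 : ∀ s, 0 ≤ η * mass y s + η * (n : ℝ) ^ 2 * (W n (mass y) s ^ 2 * mass y s) :=
            fun s => by have := mass_nonneg y s; positivity
          refine (integral_le_of_subinterval (hig.add hiw) p1 le_rfl ht.1 ht.2).trans ?_
          rw [intervalIntegral.integral_add hig hiw, intervalIntegral.integral_const_mul,
            intervalIntegral.integral_const_mul]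
          have := integral_sq_W_mul_mass_le h hn
          rw [le_div_iff₀ (by positivity)] at this
          have h5 : η * (n : ℝ) ^ 2 * ∫ s in (0 : ℝ)..1, W n (mass y) s ^ 2 * mass y s ≤
              η * (3 * N3 (mass y)) := by
            calc _ = η * ((∫ s in (0 : ℝ)..1, W n (mass y) s ^ 2 * mass y s) * (n : ℝ) ^ 2) := by
                  ring
              _ ≤ _ := by gcongr
          linarith
      rw [intervalIntegral.integral_add (i1.sub i2) i3', intervalIntegral.integral_sub i1 i2,
        ← hV] at hmain
      have hε' : η * T + η * (3 * N3 (mass y)) + d ^ 3 * η ≤ ε := by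
        have : ε = η * (T + 3 * N3 (mass y) + (d : ℝ) ^ 3 + 1) := by rw [hη]; field_simp
        rw [this]; nlinarith
      have a1 := abs_le.1 hmain
      have a2 := abs_le.1 hPZ
      rw [abs_le]
      constructor <;> linarith [a1.1, a1.2, a2.1, a2.2]
  refine ⟨U, hU1, hU2, ?_, hU3⟩
  ext i
  rw [hU3 0 h0 i]
  simp [hZ]

end Limit

/-! ### Localisation to compactly supported coefficients -/

section Localisation

variable {q d : ℕ} {f : (Fin q → ℝ) → Matrix (Fin q) (Fin d) ℝ} {x₀ : Fin q → ℝ}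
  {Y y : ℝ → Fin d → ℝ} {X : ℝ → Fin q → ℝ}

/-- `f` and `g` agree near `x`. -/
def LocallyEq (f g : (Fin q → ℝ) → Matrix (Fin q) (Fin d) ℝ) (x : Fin q → ℝ) : Prop :=
  f =ᶠ[𝓝 x] g

variable {g : (Fin q → ℝ) → Matrix (Fin q) (Fin d) ℝ}

namespace LocallyEq

variable {x : Fin q → ℝ}

theorem entry (h : LocallyEq f g x) (i : Fin q) (j : Fin d) :
    (fun z => f z i j) =ᶠ[𝓝 x] fun z => g z i j := by
  filter_upwards [h] with z hz using by rw [hz]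

theorem partialD_eventuallyEq (h : LocallyEq f g x) (i k : Fin q) (j : Fin d) :
    partialD k (fun z => f z i j) =ᶠ[𝓝 x] partialD k fun z => g z i j := by
  filter_upwards [(h.entry i j).fderiv (𝕜 := ℝ)] with z hz
  rw [partialD, partialD, hz]

theorem Df_eq (h : LocallyEq f g x) (i : Fin q) : Df f i x = Df g i x := by
  ext k j
  exact (h.partialD_eventuallyEq i k j).eq_of_nhds

theorem hess_eq (h : LocallyEq f g x) (i : Fin q) (j : Fin d) :
    hess (fun z => f z i j) x = hess (fun z => g z i j) x := by
  ext k l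
  change fderiv ℝ _ x _ = fderiv ℝ _ x _
  rw [(h.partialD_eventuallyEq i k j).fderiv_eq]

theorem G_eq (h : LocallyEq f g x) (i : Fin q) (j : Fin d) : G f i j x = G g i j x := by
  rw [G, G, h.eq_of_nhds, h.hess_eq]
  congr 1
  refine Finset.sum_congr rfl fun k _ => ?_
  rw [h.Df_eq, (h.partialD_eventuallyEq i k j).eq_of_nhds]

theorem step_eq (h : LocallyEq f g x) (Y : ℝ → Fin d → ℝ) (a t : ℝ) :
    step f Y x a t = step g Y x a t := by
  ext i
  rw [step, step, h.eq_of_nhds, h.Df_eq]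

end LocallyEq

theorem IsSolution.congr (hX : IsSolution f x₀ Y X) (h : ∀ s ∈ Icc (0 : ℝ) 1, f (X s) = g (X s)) :
    IsSolution g x₀ Y X := by
  refine ⟨hX.1, fun t ht i => ?_⟩
  rw [hX.2 t ht i]
  congr 1
  exact Finset.sum_congr rfl fun j _ => stieltjes_congr
    (fun s hs => by simp only [h s ⟨hs.1.le, hs.2.trans ht.2⟩]) fun _ _ => rfl

theorem IsErrorSolution.congr {y' : ℝ → Fin d → ℝ} {U : ℝ → Fin q → ℝ}
    (hU : IsErrorSolution f y X U) (h : ∀ s ∈ Icc (0 : ℝ) 1, LocallyEq f g (X s))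
    (hy : EqOn y y' (Icc 0 1)) : IsErrorSolution g y' X U := by
  refine ⟨hU.1, hU.2.1, fun t ht i => ?_⟩
  have hm : ∀ s ∈ Ioc 0 t, s ∈ Icc (0 : ℝ) 1 := fun s hs => ⟨hs.1.le, hs.2.trans ht.2⟩
  rw [hU.2.2 t ht i]
  congr 1
  · refine integral_congr_Ioc ht.1 fun s hs => ?_
    rw [(h s (hm s hs)).Df_eq, hy (hm s hs)]
  · congr 1
    refine Finset.sum_congr rfl fun j _ => integral_congr_Ioc ht.1 fun s hs => ?_
    rw [(h s (hm s hs)).G_eq, (h s (hm s hs)).eq_of_nhds, hy (hm s hs)]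

/-- A step uses derivatives of the coefficient, hence agreement near the grid points. It is required
only along the grid of f and carries over step by step. -/
theorem grid_congr {n : ℕ} (h : ∀ k < n, LocallyEq f g (grid f x₀ Y n k)) :
    ∀ k ≤ n, grid f x₀ Y n k = grid g x₀ Y n k := by
  intro k hk
  induction k with
  | zero => rfl
  | succ k ih =>
    rw [grid, grid, ← ih (by omega), (h k (by omega)).step_eq]

theorem scheme_congr {n : ℕ} (hn : 0 < n) (h : ∀ k < n, LocallyEq f g (grid f x₀ Y n k)) :
    EqOn (scheme f x₀ Y n) (scheme g x₀ Y n) (Icc 0 1) := by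
  intro t ht
  have hc : cell n t < n := by
    rcases ht.1.eq_or_lt with h0 | h0
    · rwa [← h0, cell_zero]
    · exact cell_lt hn ⟨h0, ht.2⟩
  rw [scheme_eq_step, scheme_eq_step, base, base, ← grid_congr h _ hc.le, (h _ hc).step_eq]

theorem grid_eq_scheme (h : IsPrimitive Y y) (f : (Fin q → ℝ) → Matrix (Fin q) (Fin d) ℝ)
    (x₀ : Fin q → ℝ) {n k : ℕ} (hn : 0 < n) (hk : k ≤ n) :
    (k : ℝ) / n ∈ Icc (0 : ℝ) 1 ∧ grid f x₀ Y n k = scheme f x₀ Y n ((k : ℝ) / n) := by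
  have hn' : (0 : ℝ) < n := by exact_mod_cast hn
  have hm : (k : ℝ) / n ∈ Icc (0 : ℝ) 1 :=
    ⟨by positivity, (div_le_one hn').2 (by exact_mod_cast hk)⟩
  refine ⟨hm, ?_⟩
  ext i
  rw [grid_eq_integral h f x₀ hn i hk, scheme_eq_integral h f x₀ hn hm]

/-- A `C²` coefficient agrees on a given ball with one of compact support. -/
theorem exists_compact_support_coefficient (hφ : ∀ i j, ContDiff ℝ 2 fun x => f x i j) (R : ℝ) :
    ∃ g : (Fin q → ℝ) → Matrix (Fin q) (Fin d) ℝ, (∀ i j, ContDiff ℝ 2 fun x => g x i j) ∧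
      (∀ i j, HasCompactSupport fun x => g x i j) ∧ ∀ x, ‖x‖ ≤ R → LocallyEq g f x := by
  let χ : ContDiffBump (0 : Fin q → ℝ) := ⟨|R| + 1, |R| + 2, by positivity, by linarith⟩
  refine ⟨fun x => χ x • f x, fun i j => ?_, fun i j => ?_, fun x hx => ?_⟩
  · exact (χ.contDiff (n := 2)).mul (hφ i j)
  · exact χ.hasCompactSupport.mul_right (f' := fun x => f x i j)
  · have hball : Metric.ball (0 : Fin q → ℝ) (|R| + 1) ∈ 𝓝 x := by
      refine Metric.isOpen_ball.mem_nhds ?_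
      rw [mem_ball_zero_iff]
      linarith [le_abs_self R]
    filter_upwards [hball] with z hz
    have : χ z = 1 := χ.one_of_mem_closedBall (Metric.ball_subset_closedBall hz)
    rw [this, one_smul]

theorem exists_common_tameBound (hφ : ∀ i j, ContDiff ℝ 2 fun x => f x i j)
    (hs : ∀ i j, HasCompactSupport fun x => f x i j) :
    ∃ M, 0 ≤ M ∧ ∀ i j, TameBound (fun x => f x i j) M := by
  choose M hM using fun i j => exists_tameBound (hφ i j) (hs i j)
  refine ⟨∑ i, ∑ j, M i j, Finset.sum_nonneg fun i _ => Finset.sum_nonneg fun j _ =>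
    (hM i j).nonneg, fun i j => (hM i j).mono ?_⟩
  exact (Finset.single_le_sum (f := fun j => M i j) (fun j _ => (hM i j).nonneg)
    (Finset.mem_univ j)).trans (Finset.single_le_sum (f := fun i => ∑ j, M i j)
      (fun i _ => Finset.sum_nonneg fun j _ => (hM i j).nonneg) (Finset.mem_univ i))

/-- A solution also solves the equation with a tame coefficient whose scheme is eventually the
same. -/
theorem exists_tame_coefficient (hφ : ∀ i j, ContDiff ℝ 2 fun x => f x i j) (h : IsPrimitive Y y)
    (hX : IsSolution f x₀ Y X) :
    ∃ g : (Fin q → ℝ) → Matrix (Fin q) (Fin d) ℝ, ∃ M, (∀ i j, ContDiff ℝ 2 fun x => g x i j) ∧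
      (∀ i j, HasCompactSupport fun x => g x i j) ∧ 0 ≤ M ∧
      (∀ i j, TameBound (fun x => g x i j) M) ∧ IsSolution g x₀ Y X ∧
      (∀ s ∈ Icc (0 : ℝ) 1, LocallyEq g f (X s)) ∧
      ∀ᶠ n in atTop, EqOn (scheme g x₀ Y n) (scheme f x₀ Y n) (Icc 0 1) := by
  obtain ⟨R, hR⟩ := (isCompact_Icc.image_of_continuousOn hX.1).isBounded.subset_closedBall 0
  have hXR : ∀ s ∈ Icc (0 : ℝ) 1, ‖X s‖ ≤ R := fun s hs => by
    have := hR ⟨s, hs, rfl⟩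
    rwa [mem_closedBall_zero_iff] at this
  -- The extra radius 1 leaves room for the error of the scheme around X.
  obtain ⟨g, hg1, hg2, hg3⟩ := exists_compact_support_coefficient hφ (R + 1)
  obtain ⟨M, hM0, hM⟩ := exists_common_tameBound hg1 hg2
  have hloc : ∀ s ∈ Icc (0 : ℝ) 1, LocallyEq g f (X s) := fun s hs =>
    hg3 _ (by linarith [hXR s hs])
  have hXg : IsSolution g x₀ Y X := hX.congr fun s hs => ((hloc s hs).eq_of_nhds).symm
  refine ⟨g, M, hg1, hg2, hM0, hM, hXg, hloc, ?_⟩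
  obtain ⟨C, hC0, hC⟩ := exists_error_bound hg1 hM0 hM h hXg
  -- Then C/n² ≤ 1, so the grid of g stays in the ball where g is f, and both schemes take the same
  -- steps.
  filter_upwards [eventually_ge_atTop (⌈C⌉₊ + 1)] with n hn
  have hn0 : 0 < n := by omega
  have hn' : (1 : ℝ) ≤ n := by exact_mod_cast hn0
  have hCn : C ≤ n := (Nat.le_ceil C).trans (by exact_mod_cast (by omega : ⌈C⌉₊ ≤ n))
  refine scheme_congr hn0 fun k hk => hg3 _ ?_
  obtain ⟨hm, e⟩ := grid_eq_scheme h g x₀ hn0 hk.le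
  have h1 := (hC n hn0).1 _ hm
  have h2 : C / (n : ℝ) ^ 2 ≤ 1 := by
    rw [div_le_one (by positivity)]
    nlinarith
  have h3 := norm_add_le (scheme g x₀ Y n ((k : ℝ) / n) - X ((k : ℝ) / n)) (X ((k : ℝ) / n))
  rw [sub_add_cancel] at h3
  rw [e]
  linarith [hXR _ hm]

theorem exists_variation_bound (hφ : ∀ i j, ContDiff ℝ 2 fun x => f x i j) (h : IsPrimitive Y y)
    (hX : IsSolution f x₀ Y X) :
    ∃ C : NNReal, ∀ n : ℕ, 1 ≤ n →
      (n : ENNReal) ^ 2 * eVariationOn (fun t => scheme f x₀ Y n t - X t) (Icc 0 1) ≤ C := by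
  obtain ⟨g, M, hg1, hg2, hM0, hM, hXg, hloc, hev⟩ := exists_tame_coefficient hφ h hX
  obtain ⟨C, hC0, hC⟩ := exists_error_bound hg1 hM0 hM h hXg
  obtain ⟨N, hN⟩ := eventually_atTop.1 hev
  have hf : ∀ i j, Continuous fun x => f x i j := fun i j => (hφ i j).continuous
  set v : ℕ → ENNReal := fun n =>
    (n : ENNReal) ^ 2 * eVariationOn (fun t => scheme f x₀ Y n t - X t) (Icc 0 1) with hv
  have hfin : ∀ n, 0 < n → v n ≠ ⊤ := fun n hn => ENNReal.mul_ne_top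
    (ENNReal.pow_ne_top (ENNReal.natCast_ne_top n)) (exists_variation_bound_single h hf hX hn).ne
  -- For the finitely many n below N the two schemes may differ; there finiteness of each variation
  -- is enough.
  refine ⟨C.toNNReal + ∑ n ∈ Finset.range N, (v n).toNNReal, fun n hn => ?_⟩
  rcases lt_or_ge n N with hlt | hge
  · change v n ≤ _
    rw [← ENNReal.coe_toNNReal (hfin n hn)]
    refine ENNReal.coe_le_coe.2 ?_
    exact (Finset.single_le_sum (f := fun n => (v n).toNNReal) (fun _ _ => zero_le)
      (Finset.mem_range.2 hlt)).trans le_add_self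
  · have hn' : (0 : ℝ) < n := by exact_mod_cast hn
    have e : eVariationOn (fun t => scheme f x₀ Y n t - X t) (Icc 0 1) =
        eVariationOn (fun t => scheme g x₀ Y n t - X t) (Icc 0 1) :=
      eVariationOn.congr fun t ht => by simp only [hN n hge ht]
    rw [e]
    calc _ ≤ (n : ENNReal) ^ 2 * ENNReal.ofReal (C / n ^ 2) := by gcongr; exact (hC n hn).2
      _ = ENNReal.ofReal ((n : ℝ) ^ 2 * (C / n ^ 2)) := by
          rw [ENNReal.ofReal_mul (by positivity), ENNReal.ofReal_pow hn'.le, ENNReal.ofReal_natCast]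
      _ = ENNReal.ofReal C := by congr 1; field_simp
      _ ≤ _ := by
          rw [ENNReal.ofReal]
          exact ENNReal.coe_le_coe.2 le_self_add

theorem exists_limit (hφ : ∀ i j, ContDiff ℝ 2 fun x => f x i j) (h : IsPrimitive Y y)
    (hX : IsSolution f x₀ Y X) :
    ∃ U : ℝ → Fin q → ℝ, TendstoUniformlyOn
      (fun (n : ℕ) t => (n : ℝ) ^ 2 • (scheme f x₀ Y n t - X t)) U atTop (Icc 0 1) ∧
      IsErrorSolution f y X U := by
  obtain ⟨g, M, hg1, hg2, hM0, hM, hXg, hloc, hev⟩ := exists_tame_coefficient hφ h hX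
  obtain ⟨U, hU1, hU2⟩ := exists_errorSolution_limit hg1 hg2 hM0 hM h hXg
  refine ⟨U, hU1.congr ?_, hU2.congr hloc fun _ _ => rfl⟩
  filter_upwards [hev] with n hn t ht
  simp only [hn ht]

/-- Extension of the density by 0 makes it integrable on the whole line without changing Y on [0,1].
-/
theorem isPrimitive_indicator (hy : ∀ l, MemLp (fun s => y s l) 3 (volume.restrict (Icc 0 1)))
    (hY : ∀ t ∈ Icc (0 : ℝ) 1, ∀ l, Y t l = ∫ s in (0 : ℝ)..t, y s l) :
    IsPrimitive Y ((Icc (0 : ℝ) 1).indicator y) := by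
  have e : ∀ l, (fun s => (Icc (0 : ℝ) 1).indicator y s l) =
      (Icc (0 : ℝ) 1).indicator fun s => y s l := fun l => by
    ext s
    by_cases hs : s ∈ Icc (0 : ℝ) 1 <;> simp [hs]
  refine ⟨fun l => ?_, fun l => ?_, fun t ht l => ?_⟩
  · rw [e, integrable_indicator_iff measurableSet_Icc]
    exact (hy l).integrable (by norm_num)
  · rw [e]
    exact ((memLp_indicator_iff_restrict measurableSet_Icc).2 (hy l)).mono_measure
      Measure.restrict_le_self
  · rw [hY t ht l]
    refine integral_congr_Ioc ht.1 fun s hs => ?_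
    have hm : s ∈ Icc (0 : ℝ) 1 := ⟨hs.1.le, hs.2.trans ht.2⟩
    rw [indicator_of_mem hm]

end Localisation

/-! ### Paths with small cubed increments -/

section CubicIncrements

variable {p : ℝ → ℝ} {C : ℝ}

theorem le_cube_div_add {x μ : ℝ} (hx : 0 ≤ x) (hμ : 0 < μ) : x ≤ x ^ 3 / μ ^ 2 + μ := by
  rcases le_total x μ with h | h
  · have : 0 ≤ x ^ 3 / μ ^ 2 := by positivity
    linarith
  · have : x ≤ x ^ 3 / μ ^ 2 := by
      rw [le_div_iff₀ (by positivity)]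
      calc x * μ ^ 2 ≤ x * x ^ 2 := by gcongr
        _ = x ^ 3 := by ring
    linarith

/-- Round the end points down to the grid and split x ≤ x³/μ² + μ for x = n|Δ|: the cubes are
bounded in total by C, and μ is paid per unit of length. -/
theorem sum_dist_grid_le
    (hC : ∀ n : ℕ, 1 ≤ n →
      (n : ℝ) ^ 2 * ∑ k ∈ Finset.range n, |p (((k : ℝ) + 1) / n) - p ((k : ℝ) / n)| ^ 3 ≤ C)
    {μ : ℝ} (hμ : 0 < μ) {m : ℕ} {a b : ℕ → ℝ}
    (hab : ∀ i ∈ Finset.range m, 0 ≤ a i ∧ a i ≤ b i ∧ b i ≤ 1)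
    (hd : (Finset.range m : Set ℕ).PairwiseDisjoint fun i => Ioc (a i) (b i))
    {n : ℕ} (hn : 1 ≤ n) :
    ∑ i ∈ Finset.range m, dist (p (⌊a i * n⌋₊ / n)) (p (⌊b i * n⌋₊ / n)) ≤
      C / μ ^ 2 + μ * ∑ i ∈ Finset.range m, ((⌊b i * n⌋₊ / n : ℝ) - ⌊a i * n⌋₊ / n) := by
  have hn' : (0 : ℝ) < n := by exact_mod_cast hn
  set D : ℕ → ℝ := fun k => |p (((k : ℝ) + 1) / n) - p ((k : ℝ) / n)| with hD
  set S : ℕ → Finset ℕ := fun i => Finset.Ico ⌊a i * n⌋₊ ⌊b i * n⌋₊ with hS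
  have hfl : ∀ {x z : ℝ}, x ≤ z → ⌊x * n⌋₊ ≤ ⌊z * n⌋₊ := fun h =>
    Nat.floor_le_floor (mul_le_mul_of_nonneg_right h hn'.le)
  -- Floors are monotone, so disjoint intervals use disjoint sets of cells.
  have hSd : (Finset.range m : Set ℕ).PairwiseDisjoint S := by
    intro i hi j hj hij
    have := hd hi hj hij
    simp only [Function.onFun, Ioc_disjoint_Ioc] at this
    rw [Function.onFun, Finset.disjoint_left]
    intro k hk hk'
    rw [hS, Finset.mem_Ico] at hk hk'
    rcases le_total (b i) (b j) with h1 | h1 <;> rcases le_total (a i) (a j) with h2 | h2 <;>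
      simp only [h1, h2, min_eq_left, min_eq_right, max_eq_left, max_eq_right] at this <;>
      have := hfl this <;> omega
  have hsub : (Finset.range m).biUnion S ⊆ Finset.range n := by
    intro k hk
    obtain ⟨i, hi, hk⟩ := Finset.mem_biUnion.1 hk
    rw [hS, Finset.mem_Ico] at hk
    rw [Finset.mem_range]
    refine hk.2.trans_le ?_
    have := Nat.floor_le_floor (mul_le_mul_of_nonneg_right (hab i hi).2.2 hn'.le)
    rwa [one_mul, Nat.floor_natCast] at this
  have hDk : ∀ k, D k ≤ (n : ℝ) ^ 2 * D k ^ 3 / μ ^ 2 + μ / n := by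
    intro k
    have h0 : 0 ≤ D k := abs_nonneg _
    have := le_cube_div_add (x := n * D k) (by positivity) hμ
    calc D k = n * D k / n := by field_simp
      _ ≤ ((n * D k) ^ 3 / μ ^ 2 + μ) / n := by gcongr
      _ = _ := by field_simp
  calc ∑ i ∈ Finset.range m, dist (p (⌊a i * n⌋₊ / n)) (p (⌊b i * n⌋₊ / n))
      ≤ ∑ i ∈ Finset.range m, ∑ k ∈ S i, D k := by
        refine Finset.sum_le_sum fun i hi => ?_
        refine (dist_le_Ico_sum_dist (fun k : ℕ => p ((k : ℝ) / n)) (hfl (hab i hi).2.1)).trans ?_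
        refine Finset.sum_le_sum fun k _ => ?_
        rw [dist_comm, Real.dist_eq]
        push_cast
        exact le_rfl
    _ ≤ ∑ i ∈ Finset.range m, ∑ k ∈ S i, ((n : ℝ) ^ 2 * D k ^ 3 / μ ^ 2 + μ / n) :=
        Finset.sum_le_sum fun i _ => Finset.sum_le_sum fun k _ => hDk k
    _ = (∑ k ∈ (Finset.range m).biUnion S, (n : ℝ) ^ 2 * D k ^ 3 / μ ^ 2) +
        μ * ∑ i ∈ Finset.range m, ((⌊b i * n⌋₊ / n : ℝ) - ⌊a i * n⌋₊ / n) := by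
        simp only [Finset.sum_add_distrib]
        rw [Finset.sum_biUnion hSd, Finset.mul_sum]
        congr 1
        refine Finset.sum_congr rfl fun i hi => ?_
        rw [Finset.sum_const, Nat.card_Ico, nsmul_eq_mul, Nat.cast_sub (hfl (hab i hi).2.1)]
        ring
    _ ≤ C / μ ^ 2 + μ * ∑ i ∈ Finset.range m, ((⌊b i * n⌋₊ / n : ℝ) - ⌊a i * n⌋₊ / n) := by
        refine add_le_add_left ?_ _
        refine (Finset.sum_le_sum_of_subset_of_nonneg hsub fun k _ _ => ?_).trans ?_
        · have : 0 ≤ D k := abs_nonneg _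
          positivity
        · rw [← Finset.sum_div, ← Finset.mul_sum]
          exact div_le_div_of_nonneg_right (hC n hn) (by positivity)

theorem tendsto_grid_floor {x : ℝ} (hx : 0 ≤ x) :
    Tendsto (fun n : ℕ => (⌊x * n⌋₊ / n : ℝ)) atTop (𝓝 x) :=
  (tendsto_nat_floor_mul_div_atTop hx).comp tendsto_natCast_atTop_atTop

/-- Limit of the grid estimate: rounded points converge to the given ones and p is continuous. -/
theorem sum_dist_le_of_cubic_increments (hp : ContinuousOn p (Icc 0 1))
    (hC : ∀ n : ℕ, 1 ≤ n →
      (n : ℝ) ^ 2 * ∑ k ∈ Finset.range n, |p (((k : ℝ) + 1) / n) - p ((k : ℝ) / n)| ^ 3 ≤ C)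
    {μ : ℝ} (hμ : 0 < μ) {m : ℕ} {a b : ℕ → ℝ}
    (hab : ∀ i ∈ Finset.range m, 0 ≤ a i ∧ a i ≤ b i ∧ b i ≤ 1)
    (hd : (Finset.range m : Set ℕ).PairwiseDisjoint fun i => Ioc (a i) (b i)) :
    ∑ i ∈ Finset.range m, dist (p (a i)) (p (b i)) ≤
      C / μ ^ 2 + μ * ∑ i ∈ Finset.range m, (b i - a i) := by
  have hlim : ∀ x ∈ Icc (0 : ℝ) 1, Tendsto (fun n : ℕ => p (⌊x * n⌋₊ / n)) atTop (𝓝 (p x)) := by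
    intro x hx
    refine (hp x hx).tendsto.comp (tendsto_nhdsWithin_iff.2 ⟨tendsto_grid_floor hx.1, ?_⟩)
    filter_upwards [eventually_gt_atTop 0] with n hn
    have hn' : (0 : ℝ) < n := by exact_mod_cast hn
    refine ⟨by positivity, (div_le_one hn').2 ?_⟩
    exact (Nat.floor_le (mul_nonneg hx.1 hn'.le)).trans (mul_le_of_le_one_left hn'.le hx.2)
  refine le_of_tendsto_of_tendsto (tendsto_finsetSum _ fun i hi =>
    (hlim (a i) ⟨(hab i hi).1, (hab i hi).2.1.trans (hab i hi).2.2⟩).dist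
      (hlim (b i) ⟨(hab i hi).1.trans (hab i hi).2.1, (hab i hi).2.2⟩))
    (tendsto_const_nhds.add (tendsto_const_nhds.mul (tendsto_finsetSum _ fun i hi =>
      (tendsto_grid_floor ((hab i hi).1.trans (hab i hi).2.1)).sub
        (tendsto_grid_floor (hab i hi).1)))) ?_
  filter_upwards [eventually_ge_atTop 1] with n hn
  exact sum_dist_grid_le hC hμ hab hd hn

theorem absolutelyContinuous_of_cubic_increments (hp : ContinuousOn p (Icc 0 1))
    (hC : ∀ n : ℕ, 1 ≤ n →
      (n : ℝ) ^ 2 * ∑ k ∈ Finset.range n, |p (((k : ℝ) + 1) / n) - p ((k : ℝ) / n)| ^ 3 ≤ C) :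
    AbsolutelyContinuousOnInterval p 0 1 := by
  have hC0 : 0 ≤ C := le_trans (by positivity) (hC 1 le_rfl)
  rw [absolutelyContinuousOnInterval_iff]
  intro ε hε
  -- This makes C/μ² at most ε/3; with total length below ε/(3μ) the other term is at most ε/3 too.
  set μ := 1 + 3 * C / ε with hμ
  have hμ1 : 1 ≤ μ := by
    have : 0 ≤ 3 * C / ε := by positivity
    linarith
  have hμ0 : 0 < μ := by linarith
  refine ⟨ε / (3 * μ), by positivity, fun ⟨m, I⟩ hE hlt => ?_⟩
  obtain ⟨h1, h2⟩ := hE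
  simp only at h1 h2 hlt ⊢
  rw [uIcc_of_le zero_le_one] at h1
  -- Absolute continuity is tested on unordered pairs, which are sorted first.
  have key := sum_dist_le_of_cubic_increments hp hC hμ0 (m := m)
    (a := fun i => min (I i).1 (I i).2) (b := fun i => max (I i).1 (I i).2)
    (fun i hi => ⟨le_min (h1 i hi).1.1 (h1 i hi).2.1, min_le_max,
      max_le (h1 i hi).1.2 (h1 i hi).2.2⟩) h2
  have e1 : ∀ i, dist (p (min (I i).1 (I i).2)) (p (max (I i).1 (I i).2)) =
      dist (p (I i).1) (p (I i).2) := fun i => by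
    rcases le_total (I i).1 (I i).2 with h | h
    · rw [min_eq_left h, max_eq_right h]
    · rw [min_eq_right h, max_eq_left h, dist_comm]
  have e2 : ∀ i, max (I i).1 (I i).2 - min (I i).1 (I i).2 = dist (I i).1 (I i).2 := fun i => by
    rw [Real.dist_eq, max_sub_min_eq_abs']
  simp only [e1, e2] at key
  have s1 : C / μ ^ 2 ≤ ε / 3 := by
    rw [div_le_iff₀ (by positivity)]
    have h3 : 3 * C ≤ ε * μ := by
      rw [hμ, mul_add, mul_div_cancel₀ _ hε.ne']; linarith
    have h4 : ε * μ ≤ ε * μ ^ 2 := by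
      gcongr
      nlinarith
    linarith
  have s2 : μ * ∑ i ∈ Finset.range m, dist (I i).1 (I i).2 ≤ ε / 3 := by
    calc _ ≤ μ * (ε / (3 * μ)) := by gcongr
      _ = ε / 3 := by field_simp
  linarith

/-- Difference quotient of `p` over the grid interval that contains `s`. -/
def quotient (p : ℝ → ℝ) (n : ℕ) (s : ℝ) : ℝ :=
  n * (p (((cell n s : ℝ) + 1) / n) - p ((cell n s : ℝ) / n))

theorem measurable_quotient (p : ℝ → ℝ) (n : ℕ) : Measurable (quotient p n) :=
  measurable_of_cell n fun k => n * (p (((k : ℝ) + 1) / n) - p ((k : ℝ) / n))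

theorem integral_cube_quotient {n : ℕ} (hn : 1 ≤ n) :
    IntervalIntegrable (fun s => |quotient p n s| ^ 3) volume 0 1 ∧
    ∫ s in (0 : ℝ)..1, |quotient p n s| ^ 3 =
      (n : ℝ) ^ 2 * ∑ k ∈ Finset.range n, |p (((k : ℝ) + 1) / n) - p ((k : ℝ) / n)| ^ 3 := by
  have hn' : (0 : ℝ) < n := by exact_mod_cast hn
  have hi : IntervalIntegrable (fun s => |quotient p n s| ^ 3) volume 0 1 :=
    intervalIntegrable_of_cell hn fun k => |n * (p (((k : ℝ) + 1) / n) - p ((k : ℝ) / n))| ^ 3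
  refine ⟨hi, ?_⟩
  have e := integral_eq_sum_cells hn hi le_rfl
  rw [div_self hn'.ne'] at e
  rw [e, Finset.mul_sum]
  refine Finset.sum_congr rfl fun k _ => ?_
  have : ∫ s in ((k : ℝ) / n)..(((k : ℝ) + 1) / n), |quotient p n s| ^ 3 =
      ∫ _s in ((k : ℝ) / n)..(((k : ℝ) + 1) / n),
        |n * (p (((k : ℝ) + 1) / n) - p ((k : ℝ) / n))| ^ 3 :=
    integral_congr_Ioc cell_le fun s hs => by rw [quotient, cell_eq hn hs.1 hs.2]
  rw [this, intervalIntegral.integral_const, cell_length, smul_eq_mul, abs_mul, mul_pow,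
    abs_of_pos hn']
  field_simp

/-- The cell contains s, so the distances of its end points from s add up to its length and the two
first order errors are o(1/n) together. -/
theorem tendsto_quotient {s y : ℝ} (hs : s ∈ Ioc (0 : ℝ) 1) (h : HasDerivAt p y s) :
    Tendsto (fun n => quotient p n s) atTop (𝓝 y) := by
  rw [Metric.tendsto_atTop']
  intro ε hε
  have hb := (hasDerivAt_iff_isLittleO.1 h).def (half_pos hε)
  obtain ⟨δ, hδ, hball⟩ := Metric.eventually_nhds_iff.1 hb
  have ht : ∀ᶠ n : ℕ in atTop, 1 / (n : ℝ) < δ :=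
    (tendsto_order.1 tendsto_one_div_atTop_nhds_zero_nat).2 δ hδ
  obtain ⟨N, hN⟩ := eventually_atTop.1 (ht.and (eventually_gt_atTop 0))
  refine ⟨N, fun n hn => ?_⟩
  obtain ⟨h1, hn0⟩ := hN n hn.le
  have hn' : (0 : ℝ) < n := by exact_mod_cast hn0
  obtain ⟨k, hk, e1, e2, e3⟩ := exists_cell hn0 hs.1 hs.2
  have hlen : ((k : ℝ) + 1) / n - (k : ℝ) / n = 1 / n := cell_length
  set a := (k : ℝ) / n with ha
  set b := ((k : ℝ) + 1) / n with hb
  have da : dist a s < δ := by rw [Real.dist_eq, abs_lt]; constructor <;> linarith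
  have db : dist b s < δ := by rw [Real.dist_eq, abs_lt]; constructor <;> linarith
  have ba := hball da
  have bb := hball db
  simp only [Real.norm_eq_abs, smul_eq_mul] at ba bb
  rw [abs_of_nonpos (by linarith : a - s ≤ 0)] at ba
  rw [abs_of_nonneg (by linarith : 0 ≤ b - s)] at bb
  have hq : |p b - p a - (b - a) * y| ≤ ε / 2 * (b - a) := by
    rw [abs_le] at ba bb ⊢
    constructor <;> linarith [ba.1, ba.2, bb.1, bb.2]
  rw [Real.dist_eq, quotient, e3, ← ha, ← hb]
  have e : n * (p b - p a) - y = n * (p b - p a - (b - a) * y) := by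
    rw [hlen]; field_simp
  rw [e, abs_mul, abs_of_pos hn']
  calc n * |p b - p a - (b - a) * y| ≤ n * (ε / 2 * (b - a)) := by gcongr
    _ = ε / 2 := by rw [hlen]; field_simp
    _ < ε := by linarith

/-- A continuous path whose cubed grid increments are of order `n⁻²` is the primitive of its
derivative, which is cube integrable. -/
theorem deriv_of_cubic_increments (hp : ContinuousOn p (Icc 0 1))
    (hC : ∀ n : ℕ, 1 ≤ n →
      (n : ℝ) ^ 2 * ∑ k ∈ Finset.range n, |p (((k : ℝ) + 1) / n) - p ((k : ℝ) / n)| ^ 3 ≤ C) :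
    MemLp (deriv p) 3 (volume.restrict (Icc 0 1)) ∧
      (∀ t ∈ Icc (0 : ℝ) 1, p t = p 0 + ∫ s in (0 : ℝ)..t, deriv p s) ∧
      ∀ᵐ s ∂(volume.restrict (Icc (0 : ℝ) 1)), DifferentiableAt ℝ p s := by
  have hac := absolutelyContinuous_of_cubic_increments hp hC
  have hdiff := hac.ae_differentiableAt
  rw [uIcc_of_le zero_le_one] at hdiff
  have hdiff' : ∀ᵐ s ∂(volume.restrict (Icc (0 : ℝ) 1)), DifferentiableAt ℝ p s :=
    (ae_restrict_iff' measurableSet_Icc).2 hdiff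
  refine ⟨?_, fun t ht => ?_, hdiff'⟩
  · rw [← restrict_Ioc_eq_restrict_Icc] at hdiff' ⊢
    have hlim : ∀ᵐ s ∂(volume.restrict (Ioc (0 : ℝ) 1)),
        Tendsto (fun n => ENNReal.ofReal (|quotient p n s| ^ 3)) atTop
          (𝓝 (ENNReal.ofReal (|deriv p s| ^ 3))) := by
      filter_upwards [hdiff', ae_restrict_mem measurableSet_Ioc] with s hs hm
      exact (ENNReal.continuous_ofReal.tendsto _).comp
        (((tendsto_quotient hm hs.hasDerivAt).abs).pow 3)
    -- Fatou's lemma: the cubed difference quotients converge almost everywhere and their integrals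
    -- are the scaled sums bounded by C.
    have hfatou : ∫⁻ s in Ioc (0 : ℝ) 1, ENNReal.ofReal (|deriv p s| ^ 3) ≤ ENNReal.ofReal C := by
      calc ∫⁻ s in Ioc (0 : ℝ) 1, ENNReal.ofReal (|deriv p s| ^ 3)
          = ∫⁻ s in Ioc (0 : ℝ) 1, liminf (fun n => ENNReal.ofReal (|quotient p n s| ^ 3)) atTop :=
            lintegral_congr_ae (hlim.mono fun s hs => hs.liminf_eq.symm)
        _ ≤ liminf (fun n => ∫⁻ s in Ioc (0 : ℝ) 1, ENNReal.ofReal (|quotient p n s| ^ 3)) atTop :=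
            lintegral_liminf_le fun n =>
              ((measurable_quotient p n).abs.pow_const 3).ennreal_ofReal
        _ ≤ liminf (fun _ : ℕ => ENNReal.ofReal C) atTop := by
            refine liminf_le_liminf ?_
            filter_upwards [eventually_ge_atTop 1] with n hn
            obtain ⟨hi, e⟩ := integral_cube_quotient (p := p) hn
            rw [intervalIntegrable_iff_integrableOn_Ioc_of_le zero_le_one] at hi
            rw [intervalIntegral.integral_of_le zero_le_one] at e
            rw [← ofReal_integral_eq_lintegral_ofReal hi
              (Eventually.of_forall fun s => by positivity), e]
            exact ENNReal.ofReal_le_ofReal (hC n hn)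
        _ = ENNReal.ofReal C := liminf_const _
    have hm : AEStronglyMeasurable (deriv p) (volume.restrict (Ioc (0 : ℝ) 1)) :=
      (measurable_deriv p).aestronglyMeasurable
    refine (integrable_norm_rpow_iff hm (by norm_num) (by norm_num)).1 ?_
    have hint : Integrable (fun s => |deriv p s| ^ 3) (volume.restrict (Ioc (0 : ℝ) 1)) := by
      refine ⟨((measurable_deriv p).abs.pow_const 3).aestronglyMeasurable, ?_⟩
      rw [hasFiniteIntegral_iff_ofReal (Eventually.of_forall fun s => by positivity)]
      exact hfatou.trans_lt ENNReal.ofReal_lt_top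
    refine hint.congr (Eventually.of_forall fun s => ?_)
    simp
  · have := (hac.mono (c := 0) (d := t) (by
      rw [uIcc_of_le zero_le_one, uIcc_of_le ht.1]
      exact Icc_subset_Icc_right ht.2)).integral_deriv_eq_sub
    rw [this]
    ring

end CubicIncrements

/-! ### The scheme for dx = x dp: recursion of the error -/

section Exponential

theorem cube_le_exp_sub {x : ℝ} (hx : 0 ≤ x) :
    x ^ 3 / 6 ≤ Real.exp x - 1 - x - x ^ 2 / 2 := by
  have := Real.sum_le_exp_of_nonneg hx 4
  simp [Finset.sum_range_succ, Nat.factorial] at this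
  linarith

/-- For x ≥ 0 the exponential series suffices. For negative x the remainder is negative, and after
multiplication by e^{-x} it is compared with the same series. -/
theorem cube_le_abs_exp_sub {x B : ℝ} (hx : |x| ≤ B) :
    |x| ^ 3 * Real.exp (-B) / 6 ≤ |Real.exp x - 1 - x - x ^ 2 / 2| := by
  have hB0 : 0 ≤ B := (abs_nonneg x).trans hx
  rcases le_total 0 x with h | h
  · have h1 := cube_le_exp_sub h
    have h2 : Real.exp (-B) ≤ 1 := Real.exp_le_one_iff.2 (by linarith)
    have h3 : 0 ≤ x ^ 3 := by positivity
    rw [abs_of_nonneg h, abs_of_nonneg (le_trans (by positivity) h1)]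
    nlinarith
  · obtain ⟨z, rfl⟩ : ∃ z, x = -z := ⟨-x, by ring⟩
    have hz : 0 ≤ z := by linarith
    have h1 := cube_le_exp_sub hz
    rw [abs_neg, abs_of_nonneg hz] at hx ⊢
    have hq : 0 ≤ 1 - z + z ^ 2 / 2 := by nlinarith [sq_nonneg (z - 1)]
    -- The cubic Taylor polynomial of e^z times 1 - z + z²/2 equals 1 + z³/6 + z⁴/12 + z⁵/12.
    have h2 : z ^ 3 / 6 ≤ Real.exp z * (1 - z + z ^ 2 / 2) - 1 := by
      have h3 : (1 + z + z ^ 2 / 2 + z ^ 3 / 6) * (1 - z + z ^ 2 / 2) ≤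
          Real.exp z * (1 - z + z ^ 2 / 2) :=
        mul_le_mul_of_nonneg_right (by linarith) hq
      have h4 : 0 ≤ z ^ 4 / 12 + z ^ 5 / 12 := by positivity
      nlinarith
    have h5 : Real.exp (-z) * (z ^ 3 / 6) ≤ (1 - z + z ^ 2 / 2) - Real.exp (-z) := by
      have := mul_le_mul_of_nonneg_left h2 (Real.exp_pos (-z)).le
      rw [mul_sub, ← mul_assoc, ← Real.exp_add] at this
      simpa using this
    have h6 : Real.exp (-B) ≤ Real.exp (-z) := Real.exp_le_exp.2 (by linarith)
    have h7 : 0 ≤ z ^ 3 := by positivity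
    rw [abs_of_nonpos (by nlinarith [Real.exp_pos (-z)])]
    nlinarith

variable {p g : ℕ → ℝ}

/-- One step of the error recursion of the scheme for `dx = x dp`. -/
theorem exp_error_step {k : ℕ}
    (hg : g (k + 1) = g k * (1 + (p (k + 1) - p k) + (p (k + 1) - p k) ^ 2 / 2)) :
    (g (k + 1) - Real.exp (p (k + 1))) - (g k - Real.exp (p k)) =
      (g k - Real.exp (p k)) * ((p (k + 1) - p k) + (p (k + 1) - p k) ^ 2 / 2) -
        Real.exp (p k) * (Real.exp (p (k + 1) - p k) - 1 - (p (k + 1) - p k) -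
          (p (k + 1) - p k) ^ 2 / 2) := by
  have : Real.exp (p (k + 1)) = Real.exp (p k) * Real.exp (p (k + 1) - p k) := by
    rw [← Real.exp_add]; ring_nf
  rw [this, hg]
  ring

/-- The recursion isolates the local error, of size at least a constant times |Δ|³, as feedback of
the accumulated error minus its increment. Both are summable: the error starts at 0, hence is
bounded by its variation A, and the |Δ| sum to at most V. -/
theorem sum_cube_le_of_error_variation
    {n : ℕ}
    (hg : ∀ k < n, g (k + 1) = g k * (1 + (p (k + 1) - p k) + (p (k + 1) - p k) ^ 2 / 2))
    (hg0 : g 0 = Real.exp (p 0)) {B V A : ℝ}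
    (hB : ∀ k ≤ n, |p k| ≤ B) (hV : ∑ k ∈ Finset.range n, |p (k + 1) - p k| ≤ V)
    (hA : ∑ k ∈ Finset.range n,
      |(g (k + 1) - Real.exp (p (k + 1))) - (g k - Real.exp (p k))| ≤ A) :
    ∑ k ∈ Finset.range n, |p (k + 1) - p k| ^ 3 ≤
      6 * Real.exp (3 * B) * (A * (1 + V * (1 + B))) := by
  set u : ℕ → ℝ := fun k => g k - Real.exp (p k) with hu
  have hA0 : 0 ≤ A := (Finset.sum_nonneg fun _ _ => abs_nonneg _).trans hA
  have hB0 : 0 ≤ B := (abs_nonneg _).trans (hB 0 (Nat.zero_le n))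
  have hu0 : u 0 = 0 := by simp [hu, hg0]
  have huk : ∀ k ≤ n, |u k| ≤ A := by
    intro k hk
    have e : u k = ∑ i ∈ Finset.range k, (u (i + 1) - u i) := by
      rw [Finset.sum_range_sub, hu0, sub_zero]
    rw [e]
    exact (Finset.abs_sum_le_sum_abs _ _).trans ((Finset.sum_le_sum_of_subset_of_nonneg
      (Finset.range_subset_range.2 hk) fun _ _ _ => abs_nonneg _).trans hA)
  -- The exponent 3B combines exp(p k) ≥ e^{-B} with the bound 2B on the increment.
  have hstep : ∀ k ∈ Finset.range n, Real.exp (-(3 * B)) / 6 * |p (k + 1) - p k| ^ 3 ≤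
      |u (k + 1) - u k| + A * (1 + B) * |p (k + 1) - p k| := by
    intro k hk
    have hk' := Finset.mem_range.1 hk
    have b1 := abs_le.1 (hB k hk'.le)
    have b2 := abs_le.1 (hB (k + 1) hk')
    set Δ := p (k + 1) - p k with hΔ
    have hΔB : |Δ| ≤ 2 * B := by rw [abs_le]; constructor <;> linarith [b1.1, b1.2, b2.1, b2.2]
    have hrec := exp_error_step (hg k hk')
    have h1 := cube_le_abs_exp_sub hΔB
    have h2 : Real.exp (-B) ≤ Real.exp (p k) := Real.exp_le_exp.2 b1.1
    set ρ := Real.exp Δ - 1 - Δ - Δ ^ 2 / 2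
    have h3 : Real.exp (-B) * (|Δ| ^ 3 * Real.exp (-(2 * B)) / 6) ≤ Real.exp (p k) * |ρ| :=
      mul_le_mul h2 h1 (by positivity) (Real.exp_pos _).le
    have e1 : Real.exp (-(3 * B)) / 6 * |Δ| ^ 3 =
        Real.exp (-B) * (|Δ| ^ 3 * Real.exp (-(2 * B)) / 6) := by
      rw [show -(3 * B) = -B + -(2 * B) by ring, Real.exp_add]; ring
    have e2 : Real.exp (p k) * |ρ| = |u k * (Δ + Δ ^ 2 / 2) - (u (k + 1) - u k)| := by
      have e3 : u k * (Δ + Δ ^ 2 / 2) - (u (k + 1) - u k) = Real.exp (p k) * ρ := by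
        change u k * (Δ + Δ ^ 2 / 2) -
          ((g (k + 1) - Real.exp (p (k + 1))) - (g k - Real.exp (p k))) = _
        rw [hrec]
        ring
      rw [e3, abs_mul, abs_of_pos (Real.exp_pos _)]
    have h4 : |u k * (Δ + Δ ^ 2 / 2)| ≤ A * (1 + B) * |Δ| := by
      have e4 : u k * (Δ + Δ ^ 2 / 2) = u k * (1 + Δ / 2) * Δ := by ring
      rw [e4, abs_mul, abs_mul]
      have h5 : |1 + Δ / 2| ≤ 1 + B := by
        have := abs_le.1 hΔB
        rw [abs_le]; constructor <;> linarith [this.1, this.2]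
      gcongr
      exact huk k hk'.le
    rw [e1]
    refine h3.trans ?_
    rw [e2]
    refine (abs_sub _ _).trans ?_
    linarith
  have hsum := Finset.sum_le_sum hstep
  rw [← Finset.mul_sum, Finset.sum_add_distrib, ← Finset.mul_sum] at hsum
  have h6 : A * (1 + B) * ∑ k ∈ Finset.range n, |p (k + 1) - p k| ≤ A * (1 + B) * V := by gcongr
  have h7 : Real.exp (-(3 * B)) / 6 * ∑ k ∈ Finset.range n, |p (k + 1) - p k| ^ 3 ≤
      A * (1 + V * (1 + B)) := by
    have : ∑ k ∈ Finset.range n, |u (k + 1) - u k| ≤ A := hA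
    linarith
  have e5 : ∑ k ∈ Finset.range n, |p (k + 1) - p k| ^ 3 = 6 * Real.exp (3 * B) *
      (Real.exp (-(3 * B)) / 6 * ∑ k ∈ Finset.range n, |p (k + 1) - p k| ^ 3) := by
    rw [Real.exp_neg]; field_simp
  rw [e5]
  gcongr

/-- For increasing p both the local error and the feedback drive the scheme further below the
exponential. Without cancellation the final error dominates the whole sum. -/
theorem sum_cube_le_of_monotone
    {n : ℕ}
    (hg : ∀ k < n, g (k + 1) = g k * (1 + (p (k + 1) - p k) + (p (k + 1) - p k) ^ 2 / 2))
    (hg0 : g 0 = Real.exp (p 0)) (hp0 : 0 ≤ p 0)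
    (hp : ∀ k < n, p k ≤ p (k + 1)) :
    ∑ k ∈ Finset.range n, |p (k + 1) - p k| ^ 3 ≤ 6 * |g n - Real.exp (p n)| := by
  -- Nonnegativity of p k is carried along because it gives exp(p k) ≥ 1.
  have key : ∀ k ≤ n, 0 ≤ p k ∧
      (∑ i ∈ Finset.range k, |p (i + 1) - p i| ^ 3) / 6 ≤ -(g k - Real.exp (p k)) := by
    intro k hk
    induction k with
    | zero => simp [hg0, hp0]
    | succ k ih =>
      obtain ⟨h1, h2⟩ := ih (by omega)
      have h3 := hp k (by omega)
      refine ⟨h1.trans h3, ?_⟩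
      have hrec := exp_error_step (hg k hk)
      set Δ := p (k + 1) - p k with hΔ
      have hΔ0 : 0 ≤ Δ := by linarith
      have h4 := cube_le_exp_sub hΔ0
      have h5 : 1 ≤ Real.exp (p k) := Real.one_le_exp h1
      have h6 : 0 ≤ -(g k - Real.exp (p k)) := le_trans (by positivity) h2
      have h7 : 0 ≤ Δ ^ 3 := by positivity
      rw [Finset.sum_range_succ, ← hΔ, abs_of_nonneg hΔ0]
      have h8 : 0 ≤ -(g k - Real.exp (p k)) * (Δ + Δ ^ 2 / 2) := mul_nonneg h6 (by positivity)
      have h9 : Δ ^ 3 / 6 ≤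
          Real.exp (p k) * (Real.exp Δ - 1 - Δ - Δ ^ 2 / 2) := by nlinarith
      linarith
  have := (key n le_rfl).2
  have := neg_le_abs (g n - Real.exp (p n))
  linarith

end Exponential

/-! ### The linear test equation -/

section LinearCoefficient

variable {q d : ℕ} (i₀ : Fin q) (j₀ : Fin d)

/-- The coefficient of the equation `dx^{i₀} = x^{i₀} dY^{j₀}`, the other coordinates being
constant. -/
def linCoeff (x : Fin q → ℝ) : Matrix (Fin q) (Fin d) ℝ :=
  Matrix.of fun i j => if i = i₀ ∧ j = j₀ then x i₀ else 0

theorem isCoefficient_linCoeff : IsCoefficient (linCoeff i₀ j₀) := by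
  refine ⟨fun i j => ?_, 1, fun x i j => ?_⟩
  · by_cases h : i = i₀ ∧ j = j₀
    · simp only [linCoeff, Matrix.of_apply, if_pos h]
      exact contDiff_apply ℝ ℝ i₀
    · simp only [linCoeff, Matrix.of_apply, if_neg h]
      exact contDiff_const
  · have h1 := norm_le_pi_norm x i₀
    rw [Real.norm_eq_abs] at h1
    have h2 := norm_nonneg x
    by_cases h : i = i₀ ∧ j = j₀
    · simp only [linCoeff, Matrix.of_apply, if_pos h]
      linarith
    · simp only [linCoeff, Matrix.of_apply, if_neg h, abs_zero]
      linarith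

theorem transpose_mul_Df_linCoeff (x : Fin q → ℝ) (l j : Fin d) :
    ((linCoeff i₀ j₀ x)ᵀ * Df (linCoeff i₀ j₀) i₀ x) l j =
      if l = j₀ ∧ j = j₀ then x i₀ else 0 := by
  have hp : partialD i₀ (fun z => linCoeff i₀ j₀ z i₀ j) x = if j = j₀ then 1 else 0 := by
    by_cases h : j = j₀
    · have e : (fun z : Fin q → ℝ => linCoeff i₀ j₀ z i₀ j) =
          (ContinuousLinearMap.proj i₀ : (Fin q → ℝ) →L[ℝ] ℝ) := by
        ext z; simp [linCoeff, h]
      rw [partialD, e, ContinuousLinearMap.fderiv]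
      simp [h]
    · have e : (fun z : Fin q → ℝ => linCoeff i₀ j₀ z i₀ j) = fun _ => 0 := by
        ext z; simp [linCoeff, h]
      rw [partialD, e]
      simp [h]
  rw [Matrix.mul_apply, Finset.sum_eq_single i₀]
  · rw [Matrix.transpose_apply, Df, Matrix.of_apply, hp]
    by_cases h1 : l = j₀ <;> by_cases h2 : j = j₀ <;> simp [linCoeff, h1, h2]
  · intro k _ hk
    simp [linCoeff, hk]
  · simp

theorem stieltjes_zero (y : ℝ → ℝ) (a b : ℝ) : stieltjes (fun _ => 0) y a b = 0 := by
  unfold stieltjes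
  split_ifs <;> simp

variable {i₀ j₀} {Y : ℝ → Fin d → ℝ}

theorem IsContinuousFV.continuousOn_apply (hY : IsContinuousFV Y) (j : Fin d) :
    ContinuousOn (fun s => Y s j) (Icc 0 1) :=
  (continuous_apply j).comp_continuousOn hY.2.1

theorem IsContinuousFV.boundedVariationOn_apply (hY : IsContinuousFV Y) (j : Fin d) :
    BoundedVariationOn (fun s => Y s j) (Icc 0 1) := by
  refine ne_top_of_le_ne_top hY.2.2 ?_
  refine iSup_le fun p => le_trans (Finset.sum_le_sum fun i _ => ?_)
    (eVariationOn.sum_le (f := Y) (n := p.1) p.2.2.1 p.2.2.2)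
  exact edist_le_pi_edist (Y _) (Y _) j

variable (i₀ j₀) in
/-- The solution `exp(Y^{j₀})` in the coordinate `i₀`. -/
def expSolution (Y : ℝ → Fin d → ℝ) (t : ℝ) : Fin q → ℝ := Pi.single i₀ (Real.exp (Y t j₀))

theorem isSolution_expSolution (hY : IsContinuousFV Y) :
    IsSolution (linCoeff i₀ j₀) (Pi.single i₀ 1) Y (expSolution i₀ j₀ Y) := by
  have hc := hY.continuousOn_apply j₀
  refine ⟨?_, fun t ht i => ?_⟩
  · refine continuousOn_pi.2 fun i => ?_
    by_cases h : i = i₀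
    · subst h
      simp only [expSolution, Pi.single_eq_same]
      exact Real.continuous_exp.comp_continuousOn hc
    · simp only [expSolution, Pi.single_eq_of_ne h]
      exact continuousOn_const
  · by_cases h : i = i₀
    · subst h
      rw [Finset.sum_eq_single j₀]
      · have e : (fun s => linCoeff i j₀ (expSolution i j₀ Y s) i j₀) =
            fun s => Real.exp (Y s j₀) := by
          ext s; simp [linCoeff, expSolution]
        rw [e, stieltjes_deriv_comp (F := Real.exp) (F' := Real.exp) hc
          (hY.boundedVariationOn_apply j₀) Real.hasDerivAt_exp Real.continuous_exp le_rfl ht.1 ht.2]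
        simp [expSolution, hY.1]
      · intro j _ hj
        have e : (fun s => linCoeff i j₀ (expSolution i j₀ Y s) i j) = fun _ => 0 := by
          ext s; simp [linCoeff, hj]
        rw [e, stieltjes_zero]
      · simp
    · have e : ∀ j, (fun s => linCoeff i₀ j₀ (expSolution i₀ j₀ Y s) i j) = fun _ => 0 := fun j => by
        ext s; simp [linCoeff, h]
      simp only [e, stieltjes_zero]
      simp [expSolution, h]

/-- The chain rule evaluates the iterated integral as half the squared increment; no density of Y is
available at this stage. -/
theorem step_linCoeff (hY : IsContinuousFV Y) (x : Fin q → ℝ) {a t : ℝ} (ha : 0 ≤ a) (hat : a ≤ t)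
    (ht : t ≤ 1) :
    step (linCoeff i₀ j₀) Y x a t i₀ =
      x i₀ * (1 + (Y t j₀ - Y a j₀) + (Y t j₀ - Y a j₀) ^ 2 / 2) := by
  have hs : stieltjes (fun s => Y s j₀ - Y a j₀) (fun s => Y s j₀) a t =
      (Y t j₀ - Y a j₀) ^ 2 / 2 := by
    have hd : ∀ z, HasDerivAt (fun z => (z - Y a j₀) ^ 2 / 2) (z - Y a j₀) z := fun z => by
      have := (((hasDerivAt_id z).sub_const (Y a j₀)).pow 2).div_const 2
      have e : ((2 : ℕ) : ℝ) * (id z - Y a j₀) ^ (2 - 1) * 1 / 2 = z - Y a j₀ := by simp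
      rw [e] at this
      exact this
    have := stieltjes_deriv_comp (hY.continuousOn_apply j₀) (hY.boundedVariationOn_apply j₀) hd
      (by fun_prop) ha hat ht
    rw [this]
    simp
  rw [step]
  have e1 : ∑ j, linCoeff i₀ j₀ x i₀ j * (Y t j - Y a j) = x i₀ * (Y t j₀ - Y a j₀) := by
    rw [Finset.sum_eq_single j₀]
    · simp [linCoeff]
    · intro j _ hj; simp [linCoeff, hj]
    · simp
  have e2 : ∑ l, ∑ j, ((linCoeff i₀ j₀ x)ᵀ * Df (linCoeff i₀ j₀) i₀ x) l j *
      stieltjes (fun s => Y s l - Y a l) (fun s => Y s j) a t =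
      x i₀ * ((Y t j₀ - Y a j₀) ^ 2 / 2) := by
    simp only [transpose_mul_Df_linCoeff]
    rw [Finset.sum_eq_single j₀, Finset.sum_eq_single j₀]
    · simp [hs]
    · intro j _ hj; simp [hj]
    · simp
    · intro l _ hl; simp [hl]
    · simp
  rw [e1, e2]
  ring

theorem scheme_linCoeff_grid (hY : IsContinuousFV Y) {n : ℕ} (hn : 0 < n) (k : ℕ) :
    scheme (linCoeff i₀ j₀) (Pi.single i₀ 1) Y n ((k : ℝ) / n) i₀ =
      grid (linCoeff i₀ j₀) (Pi.single i₀ 1) Y n k i₀ := by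
  have hn' : (0 : ℝ) < n := by exact_mod_cast hn
  cases k with
  | zero =>
    rw [scheme_eq_step, Nat.cast_zero, zero_div, base, cell_zero, lo_zero,
      step_linCoeff hY _ le_rfl le_rfl zero_le_one]
    simp
  | succ k =>
    have h1 : (k : ℝ) / n < ((k : ℝ) + 1) / n := by gcongr; linarith
    rw [scheme_eq_step, Nat.cast_add, Nat.cast_one, base, cell_eq hn h1 le_rfl,
      lo_eq hn h1 le_rfl, grid]

theorem grid_linCoeff_succ (hY : IsContinuousFV Y) {n k : ℕ} (hk : k < n) :
    grid (linCoeff i₀ j₀) (Pi.single i₀ 1) Y n (k + 1) i₀ =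
      grid (linCoeff i₀ j₀) (Pi.single i₀ 1) Y n k i₀ *
        (1 + (Y (((k : ℝ) + 1) / n) j₀ - Y ((k : ℝ) / n) j₀) +
          (Y (((k : ℝ) + 1) / n) j₀ - Y ((k : ℝ) / n) j₀) ^ 2 / 2) := by
  rw [grid, step_linCoeff hY _ (by positivity) cell_le
    (cell_Ioc_subset hk ⟨cell_le, le_rfl⟩).2]

end LinearCoefficient

/-! ### From the error to cubed increments -/

section Necessity

theorem sum_edist_grid_le {V : Type*} [PseudoEMetricSpace V] (u : ℝ → V) {n : ℕ} (hn : 0 < n) :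
    ∑ k ∈ Finset.range n, edist (u (((k : ℝ) + 1) / n)) (u ((k : ℝ) / n)) ≤
      eVariationOn u (Icc 0 1) := by
  have hn' : (0 : ℝ) < n := by exact_mod_cast hn
  -- The index is capped at n, since the sequence must be monotone and stay in [0,1] for all
  -- indices.
  have h := eVariationOn.sum_le (f := u) (s := Icc 0 1) (n := n)
    (u := fun k => ((min k n : ℕ) : ℝ) / n) (fun a b hab => by
      simp only
      gcongr) fun k => ⟨by positivity, (div_le_one hn').2 (by exact_mod_cast min_le_right k n)⟩
  refine le_trans (Finset.sum_le_sum fun k hk => ?_) h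
  have hk' := Finset.mem_range.1 hk
  rw [min_eq_left hk'.le, min_eq_left (Nat.succ_le_of_lt hk')]
  push_cast
  exact le_rfl

variable {q d : ℕ} {i₀ : Fin q} {j₀ : Fin d} {Y : ℝ → Fin d → ℝ}

/-- The variation of the error along the grid is at most C/n², and the factor n² cancels. -/
theorem exists_cubic_bound_of_variation (hY : IsContinuousFV Y) {C : NNReal}
    (hC : ∀ n : ℕ, 1 ≤ n → (n : ENNReal) ^ 2 * eVariationOn (fun t =>
      scheme (linCoeff i₀ j₀) (Pi.single i₀ 1) Y n t - expSolution i₀ j₀ Y t) (Icc 0 1) ≤ C) :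
    ∃ K : ℝ, ∀ n : ℕ, 1 ≤ n → (n : ℝ) ^ 2 * ∑ k ∈ Finset.range n,
      |Y (((k : ℝ) + 1) / n) j₀ - Y ((k : ℝ) / n) j₀| ^ 3 ≤ K := by
  obtain ⟨B, hB⟩ := isCompact_Icc.exists_bound_of_continuousOn (hY.continuousOn_apply j₀)
  set V := (eVariationOn (fun s => Y s j₀) (Icc 0 1)).toReal with hV
  refine ⟨6 * Real.exp (3 * B) * (C * (1 + V * (1 + B))), fun n hn => ?_⟩
  have hn' : (0 : ℝ) < n := by exact_mod_cast hn
  set p : ℕ → ℝ := fun k => Y ((k : ℝ) / n) j₀ with hp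
  set g : ℕ → ℝ := fun k => grid (linCoeff i₀ j₀) (Pi.single i₀ 1) Y n k i₀ with hg
  have hp1 : ∀ k, p (k + 1) = Y (((k : ℝ) + 1) / n) j₀ := fun k => by simp [hp]
  set u : ℝ → Fin q → ℝ := fun t =>
    scheme (linCoeff i₀ j₀) (Pi.single i₀ 1) Y n t - expSolution i₀ j₀ Y t with hu
  have hug : ∀ k : ℕ, u ((k : ℝ) / n) i₀ = g k - Real.exp (p k) := fun k => by
    simp only [hu, hg, hp, Pi.sub_apply, scheme_linCoeff_grid hY hn, expSolution,
      Pi.single_eq_same]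
  have hvarY : ∑ k ∈ Finset.range n, |p (k + 1) - p k| ≤ V := by
    have h := sum_edist_grid_le (fun s => Y s j₀) hn
    have h' := ENNReal.toReal_mono (hY.boundedVariationOn_apply j₀) h
    rw [ENNReal.toReal_sum fun _ _ => edist_ne_top _ _] at h'
    refine le_trans (le_of_eq (Finset.sum_congr rfl fun k _ => ?_)) h'
    rw [hp1, ← Real.dist_eq, edist_dist, ENNReal.toReal_ofReal dist_nonneg]
  have hvarU : ∑ k ∈ Finset.range n,
      |(g (k + 1) - Real.exp (p (k + 1))) - (g k - Real.exp (p k))| ≤ C / (n : ℝ) ^ 2 := by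
    have h := sum_edist_grid_le u hn
    have h1 : ENNReal.ofReal (∑ k ∈ Finset.range n,
        |(g (k + 1) - Real.exp (p (k + 1))) - (g k - Real.exp (p k))|) ≤
        eVariationOn u (Icc 0 1) := by
      refine le_trans ?_ h
      rw [ENNReal.ofReal_sum_of_nonneg fun _ _ => abs_nonneg _]
      refine Finset.sum_le_sum fun k _ => ?_
      refine le_trans (le_of_eq ?_) (edist_le_pi_edist _ _ i₀)
      rw [hug, ← hug (k + 1), edist_dist, Real.dist_eq]
      push_cast
      rfl
    have h2 := (mul_le_mul_right h1 ((n : ENNReal) ^ 2)).trans (hC n hn)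
    rw [← ENNReal.ofReal_natCast, ← ENNReal.ofReal_pow hn'.le, ← ENNReal.ofReal_mul (by positivity),
      ENNReal.ofReal_le_iff_le_toReal ENNReal.coe_ne_top, ENNReal.coe_toReal] at h2
    rw [le_div_iff₀ (by positivity), mul_comm]
    exact h2
  have := sum_cube_le_of_error_variation (p := p) (g := g) (n := n) (B := B)
    (fun k hk => by
      rw [hp1]
      exact grid_linCoeff_succ hY hk) (by simp [hg, hp, grid, hY.1]) (fun k hk => hB _
      ⟨by positivity, (div_le_one hn').2 (by exact_mod_cast hk)⟩) hvarY hvarU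
  simp only [hp1] at this
  calc _ ≤ (n : ℝ) ^ 2 * (6 * Real.exp (3 * B) * (C / (n : ℝ) ^ 2 * (1 + V * (1 + B)))) := by
        gcongr
    _ = _ := by field_simp

/-- Only time 1 matters: a convergent sequence is bounded, and monotonicity turns the final error
into a bound for the sum. -/
theorem exists_cubic_bound_of_convergence (hY : IsContinuousFV Y) (hmono : MonotoneOn Y (Icc 0 1))
    {U : ℝ → Fin q → ℝ} (hU : TendstoUniformlyOn (fun (n : ℕ) t => (n : ℝ) ^ 2 •
      (scheme (linCoeff i₀ j₀) (Pi.single i₀ 1) Y n t - expSolution i₀ j₀ Y t)) U atTop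
        (Icc 0 1)) :
    ∃ K : ℝ, ∀ n : ℕ, 1 ≤ n → (n : ℝ) ^ 2 * ∑ k ∈ Finset.range n,
      |Y (((k : ℝ) + 1) / n) j₀ - Y ((k : ℝ) / n) j₀| ^ 3 ≤ K := by
  have h1 := (hU.tendsto_at (⟨zero_le_one, le_rfl⟩ : (1 : ℝ) ∈ Icc (0 : ℝ) 1)).norm
  obtain ⟨C, hC⟩ := h1.bddAbove_range
  refine ⟨6 * C, fun n hn => ?_⟩
  have hn' : (0 : ℝ) < n := by exact_mod_cast hn
  set p : ℕ → ℝ := fun k => Y ((k : ℝ) / n) j₀ with hp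
  set g : ℕ → ℝ := fun k => grid (linCoeff i₀ j₀) (Pi.single i₀ 1) Y n k i₀ with hg
  have hp1 : ∀ k, p (k + 1) = Y (((k : ℝ) + 1) / n) j₀ := fun k => by simp [hp]
  have := sum_cube_le_of_monotone (p := p) (g := g) (n := n)
    (fun k hk => by
      rw [hp1]
      exact grid_linCoeff_succ hY hk) (by simp [hg, hp, grid, hY.1]) (by simp [hp, hY.1])
    (fun k hk => by
      rw [hp1]
      have hs := cell_Ioc_subset hk
      exact hmono (hs ⟨le_rfl, cell_le⟩) (hs ⟨cell_le, le_rfl⟩) cell_le j₀)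
  simp only [hp1] at this
  have hb := hC (mem_range_self n)
  have e : ((n : ℝ) ^ 2 • (scheme (linCoeff i₀ j₀) (Pi.single i₀ 1) Y n 1 -
      expSolution i₀ j₀ Y 1)) i₀ = (n : ℝ) ^ 2 * (g n - Real.exp (p n)) := by
    have e1 := scheme_linCoeff_grid (i₀ := i₀) (j₀ := j₀) hY hn n
    rw [div_self hn'.ne'] at e1
    rw [Pi.smul_apply, Pi.sub_apply, smul_eq_mul, e1]
    simp [hg, hp, expSolution, hn'.ne']
  have hb2 := (norm_le_pi_norm ((n : ℝ) ^ 2 • (scheme (linCoeff i₀ j₀) (Pi.single i₀ 1) Y n 1 -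
      expSolution i₀ j₀ Y 1)) i₀).trans hb
  rw [e, Real.norm_eq_abs, abs_mul, abs_of_nonneg (by positivity : (0 : ℝ) ≤ (n : ℝ) ^ 2)] at hb2
  calc _ ≤ (n : ℝ) ^ 2 * (6 * |g n - Real.exp (p n)|) := by gcongr
    _ = 6 * ((n : ℝ) ^ 2 * |g n - Real.exp (p n)|) := by ring
    _ ≤ 6 * C := by gcongr

end Necessity

/-! ### A jointly measurable density -/

section Density

theorem tendsto_right_quotient {p : ℝ → ℝ} {s : ℝ} (h : DifferentiableAt ℝ p s) :
    Tendsto (fun n : ℕ => ((n : ℝ) + 1) * (p (s + 1 / ((n : ℝ) + 1)) - p s)) atTop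
      (𝓝 (deriv p s)) := by
  have ht : Tendsto (fun n : ℕ => 1 / ((n : ℝ) + 1)) atTop (𝓝[≠] 0) :=
    tendsto_nhdsWithin_iff.2 ⟨tendsto_one_div_add_atTop_nhds_zero_nat,
      Eventually.of_forall fun n => by
        have : (0 : ℝ) < 1 / ((n : ℝ) + 1) := by positivity
        exact this.ne'⟩
  refine (h.hasDerivAt.tendsto_slope_zero.comp ht).congr fun n => ?_
  simp

variable {Ω : Type*} [MeasurableSpace Ω] {P : Measure Ω} {d : ℕ} {Y : Ω → ℝ → Fin d → ℝ}

/-- A continuous process with cubic increments of order `n⁻²` has a measurable density. -/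
theorem exists_isCubicDensity (hYmeas : ∀ t ∈ Icc (0 : ℝ) 1, Measurable fun ω => Y ω t)
    (hY : ∀ᵐ ω ∂P, IsContinuousFV (Y ω))
    (hC : ∀ᵐ ω ∂P, ∀ j, ∃ K : ℝ, ∀ n : ℕ, 1 ≤ n → (n : ℝ) ^ 2 * ∑ k ∈ Finset.range n,
      |Y ω (((k : ℝ) + 1) / n) j - Y ω ((k : ℝ) / n) j| ^ 3 ≤ K) :
    ∃ y, IsCubicDensity P Y y := by
  classical
  -- On a measurable null set the path is replaced by 0. Every path is then continuous, and the
  -- process is jointly measurable.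
  set N := toMeasurable P {ω | ¬ IsContinuousFV (Y ω)} with hN
  have hNm : MeasurableSet N := measurableSet_toMeasurable _ _
  have hN0 : P N = 0 := by rw [hN, measure_toMeasurable]; exact hY
  have hNc : ∀ ω, ω ∉ N → IsContinuousFV (Y ω) := fun ω hω => by
    by_contra h
    exact hω (subset_toMeasurable P _ h)
  set Z : Fin d → ℝ → Ω → ℝ := fun j s ω => if ω ∈ N then 0 else clamp (fun r => Y ω r j) s with hZ
  have hZc : ∀ j ω, Continuous fun s => Z j s ω := fun j ω => by
    by_cases h : ω ∈ N
    · simp only [hZ, if_pos h]; exact continuous_const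
    · simp only [hZ, if_neg h]; exact continuous_clamp ((hNc ω h).continuousOn_apply j)
  have hZm : ∀ j s, Measurable (Z j s) := fun j s =>
    Measurable.ite hNm measurable_const
      ((measurable_pi_apply j).comp (hYmeas _ (projIcc (0 : ℝ) 1 zero_le_one s).2))
  have hZu : ∀ j, Measurable (Function.uncurry (Z j)) := fun j =>
    measurable_uncurry_of_continuous_of_measurable (hZc j) (hZm j)
  -- The upper limit of right difference quotients is jointly measurable and equals the derivative
  -- wherever that exists, so almost everywhere on good paths. Clamping supplies values beyond time
  -- 1.
  refine ⟨fun ω s j => limsup (fun n : ℕ =>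
    ((n : ℝ) + 1) * (Z j (s + 1 / ((n : ℝ) + 1)) ω - Z j s ω)) atTop, ?_, ?_⟩
  · refine measurable_pi_iff.2 fun j => Measurable.limsup fun n => Measurable.const_mul ?_ _
    have m1 : Measurable fun p : Ω × ℝ => Z j (p.2 + 1 / ((n : ℝ) + 1)) p.1 :=
      (hZu j).comp ((measurable_snd.add_const _).prodMk measurable_fst)
    have m2 : Measurable fun p : Ω × ℝ => Z j p.2 p.1 :=
      (hZu j).comp (measurable_snd.prodMk measurable_fst)
    exact m1.sub m2
  · have hNae : ∀ᵐ ω ∂P, ω ∉ N := measure_eq_zero_iff_ae_notMem.1 hN0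
    filter_upwards [hC, hNae] with ω hω hωN j
    obtain ⟨K, hK⟩ := hω j
    have hYω := hNc ω hωN
    set p : ℝ → ℝ := fun s => Z j s ω with hp
    have hpY : ∀ s ∈ Icc (0 : ℝ) 1, p s = Y ω s j := fun s hs => by
      simp only [hp, hZ, if_neg hωN]
      exact clamp_of_mem _ hs
    obtain ⟨h1, h2, h3⟩ := deriv_of_cubic_increments (p := p) (C := K) (hZc j ω).continuousOn
      fun n hn => by
        refine le_trans (le_of_eq ?_) (hK n hn)
        congr 1
        refine Finset.sum_congr rfl fun k hk => ?_
        have hs := cell_Ioc_subset (Finset.mem_range.1 hk)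
        rw [hpY _ (hs ⟨le_rfl, cell_le⟩), hpY _ (hs ⟨cell_le, le_rfl⟩)]
    have hae : (fun s => limsup (fun n : ℕ =>
        ((n : ℝ) + 1) * (Z j (s + 1 / ((n : ℝ) + 1)) ω - Z j s ω)) atTop)
        =ᵐ[volume.restrict (Icc (0 : ℝ) 1)] deriv p := by
      filter_upwards [h3] with s hs
      exact (tendsto_right_quotient hs).limsup_eq
    refine ⟨(memLp_congr_ae hae).2 h1, fun t ht => ?_⟩
    have h0 : p 0 = 0 := by
      rw [hpY 0 ⟨le_rfl, zero_le_one⟩, hYω.1]; rfl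
    rw [← hpY t ht, h2 t ht, h0, zero_add]
    refine (intervalIntegral.integral_congr_ae ?_).symm
    filter_upwards [(ae_restrict_iff' measurableSet_Icc).1 hae] with s hs hst
    rw [uIoc_of_le ht.1] at hst
    exact hs ⟨hst.1.le, hst.2.trans ht.2⟩

end Density

/-! ### From single paths to the process -/

section Equivalence

variable {Ω : Type*} [MeasurableSpace Ω] {P : Measure Ω} {d q : ℕ} {Y : Ω → ℝ → Fin d → ℝ}

theorem exists_isCubicDensity_of_errorVariationBounded (hq : 0 < q)
    (hYmeas : ∀ t ∈ Icc (0 : ℝ) 1, Measurable fun ω => Y ω t)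
    (hY : ∀ᵐ ω ∂P, IsContinuousFV (Y ω)) (h : ErrorVariationBounded P q Y) :
    ∃ y, IsCubicDensity P Y y := by
  refine exists_isCubicDensity hYmeas hY (ae_all_iff.2 fun j => ?_)
  filter_upwards [hY, h (Pi.single ⟨0, hq⟩ 1) (linCoeff ⟨0, hq⟩ j) (isCoefficient_linCoeff _ _)
    (fun ω => expSolution ⟨0, hq⟩ j (Y ω)) (hY.mono fun ω hω => isSolution_expSolution hω)]
    with ω hω hC
  obtain ⟨C, hC⟩ := hC
  exact exists_cubic_bound_of_variation hω hC

theorem exists_isCubicDensity_of_errorConverges (hq : 0 < q)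
    (hYmeas : ∀ t ∈ Icc (0 : ℝ) 1, Measurable fun ω => Y ω t)
    (hY : ∀ᵐ ω ∂P, IsContinuousFV (Y ω)) (hmono : ∀ᵐ ω ∂P, MonotoneOn (Y ω) (Icc 0 1))
    (h : ErrorConverges P q Y) : ∃ y, IsCubicDensity P Y y := by
  refine exists_isCubicDensity hYmeas hY (ae_all_iff.2 fun j => ?_)
  obtain ⟨U, hU⟩ := h (Pi.single ⟨0, hq⟩ 1) (linCoeff ⟨0, hq⟩ j) (isCoefficient_linCoeff _ _)
    (fun ω => expSolution ⟨0, hq⟩ j (Y ω)) (hY.mono fun ω hω => isSolution_expSolution hω)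
  filter_upwards [hY, hmono, hU] with ω h1 h2 h3
  exact exists_cubic_bound_of_convergence h1 h2 h3

theorem IsCubicDensity.ae_isPrimitive {y : Ω → ℝ → Fin d → ℝ} (h : IsCubicDensity P Y y) :
    ∀ᵐ ω ∂P, IsPrimitive (Y ω) ((Icc (0 : ℝ) 1).indicator (y ω)) := by
  filter_upwards [h.2] with ω hω
  exact isPrimitive_indicator (fun l => (hω l).1) fun t ht l => (hω l).2 t ht

theorem errorVariationBounded_of_isCubicDensity {y : Ω → ℝ → Fin d → ℝ}
    (h : IsCubicDensity P Y y) : ErrorVariationBounded P q Y := by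
  intro x₀ f hf X hX
  filter_upwards [h.ae_isPrimitive, hX] with ω h1 h2
  exact exists_variation_bound hf.1 h1 h2

theorem exists_limit_of_isCubicDensity {y : Ω → ℝ → Fin d → ℝ} (h : IsCubicDensity P Y y)
    {x₀ : Fin q → ℝ} {f : (Fin q → ℝ) → Matrix (Fin q) (Fin d) ℝ} (hf : IsCoefficient f)
    {X : Ω → ℝ → Fin q → ℝ} (hX : ∀ᵐ ω ∂P, IsSolution f x₀ (Y ω) (X ω)) :
    ∃ U : Ω → ℝ → Fin q → ℝ, ∀ᵐ ω ∂P,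
      TendstoUniformlyOn
        (fun (n : ℕ) t => (n : ℝ) ^ 2 • (scheme f x₀ (Y ω) n t - X ω t))
        (U ω) atTop (Icc 0 1) ∧
      IsErrorSolution f (y ω) (X ω) (U ω) ∧
      ∀ V, IsErrorSolution f (y ω) (X ω) V → EqOn V (U ω) (Icc 0 1) := by
  have key : ∀ᵐ ω ∂P, ∃ U : ℝ → Fin q → ℝ,
      TendstoUniformlyOn
        (fun (n : ℕ) t => (n : ℝ) ^ 2 • (scheme f x₀ (Y ω) n t - X ω t)) U atTop (Icc 0 1) ∧
      IsErrorSolution f (y ω) (X ω) U ∧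
      ∀ V, IsErrorSolution f (y ω) (X ω) V → EqOn V U (Icc 0 1) := by
    filter_upwards [h.ae_isPrimitive, hX, h.2] with ω h1 h2 h3
    obtain ⟨U, hU1, hU2⟩ := exists_limit hf.1 h1 h2
    -- The error equation involves y on [0,1] only, so the extension by 0 can be undone.
    have hU3 : IsErrorSolution f (y ω) (X ω) U :=
      hU2.congr (fun _ _ => EventuallyEq.rfl) fun s hs => indicator_of_mem hs _
    have hy : ∀ j, IntervalIntegrable (fun s => y ω s j) volume 0 1 := fun j => by
      rw [intervalIntegrable_iff_integrableOn_Icc_of_le zero_le_one]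
      exact (h3 j).1.integrable (by norm_num)
    exact ⟨U, hU1, hU3, fun V hV => errorSolution_unique hf.1 h2.1 hy hU3 hV⟩
  -- The limit is chosen separately for each ω, with an arbitrary value on the exceptional set.
  choose! U hU using fun ω (hω : ∃ U : ℝ → Fin q → ℝ,
      TendstoUniformlyOn
        (fun (n : ℕ) t => (n : ℝ) ^ 2 • (scheme f x₀ (Y ω) n t - X ω t)) U atTop (Icc 0 1) ∧
      IsErrorSolution f (y ω) (X ω) U ∧
      ∀ V, IsErrorSolution f (y ω) (X ω) V → EqOn V U (Icc 0 1)) => hω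
  exact ⟨U, key.mono hU⟩

theorem errorConverges_of_isCubicDensity {y : Ω → ℝ → Fin d → ℝ} (h : IsCubicDensity P Y y) :
    ErrorConverges P q Y := by
  intro x₀ f hf X hX
  obtain ⟨U, hU⟩ := exists_limit_of_isCubicDensity h hf hX
  exact ⟨U, hU.mono fun ω hω => hω.1⟩

end Equivalence

end Milstein

end

theorem theorem3p3 {Ω : Type*} [MeasurableSpace Ω] (P : Measure Ω) [IsProbabilityMeasure P]
    (d q : ℕ) (hq : 0 < q) (Y : Ω → ℝ → Fin d → ℝ)
    (hYmeas : ∀ t ∈ Icc (0 : ℝ) 1, Measurable fun ω => Y ω t)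
    (hY : ∀ᵐ ω ∂P, Milstein.IsContinuousFV (Y ω)) :
    ((∀ᵐ ω ∂P, MonotoneOn (Y ω) (Icc 0 1)) →
      List.TFAE [Milstein.ErrorVariationBounded P q Y,
        Milstein.ErrorConverges P q Y,
        ∃ y, Milstein.IsCubicDensity P Y y]) ∧
    (Milstein.ErrorVariationBounded P q Y ↔ ∃ y, Milstein.IsCubicDensity P Y y) ∧
    ((∃ y, Milstein.IsCubicDensity P Y y) → Milstein.ErrorConverges P q Y) ∧
    (∀ y, Milstein.IsCubicDensity P Y y →
      ∀ (x₀ : Fin q → ℝ) (f : (Fin q → ℝ) → Matrix (Fin q) (Fin d) ℝ),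
        Milstein.IsCoefficient f →
        ∀ X : Ω → ℝ → Fin q → ℝ, (∀ᵐ ω ∂P, Milstein.IsSolution f x₀ (Y ω) (X ω)) →
          ∃ U : Ω → ℝ → Fin q → ℝ, ∀ᵐ ω ∂P,
            TendstoUniformlyOn
              (fun (n : ℕ) t => (n : ℝ) ^ 2 • (Milstein.scheme f x₀ (Y ω) n t - X ω t))
              (U ω) atTop (Icc 0 1) ∧
            Milstein.IsErrorSolution f (y ω) (X ω) (U ω) ∧
            ∀ V, Milstein.IsErrorSolution f (y ω) (X ω) V → EqOn V (U ω) (Icc 0 1)) := by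
  have hac : Milstein.ErrorVariationBounded P q Y → ∃ y, Milstein.IsCubicDensity P Y y :=
    Milstein.exists_isCubicDensity_of_errorVariationBounded hq hYmeas hY
  have hca : (∃ y, Milstein.IsCubicDensity P Y y) → Milstein.ErrorVariationBounded P q Y :=
    fun ⟨_, hy⟩ => Milstein.errorVariationBounded_of_isCubicDensity hy
  have hcb : (∃ y, Milstein.IsCubicDensity P Y y) → Milstein.ErrorConverges P q Y :=
    fun ⟨_, hy⟩ => Milstein.errorConverges_of_isCubicDensity hy
  refine ⟨fun hmono => ?_, ⟨hac, hca⟩, hcb, fun y hy x₀ f hf X hX =>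
    Milstein.exists_limit_of_isCubicDensity hy hf hX⟩
  have hbc : Milstein.ErrorConverges P q Y → ∃ y, Milstein.IsCubicDensity P Y y :=
    Milstein.exists_isCubicDensity_of_errorConverges hq hYmeas hY hmono
  tfae_have 1 → 3 := hac
  tfae_have 3 → 1 := hca
  tfae_have 3 → 2 := hcb
  tfae_have 2 → 3 := hbc
  tfae_finish
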